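/- Theorem 2 (Security of Eunomia$^{\mathrm{DET}}$). Let $\mathsf{DET}=(\mathsf{KeyGen},\mathsf{Enc},\mathsf{Dec})$ be a deterministic encryption scheme on bit strings: $\mathsf{KeyGen}$ is probabilistic polynomial time (ppt), $\mathsf{Enc}$ and $\mathsf{Dec}$ are deterministic polynomial time, decryption inverts encryption, and the length of a ciphertext depends only on the security parameter $\kappa$ and the length of the message. If $\mathsf{Enc}$ with a random key is a pseudorandom function (no ppt oracle machine distinguishes it, with non-negligible advantage, from a uniformly random function with the same output lengths), then Eunomia$^{\mathrm{DET}}$ is IND-CPLA$^{\mathrm{DET}}$ secure: for every ppt adversary $\mathsf{Adv}$ there is a negligible function $\mathrm{negl}$ with $\Pr[\mathsf{Adv}\text{ wins}]\le \frac12+\mathrm{negl}(\kappa)$ for all $\kappa$, the probability being over the coins of $\mathsf{Adv}$, the keys and the bit $b$. Logs. A schema $S$ lists table names with ordered lists of column names, some columns being marked as timestamp columns. A log with schema $S$ gives for each table a list of rows of cell values; values are bit strings, and timestamps and displacements are integers in binary. An equality scheme $\delta$ is a finite set of pairs of columns. The classes of columns are those of the reflexive, symmetric, transitive closure of $\delta$,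 where any two timestamp columns count as related (all timestamps may be compared with each other). Equivalence. For a finite set $C$ of policy constants and a set $D\subseteq C$ of displacements, $L_0\equiv_{(\delta,C,D)}L_1$ means: (1) $L_0$ and $L_1$ have the same schema and the same number of rows in each table; (2) for each class of columns there is a bijection $M$ from the values of $L_0$ in these columns onto the values of $L_1$ in these columns such that, for each cell of $L_0$ in such a column with value $v$, the corresponding cell of $L_1$ has value $M(v)$; $M(v)=v$ if $v\in C$ or $M(v)\in C$; and $|M(v)|=|v|$; (3) if $\vec u,\vec w$ are the sequences of timestamps of $L_0,L_1$ (in the same traversal order), then $|\vec u|=|\vec w|$ and $u_i+d\ge u_j+d'\iff w_i+d\ge w_j+d'$ for all $i,j$ and all $d,d'\in D$. Game. $\mathsf{Adv}(1^\kappa)$ chooses $S,C,D,\delta$ with $D\subseteq C$ and two logs $L_0\ne L_1$ with schema $S$ and $L_0\equiv_{(\delta,C,D)}L_1$. The challenger draws a key for each class of columns, independently by $\mathsf{KeyGen}(1^\kappa)$, and a uniform bit $b$. $\mathsf{Adv}$ receives: the log $L_b$ with each cell encrypted with the key of its column; the mOPED structure, which maps $(\mathsf{Enc}(t),\mathsf{Enc}(d))$,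 for each timestamp $t$ of $L_b$ and each $d\in D$ (both encrypted with the key of the timestamp columns), to the rank of $t+d$ among all such sums; the state of this structure after each insertion during its construction; and, for each $c\in C$ and each column of $L_b$ in which $c$ occurs, the encryption of $c$ with the key of that column. $\mathsf{Adv}$ may then ask for the encryption, with the key of any column, of any value that occurs neither in $L_0$ nor in $L_1$. It outputs a bit $b'$ and wins if $b'=b$. -/

import Mathlib

open MeasureTheory

namespace Eunomia

noncomputable section

/-! ### Data: bit strings and binary trees -/

/-- Bit strings: keys, messages, ciphertexts, names and cell values. -/
abbrev Str := List Bool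

/-- Binary trees, the data that programs compute on. -/
inductive Data where
  | nil : Data
  | cons : Data → Data → Data
  deriving DecidableEq

namespace Data

/-- Number of nodes. -/
def size : Data → ℕ
  | nil => 1
  | cons a b => 1 + a.size + b.size

/-- Left subtree (`nil` for the empty tree). -/
def fst : Data → Data
  | nil => nil
  | cons a _ => a

/-- Right subtree (`nil` for the empty tree). -/
def snd : Data → Data
  | nil => nil
  | cons _ b => b

/-- Every tree reads as a list, along its right spine. -/
def toList : Data → List Data
  | nil => []
  | cons a b => a :: b.toList

def ofList : List Data → Data
  | [] => nil
  | a :: l => cons a (ofList l)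

def toBool : Data → Bool
  | nil => false
  | cons _ _ => true

def ofBool (b : Bool) : Data := if b then cons nil nil else nil

def toStr (d : Data) : Str := d.toList.map toBool

def ofStr (s : Str) : Data := ofList (s.map ofBool)

/-- The number `n` in unary, that is `1 ^ n`. -/
def unary (n : ℕ) : Data := ofList (List.replicate n nil)

theorem toList_ofList (l : List Data) : (ofList l).toList = l := by
  induction l with
  | nil => rfl
  | cons a l ih => simp [ofList, toList, ih]

theorem toBool_ofBool (b : Bool) : (ofBool b).toBool = b := by
  cases b <;> rfl

theorem toStr_ofStr (s : Str) : (ofStr s).toStr = s := by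
  simp [toStr, ofStr, toList_ofList, Function.comp_def, toBool_ofBool]

end Data

/-! ### Probabilistic oracle programs with a time count -/

/-- Probabilistic oracle programs: a first-order language on binary trees. Iteration is bounded by
the length of a list that the program has computed; this is no restriction on machines that halt
within a polynomial number of steps whatever their coins and oracle are, since the polynomial clock
can be computed by nested iterations and the step function of the machine iterated along it. -/
inductive Prog where
  | id : Prog
  | nil : Prog
  | fst : Prog
  | snd : Prog
  | eq : Prog
  | flip : Prog
  | query : Prog
  | comp : Prog → Prog → Prog
  | pair : Prog → Prog → Prog
  | cond : Prog → Prog → Prog → Prog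
  | iter : Prog → Prog

/-- An elementary operation that turns `x` into `y`; its time is one plus the amount of data read
and written. (Duplicating data is thus paid for, and nothing of more than polynomial size can be
produced in polynomial time.) -/
def step (x y : Data) : PMF (Data × ℕ) := PMF.pure (y, 1 + x.size + y.size)

/-- Sequencing; the times add up. -/
def andThen (m : PMF (Data × ℕ)) (f : Data → PMF (Data × ℕ)) : PMF (Data × ℕ) :=
  m.bind fun r => (f r.1).map fun s => (s.1, r.2 + s.2)

namespace Prog

/-- Semantics of a program with oracle `O`: the joint distribution of the output and the time. -/
def eval (O : Data → Data) : Prog → Data → PMF (Data × ℕ)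
  | id => fun x => step x x
  | nil => fun x => step x Data.nil
  | fst => fun x => step x x.fst
  | snd => fun x => step x x.snd
  | eq => fun x => step x (Data.ofBool (decide (x.fst = x.snd)))
  | flip => fun x => (PMF.uniformOfFintype Bool).bind fun b => step x (Data.ofBool b)
  | query => fun x => step x (O x)
  | comp p q => fun x => andThen (eval O q x) (eval O p)
  | pair p q => fun x =>
      andThen (eval O p x) fun y => andThen (eval O q x) fun z => PMF.pure (Data.cons y z, 1)
  | cond p q r => fun x =>
      andThen (eval O p x) fun y => if y = Data.nil then eval O r x else eval O q x
  | iter p => fun x =>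
      Nat.rec (step x x.snd) (fun _ m => andThen m (eval O p)) x.fst.toList.length

/-- The distribution of the output. -/
def output (O : Data → Data) (p : Prog) (x : Data) : PMF Data := (p.eval O x).map Prod.fst

/-- Probability that the output is read as `true`. -/
def acceptProb (O : Data → Data) (p : Prog) (x : Data) : ENNReal :=
  ((p.output O x).map Data.toBool) true

/-- Probabilistic polynomial time: for all coins, inputs and oracles the time is bounded by a
polynomial in the size of the input. Since reading an oracle reply takes time, the bound may depend
on a polynomial bound on the length of the replies. -/
def PolyTime (p : Prog) : Prop :=
  ∀ L : Polynomial ℕ, ∃ T : Polynomial ℕ, ∀ (O : Data → Data) (x : Data),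
    (∀ q, (O q).size ≤ L.eval (x.size + q.size)) →
      ∀ r ∈ (p.eval O x).support, r.2 ≤ T.eval x.size

end Prog

/-- The trivial oracle, for programs that are run without one. -/
def noOracle : Data → Data := fun _ => Data.nil

/-- Negligible functions of the security parameter. -/
def Negligible (f : ℕ → ℝ) : Prop :=
  ∀ c : ℕ, ∃ K : ℕ, ∀ κ > K, f κ < 1 / (κ : ℝ) ^ c

/-! ### Deterministic encryption and pseudorandom functions -/

/-- A deterministic encryption scheme: probabilistic polynomial-time key generation, and
deterministic polynomial-time encryption and decryption. The length of a ciphertext is determined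
by the security parameter and the length of the message. -/
structure DetEnc where
  keyGen : Prog
  encProg : Prog
  decProg : Prog
  /-- `enc κ k m` is the encryption of `m` with key `k`. -/
  enc : ℕ → Str → Str → Str
  dec : ℕ → Str → Str → Str
  /-- `outLen κ n` is the length of the encryption of a message of length `n`. -/
  outLen : ℕ → ℕ → ℕ
  keyGen_polyTime : keyGen.PolyTime
  encProg_polyTime : encProg.PolyTime
  decProg_polyTime : decProg.PolyTime
  encProg_output : ∀ O κ k m,
    encProg.output O (.cons (Data.unary κ) (.cons (Data.ofStr k) (Data.ofStr m))) =
      PMF.pure (Data.ofStr (enc κ k m))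
  decProg_output : ∀ O κ k c,
    decProg.output O (.cons (Data.unary κ) (.cons (Data.ofStr k) (Data.ofStr c))) =
      PMF.pure (Data.ofStr (dec κ k c))
  enc_length : ∀ κ, ∀ k ∈ ((keyGen.output noOracle (Data.unary κ)).map Data.toStr).support,
    ∀ m, (enc κ k m).length = outLen κ m.length
  dec_enc : ∀ κ, ∀ k ∈ ((keyGen.output noOracle (Data.unary κ)).map Data.toStr).support,
    ∀ m, dec κ k (enc κ k m) = m

/-- A function on bit strings as an oracle. -/
def strOracle (f : Str → Str) : Data → Data := fun q => Data.ofStr (f q.toStr)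

/-- Independent fair bits, indexed by a bit string and a position. -/
def fairBits : Measure (Str × ℕ → Bool) :=
  Measure.infinitePi fun _ => (PMF.uniformOfFintype Bool).toMeasure

/-- For `ω` distributed as `fairBits`, a uniformly random function on bit strings that maps strings
of length `n` to strings of length `len n`. -/
def randomFunction (len : ℕ → ℕ) (ω : Str × ℕ → Bool) (m : Str) : Str :=
  (List.range (len m.length)).map fun i => ω (m, i)

namespace DetEnc

/-- Distribution of the keys for security parameter `κ`. -/
def keyDist (E : DetEnc) (κ : ℕ) : PMF Str :=
  (E.keyGen.output noOracle (Data.unary κ)).map Data.toStr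

/-- Probability that the distinguisher `B` accepts, given the encryption function with a random
key as its oracle. -/
def prfReal (E : DetEnc) (B : Prog) (κ : ℕ) : ENNReal :=
  ((E.keyDist κ).bind fun k =>
    (B.output (strOracle (E.enc κ k)) (Data.unary κ)).map Data.toBool) true

/-- Probability that the distinguisher `B` accepts, given a uniformly random function as its
oracle. -/
def prfIdeal (E : DetEnc) (B : Prog) (κ : ℕ) : ENNReal :=
  ∫⁻ ω, B.acceptProb (strOracle (randomFunction (E.outLen κ) ω)) (Data.unary κ) ∂fairBits

/-- The encryption function is a pseudorandom function. -/
def IsPRF (E : DetEnc) : Prop :=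
  ∀ B : Prog, B.PolyTime →
    Negligible fun κ => |(E.prfReal B κ).toReal - (E.prfIdeal B κ).toReal|

end DetEnc

/-! ### Schemas and logs -/

/-- A column `p.a`, given by the names of the table and of the column. -/
abbrev Col := Str × Str

/-- A schema: table names with their ordered lists of column names; each column is marked as
containing timestamps or not. -/
abbrev Schema := List (Str × List (Str × Bool))

/-- A log: for each table of the schema its rows, each row a list of cell values. -/
abbrev Log := List (List (List Str))

/-- An equality scheme. -/
abbrev EqScheme := List (Col × Col)

/-- Table names are distinct, and so are the column names of a table. -/
def Schema.WellFormed (S : Schema) : Prop :=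
  (S.map Prod.fst).Nodup ∧ ∀ T ∈ S, (T.2.map Prod.fst).Nodup

/-- All columns. -/
def columns (S : Schema) : List Col :=
  S.flatMap fun T => T.2.map fun a => (T.1, a.1)

/-- The columns that contain timestamps. -/
def timeColumns (S : Schema) : List Col :=
  S.flatMap fun T => (T.2.filter fun a => a.2).map fun a => (T.1, a.1)

/-- The log `L` has schema `S`. -/
def HasSchema (S : Schema) (L : Log) : Prop :=
  List.Forall₂ (fun T rows => ∀ r ∈ rows, r.length = T.2.length) S L

/-- All cells with their columns, table by table and, within each table, in row order. -/
def cells (S : Schema) (L : Log) : List (Col × Str) :=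
  (List.zipWith (fun T rows =>
    rows.flatMap fun r => List.zipWith (fun a v => ((T.1, a.1), v)) T.2 r) S L).flatten

/-- The sequence of timestamps of a log. -/
def timeStamps (S : Schema) (L : Log) : List Str :=
  ((cells S L).filter fun e => decide (e.1 ∈ timeColumns S)).map Prod.snd

/-- The integer denoted by a bit string: a sign bit, followed by the binary digits of the absolute
value, least significant digit first (leading zeros are allowed). -/
def toInt : Str → ℤ
  | [] => 0
  | s :: m =>
    if s then -(Nat.ofDigits 2 (m.map Bool.toNat) : ℤ) else (Nat.ofDigits 2 (m.map Bool.toNat) : ℤ)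

/-- Two columns lie in the same class: the reflexive, symmetric, transitive closure of the equality
scheme, to which any two timestamp columns belong, since all timestamps may be compared with each
other. -/
def SameClass (S : Schema) (δ : EqScheme) : Col → Col → Prop :=
  Relation.EqvGen fun a b => (a, b) ∈ δ ∨ (a ∈ timeColumns S ∧ b ∈ timeColumns S)

/-- The values that occur in `L` in the columns of the class of `a`. -/
def classValues (S : Schema) (δ : EqScheme) (L : Log) (a : Col) : Set Str :=
  {v | ∃ a', SameClass S δ a a' ∧ (a', v) ∈ cells S L}

/-- Two sequences of timestamps are equal up to distances with displacements `D`. -/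
def EDD (u v : List Str) (D : List Str) : Prop :=
  u.length = v.length ∧ ∀ d ∈ D, ∀ d' ∈ D, ∀ (i j : ℕ) (ui uj vi vj : Str),
    u[i]? = some ui → u[j]? = some uj → v[i]? = some vi → v[j]? = some vj →
      (toInt ui + toInt d ≥ toInt uj + toInt d' ↔ toInt vi + toInt d ≥ toInt vj + toInt d')

/-- Equivalence of plaintext logs, for the schema `S`, the equality scheme `δ`, the policy constants
`C` and the displacements `D`. The function `M a` is the bijection of the class of `a`. -/
structure LogEquiv (S : Schema) (δ : EqScheme) (C D : List Str) (L₀ L₁ : Log) : Prop where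
  schema₀ : HasSchema S L₀
  schema₁ : HasSchema S L₁
  rows : L₀.map List.length = L₁.map List.length
  bij : ∃ M : Col → Str → Str,
    (∀ a b, SameClass S δ a b → M a = M b) ∧
    (∀ a ∈ columns S, Set.BijOn (M a) (classValues S δ L₀ a) (classValues S δ L₁ a)) ∧
    cells S L₁ = (cells S L₀).map (fun e => (e.1, M e.1 e.2)) ∧
    (∀ e ∈ cells S L₀, (e.2 ∈ C ∨ M e.1 e.2 ∈ C) → M e.1 e.2 = e.2) ∧
    (∀ e ∈ cells S L₀, e.2.length = (M e.1 e.2).length)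
  edd : EDD (timeStamps S L₀) (timeStamps S L₁) D

/-! ### The encryption scheme for logs -/

/-- `n` independent samples. -/
def iid {α : Type} (p : PMF α) : ℕ → PMF (List α)
  | 0 => PMF.pure []
  | n + 1 => p.bind fun a => (iid p n).map fun l => a :: l

/-- A key set: the key of each column. -/
abbrev KeySet := Col → Str

open Classical in
/-- Key generation: the columns of one class share a key (the one drawn for the first column of the
class), and the keys of different classes are independent. -/
def keyGenDET (E : DetEnc) (κ : ℕ) (S : Schema) (δ : EqScheme) : PMF KeySet :=
  (iid (E.keyDist κ) (columns S).length).map fun ks a =>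
    ks.getD ((columns S).findIdx fun a' => decide (SameClass S δ a' a)) []

/-- The key with which timestamps and displacements are encrypted, that is the key of any timestamp
column. -/
def timeKey (S : Schema) (K : KeySet) : Str :=
  match timeColumns S with
  | [] => []
  | a :: _ => K a

/-- Cell-wise encryption of a log; `e k m` is the encryption of `m` with key `k`. -/
def encryptDB (e : Str → Str → Str) (K : KeySet) (S : Schema) (L : Log) : Log :=
  List.zipWith (fun T rows =>
    rows.map fun r => List.zipWith (fun a v => e (K (T.1, a.1)) v) T.2 r) S L

/-- The encoding of timestamps with displacements: a table that maps the encryption of `t` and the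
encryption of `d` to the rank of `t + d`. -/
abbrev OPED := List ((Str × Str) × ℕ)

/-- The rank (starting from one) of `t + d` among the values of all pairs in `P`. -/
def rank (P : List (Str × Str)) (p : Str × Str) : ℕ :=
  ((P.map fun q => toInt q.1 + toInt q.2).toFinset.filter
    fun z => z ≤ toInt p.1 + toInt p.2).card

/-- The encoding of the pairs `(t, d)` in `P`. -/
def oped (enc : Str → Str) (P : List (Str × Str)) : OPED :=
  P.map fun p => ((enc p.1, enc p.2), rank P p)

/-- The pairs `(t, d)` in the order of their insertion. -/
def timePairs (S : Schema) (D : List Str) (L : Log) : List (Str × Str) :=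
  (timeStamps S L).flatMap fun t => D.map fun d => (t, d)

/-- Encryption of a log: the cell-wise encryption and the encoding of the timestamps. -/
def encryptLogDET (e : Str → Str → Str) (K : KeySet) (S : Schema) (D : List Str) (L : Log) :
    Log × OPED :=
  (encryptDB e K S L, oped (e (timeKey S K)) (timePairs S D L))

/-- What can be observed of the construction of the encoding, pair by pair: its state after each
insertion. (These tables determine the result of the comparison of each newly inserted pair with
every earlier one, and hence also every position in a search tree over the encrypted pairs.) -/
def opedConstruction (e : Str → Str → Str) (K : KeySet) (S : Schema) (D : List Str) (L : Log) :
    List OPED :=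
  (timePairs S D L).inits.map (oped (e (timeKey S K)))

/-- The encryptions of the policy constants that occur in the log, with the keys of the columns in
which they occur. -/
def encryptConstants (e : Str → Str → Str) (K : KeySet) (S : Schema) (C : List Str) (L : Log) :
    List (Col × Str × Str) :=
  (columns S).flatMap fun a =>
    (C.filter fun c => decide ((a, c) ∈ cells S L)).map fun c => (a, c, e (K a) c)

/-! ### The indistinguishability game -/

/-- What the adversary chooses: schema, policy constants, displacements, equality scheme and two
logs. -/
structure Challenge where
  schema : Schema
  consts : List Str
  disps : List Str
  eqs : EqScheme
  log₀ : Log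
  log₁ : Log

namespace Challenge

/-- The choice obeys the rules of the game. -/
structure Valid (ch : Challenge) : Prop where
  wellFormed : ch.schema.WellFormed
  disps_subset : ∀ d ∈ ch.disps, d ∈ ch.consts
  equiv : LogEquiv ch.schema ch.eqs ch.consts ch.disps ch.log₀ ch.log₁
  ne : ch.log₀ ≠ ch.log₁

/-- The log selected by the bit. -/
def log (ch : Challenge) (b : Bool) : Log := if b then ch.log₁ else ch.log₀

end Challenge

/-- Reading a column name. -/
def readCol (d : Data) : Col := (d.fst.toStr, d.snd.toStr)

/-- Reading a log. -/
def readLog (d : Data) : Log :=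
  d.toList.map fun t => t.toList.map fun r => r.toList.map Data.toStr

/-- Reading a schema. -/
def readSchema (d : Data) : Schema :=
  d.toList.map fun t => (t.fst.toStr, t.snd.toList.map fun a => (a.fst.toStr, a.snd.toBool))

/-- Reading a tree `(S, (C, (D, (δ, (L₀, L₁)))))` as the choice of the adversary. -/
def readChallenge (d : Data) : Challenge where
  schema := readSchema d.fst
  consts := d.snd.fst.toList.map Data.toStr
  disps := d.snd.snd.fst.toList.map Data.toStr
  eqs := d.snd.snd.snd.fst.toList.map fun p => (readCol p.fst, readCol p.snd)
  log₀ := readLog d.snd.snd.snd.snd.fst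
  log₁ := readLog d.snd.snd.snd.snd.snd

/-- Writing a log. -/
def writeLog (L : Log) : Data :=
  Data.ofList (L.map fun t => Data.ofList (t.map fun r => Data.ofList (r.map Data.ofStr)))

/-- Writing an encoding of timestamps. -/
def writeOPED (T : OPED) : Data :=
  Data.ofList (T.map fun e =>
    .cons (.cons (Data.ofStr e.1.1) (Data.ofStr e.1.2)) (Data.unary e.2))

/-- Writing a list of encrypted constants. -/
def writeConstants (l : List (Col × Str × Str)) : Data :=
  Data.ofList (l.map fun e =>
    .cons (.cons (Data.ofStr e.1.1) (Data.ofStr e.1.2))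
      (.cons (Data.ofStr e.2.1) (Data.ofStr e.2.2)))

/-- All that the adversary receives when the log `L` is encrypted: the encrypted log, the encoding
of the timestamps, the course of its construction, and the encrypted constants. -/
def view (e : Str → Str → Str) (K : KeySet) (ch : Challenge) (L : Log) : Data :=
  .cons (writeLog (encryptLogDET e K ch.schema ch.disps L).1)
    (.cons (writeOPED (encryptLogDET e K ch.schema ch.disps L).2)
      (.cons (Data.ofList ((opedConstruction e K ch.schema ch.disps L).map writeOPED))
        (writeConstants (encryptConstants e K ch.schema ch.consts L))))

/-- The encryption oracle: a query names a column and a value, and is answered by the encryption of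
the value with the key of the column. Values that occur in one of the two logs are refused. -/
def encOracle (e : Str → Str → Str) (K : KeySet) (ch : Challenge) : Data → Data := fun q =>
  if readCol q.fst ∈ columns ch.schema ∧
      q.snd.toStr ∉ ch.log₀.flatten.flatten ∧ q.snd.toStr ∉ ch.log₁.flatten.flatten then
    Data.ofStr (e (K (readCol q.fst)) q.snd.toStr)
  else Data.nil

/-- An adversary. Given the security parameter in unary, `choose` outputs its choice together with
a state (up to this point the adversary is sent nothing). From the security parameter, the state and
what the adversary receives, `guess` outputs a guess of the bit, with access to the encryption
oracle. -/
structure Adversary where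
  choose : Prog
  guess : Prog

namespace Adversary

/-- The adversary runs in probabilistic polynomial time. -/
def IsPPT (A : Adversary) : Prop := A.choose.PolyTime ∧ A.guess.PolyTime

/-- The choice of the adversary always obeys the rules of the game. -/
def IsAdmissible (A : Adversary) : Prop :=
  ∀ κ, ∀ d ∈ (A.choose.output noOracle (Data.unary κ)).support, (readChallenge d.fst).Valid

end Adversary

/-- The game; the result tells whether the adversary wins. -/
def game (E : DetEnc) (A : Adversary) (κ : ℕ) : PMF Bool :=
  (A.choose.output noOracle (Data.unary κ)).bind fun d =>
    let ch := readChallenge d.fst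
    (keyGenDET E κ ch.schema ch.eqs).bind fun K =>
      (PMF.uniformOfFintype Bool).bind fun b =>
        (A.guess.output (encOracle (E.enc κ) K ch)
          (.cons (Data.unary κ) (.cons d.snd (view (E.enc κ) K ch (ch.log b))))).map
            fun g => decide (g.toBool = b)

/-- The probability that the adversary wins. -/
def winProb (E : DetEnc) (A : Adversary) (κ : ℕ) : ℝ := (game E A κ true).toReal

/-- Security of the log encryption scheme built from `E`: every admissible probabilistic
polynomial-time adversary wins with probability at most one half plus a negligible function. -/
def IndCplaDetSecure (E : DetEnc) : Prop :=
  ∀ A : Adversary, A.IsPPT → A.IsAdmissible →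
    ∃ negl : ℕ → ℝ, Negligible negl ∧ ∀ κ, winProb E A κ ≤ 1 / 2 + negl κ

end

end Eunomia

/-!
The security of the scheme follows by a hybrid argument over the classes of columns. Number each
class by the position of its first column (`classIdx`), and let the `i`-th hybrid log
(`hybridLog`) carry the values of `L₁` in the classes of number less than `i` and those of `L₀`
elsewhere. The first hybrid is `L₀` and, for `i` at least the number of columns, the hybrid is
`L₁`.

Neighbouring hybrids differ in a single class `j`. There the bijection of the definition of
equivalence extends to a permutation `σ` of all bit strings that preserves lengths, fixes the
policy constants, and fixes every string that occurs in neither log (`exists_perm_extension`). All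
that the adversary sees of the log, apart from the encryptions of its cells, is where the
constants occur and how the sums `t + d` are ordered, and this is the same for both hybrids. So if
class `j` is encrypted by `f ∘ σ` in the one hybrid and by `f` in the other, then view and
encryption oracle are equal (`exists_perm_hybridLog`). For a uniformly random function `f` the
functions `f ∘ σ` and `f` have the same distribution, and hence the two hybrids are perfectly
indistinguishable (`lintegral_accept_succ`).

For `b = 0, 1` let the distinguisher `B_b` run the adversary on the hybrid `j + b`, for a random
`j`, where its own oracle encrypts class `j` and the other classes are encrypted with keys of its
own (`exists_distinguisher`). Since only fair coins are available, `j` is uniform below a power of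
two `2 ^ m` that is at least the number of columns and of polynomial size. With the real
encryption function, the key behind the oracle takes the part of one of the keys of the game, so
that the difference of the acceptance probabilities of `B₁` and `B₀` telescopes to `2⁻ᵐ` times the
difference between the last and the first hybrid (`prfReal_eq`), that is `2⁻ᵐ` times twice the
advantage of the adversary (`winProb_eq`). With a random function the two probabilities are equal.
So the advantage is at most `2 ^ m / 2` times the sum of the two distinguishing advantages, which
is negligible.

The larger part of the work is to show that the distinguishers are polynomial-time programs in the
language `Prog`. Functions and random functions that such programs compute are closed under the
usual operations on lists and numbers; the predicate `Poly` is registered with `fun_prop`, which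
then finds most of the programs. The adversary is run with a simulated oracle by a syntactic
transformation of programs (`Prog.simulate`, `exists_polyTime_simulate`). The view involves
equivalence closure, comparison of binary integers and ranks, for which `label_contract_eq_iff`,
`toInt_add_le_iff` and `rank_eq` supply algorithms.
-/

open MeasureTheory

namespace Eunomia

/-! ### Outputs and running times of programs -/

theorem mem_support_step {x y : Data} {r : Data × ℕ} :
    r ∈ (step x y).support ↔ r = (y, 1 + x.size + y.size) := by
  simp [step]

theorem mem_support_andThen {m : PMF (Data × ℕ)} {f : Data → PMF (Data × ℕ)} {r : Data × ℕ} :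
    r ∈ (andThen m f).support ↔
      ∃ r₁ ∈ m.support, ∃ r₂ ∈ (f r₁.1).support, r = (r₂.1, r₁.2 + r₂.2) := by
  simp only [andThen, PMF.mem_support_bind_iff, PMF.mem_support_map_iff]
  constructor
  · rintro ⟨a, ha, b, hb, rfl⟩; exact ⟨a, ha, b, hb, rfl⟩
  · rintro ⟨a, ha, b, hb, rfl⟩; exact ⟨a, ha, b, hb, rfl⟩

theorem map_fst_step (x y : Data) : (step x y).map Prod.fst = PMF.pure y := by
  simp [step, PMF.pure_map]

theorem map_fst_andThen (m : PMF (Data × ℕ)) (f : Data → PMF (Data × ℕ)) :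
    (andThen m f).map Prod.fst = (m.map Prod.fst).bind fun y => (f y).map Prod.fst := by
  simp only [andThen, PMF.map_bind, PMF.map_comp, PMF.bind_map]
  rfl

/-- The distribution reached from `a` after `n` steps of the random process `k`. -/
noncomputable def iterDist {σ : Type} (k : σ → PMF σ) (a : σ) : ℕ → PMF σ
  | 0 => PMF.pure a
  | n + 1 => (iterDist k a n).bind k

theorem iterDist_pure {σ : Type} (k : σ → σ) (a : σ) (n : ℕ) :
    iterDist (fun s => PMF.pure (k s)) a n = PMF.pure (k^[n] a) := by
  induction n with
  | zero => rfl
  | succ n ih => rw [iterDist, ih, PMF.pure_bind, Function.iterate_succ_apply']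

theorem iterDist_map {σ τ : Type} (g : σ → τ) (k : σ → PMF σ) (k' : τ → PMF τ)
    (h : ∀ s, k' (g s) = (k s).map g) (a : σ) (n : ℕ) :
    iterDist k' (g a) n = (iterDist k a n).map g := by
  induction n with
  | zero => simp [iterDist, PMF.pure_map]
  | succ n ih => simp only [iterDist, ih, PMF.map_bind, PMF.bind_map, Function.comp_def, h]

namespace Prog

theorem output_id (O : Data → Data) (x : Data) : Prog.id.output O x = PMF.pure x :=
  map_fst_step x x

theorem output_nil (O : Data → Data) (x : Data) : Prog.nil.output O x = PMF.pure .nil :=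
  map_fst_step x _

theorem output_fst (O : Data → Data) (x : Data) : Prog.fst.output O x = PMF.pure x.fst :=
  map_fst_step x _

theorem output_snd (O : Data → Data) (x : Data) : Prog.snd.output O x = PMF.pure x.snd :=
  map_fst_step x _

theorem output_query (O : Data → Data) (x : Data) : Prog.query.output O x = PMF.pure (O x) :=
  map_fst_step x _

theorem output_flip (O : Data → Data) (x : Data) :
    Prog.flip.output O x = (PMF.uniformOfFintype Bool).map Data.ofBool := by
  simp only [output, eval, PMF.map_bind, map_fst_step]
  rfl

theorem output_comp (O : Data → Data) (p q : Prog) (x : Data) :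
    (comp p q).output O x = (q.output O x).bind (p.output O) :=
  map_fst_andThen _ _

theorem output_pair (O : Data → Data) (p q : Prog) (x : Data) :
    (pair p q).output O x =
      (p.output O x).bind fun y => (q.output O x).map fun z => Data.cons y z := by
  simp only [output, eval, map_fst_andThen, PMF.pure_map]
  rfl

theorem output_cond (O : Data → Data) (p q r : Prog) (x : Data) :
    (cond p q r).output O x =
      (p.output O x).bind fun y => if y = Data.nil then r.output O x else q.output O x := by
  simp only [output, eval, map_fst_andThen]
  congr 1
  funext y
  split_ifs <;> rfl

theorem output_iter (O : Data → Data) (p : Prog) (x : Data) :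
    (iter p).output O x = iterDist (p.output O) x.snd x.fst.toList.length := by
  simp only [output, eval]
  generalize x.fst.toList.length = n
  induction n with
  | zero => exact map_fst_step _ _
  | succ n ih =>
    simp only [map_fst_andThen, iterDist, ih]
    rfl

/-- The time of a program covers the reading of its input and the writing of its output. -/
theorem size_le_time (O : Data → Data) (p : Prog) : ∀ (x : Data), ∀ r ∈ (p.eval O x).support,
    x.size ≤ r.2 ∧ r.1.size ≤ r.2 := by
  have hstep : ∀ x y : Data, ∀ r ∈ (step x y).support, x.size ≤ r.2 ∧ r.1.size ≤ r.2 := by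
    intro x y r hr
    rw [mem_support_step] at hr
    subst hr
    constructor <;> dsimp only <;> omega
  induction p with
  | id => intro x; exact hstep x _
  | nil => intro x; exact hstep x _
  | fst => intro x; exact hstep x _
  | snd => intro x; exact hstep x _
  | eq => intro x; exact hstep x _
  | query => intro x; exact hstep x _
  | flip =>
    intro x r hr
    simp only [eval, PMF.mem_support_bind_iff] at hr
    obtain ⟨b, -, hb⟩ := hr
    exact hstep x _ r hb
  | comp p q ihp ihq =>
    intro x r hr
    simp only [eval, mem_support_andThen] at hr
    obtain ⟨a, ha, b, hb, rfl⟩ := hr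
    have := ihq _ _ ha
    have := ihp _ _ hb
    constructor <;> simp <;> omega
  | pair p q ihp ihq =>
    intro x r hr
    simp only [eval, mem_support_andThen, PMF.support_pure, Set.mem_singleton_iff] at hr
    obtain ⟨a, ha, b, ⟨c, hc, d, rfl, rfl⟩, rfl⟩ := hr
    have := ihp _ _ ha
    have := ihq _ _ hc
    constructor <;> simp [Data.size] <;> omega
  | cond p q r ihp ihq ihr =>
    intro x s hs
    simp only [eval, mem_support_andThen] at hs
    obtain ⟨a, ha, b, hb, rfl⟩ := hs
    have := ihp _ _ ha
    split_ifs at hb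
    · have := ihr _ _ hb
      constructor <;> simp <;> omega
    · have := ihq _ _ hb
      constructor <;> simp <;> omega
  | iter p ihp =>
    intro x r hr
    simp only [eval] at hr
    generalize x.fst.toList.length = n at hr
    induction n generalizing r with
    | zero => exact hstep x _ r hr
    | succ n ih =>
      simp only [mem_support_andThen] at hr
      obtain ⟨a, ha, b, hb, rfl⟩ := hr
      have := ih _ ha
      have := ihp _ _ hb
      constructor <;> simp <;> omega

theorem mem_support_output {O : Data → Data} {p : Prog} {x : Data} {r : Data × ℕ}
    (h : r ∈ (p.eval O x).support) : r.1 ∈ (p.output O x).support := by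
  rw [output, PMF.mem_support_map_iff]
  exact ⟨r, h, rfl⟩

end Prog

theorem eval_mono (T : Polynomial ℕ) {m n : ℕ} (h : m ≤ n) : T.eval m ≤ T.eval n := by
  simp only [Polynomial.eval_eq_sum, Polynomial.sum]
  exact Finset.sum_le_sum fun i _ => Nat.mul_le_mul_left _ (Nat.pow_le_pow_left h i)

/-! ### Encodings and polynomial-time computable random functions -/

/-- A type whose elements are written as trees. -/
class Code (α : Type) where
  /-- The tree that stands for an element. -/
  enc : α → Data
  inj : Function.Injective enc

/-- The replies of the oracle are bounded by the polynomial `L` in `n` and the query. -/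
def OracleBdd (L : Polynomial ℕ) (n : ℕ) (O : Data → Data) : Prop :=
  ∀ q, (O q).size ≤ L.eval (n + q.size)

theorem OracleBdd.mono {L : Polynomial ℕ} {m n : ℕ} {O : Data → Data} (h : OracleBdd L m O)
    (hmn : m ≤ n) : OracleBdd L n O :=
  fun q => (h q).trans (eval_mono _ (by omega))

theorem oracleBdd_noOracle (n : ℕ) : OracleBdd 1 n noOracle := fun q => by
  simp [noOracle, Data.size]

section

variable {α β γ σ : Type} [Code α] [Code β] [Code γ] [Code σ]

/-- The time of `p` on the encodings of elements of `α` is polynomial. The bound refers to any `n`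
that is at least the size of the input, and the replies of the oracle are bounded in terms of `n`
as well: in contrast to `Prog.PolyTime` this notion is preserved by composition, since a small
intermediate result may be passed on together with an oracle that has longer replies. -/
def Prog.PolyTimeOn (α : Type) [Code α] (p : Prog) : Prop :=
  ∀ L : Polynomial ℕ, ∃ T : Polynomial ℕ, ∀ (O : Data → Data) (n : ℕ) (a : α),
    OracleBdd L n O → (Code.enc a).size ≤ n →
      ∀ r ∈ (p.eval O (Code.enc a)).support, r.2 ≤ T.eval n

/-- The random function `f`, which may depend on an oracle, is computed in polynomial time. -/
def PolyRand (f : (Data → Data) → α → PMF β) : Prop :=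
  ∃ p : Prog, (∀ O a, p.output O (Code.enc a) = (f O a).map Code.enc) ∧ p.PolyTimeOn α

/-- The function `f` is computed in polynomial time. -/
@[fun_prop]
def Poly (f : α → β) : Prop := PolyRand fun _ a => PMF.pure (f a)

theorem PolyRand.size_le {f : (Data → Data) → α → PMF β} (hf : PolyRand f) (L : Polynomial ℕ) :
    ∃ T : Polynomial ℕ, ∀ (O : Data → Data) (n : ℕ) (a : α), OracleBdd L n O →
      (Code.enc a).size ≤ n → ∀ b ∈ (f O a).support, (Code.enc b).size ≤ T.eval n := by
  obtain ⟨p, hp, hT⟩ := hf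
  obtain ⟨T, hT⟩ := hT L
  refine ⟨T, fun O n a hO hn b hb => ?_⟩
  have h1 : Code.enc b ∈ (p.output O (Code.enc a)).support := by
    rw [hp, PMF.mem_support_map_iff]; exact ⟨b, hb, rfl⟩
  rw [Prog.output, PMF.mem_support_map_iff] at h1
  obtain ⟨r, hr, h2⟩ := h1
  rw [← h2]
  exact ((p.size_le_time O _ r hr).2).trans (hT O n a hO hn r hr)

theorem Poly.size_le {f : α → β} (hf : Poly f) :
    ∃ T : Polynomial ℕ, ∀ a, (Code.enc (f a)).size ≤ T.eval (Code.enc a).size := by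
  obtain ⟨T, hT⟩ := PolyRand.size_le hf 1
  exact ⟨T, fun a => hT noOracle _ a (oracleBdd_noOracle _) le_rfl _ (by simp)⟩

theorem exists_of_mem_eval {f : (Data → Data) → α → PMF β} {p : Prog}
    (hp : ∀ O a, p.output O (Code.enc a) = (f O a).map Code.enc) {O : Data → Data} {a : α}
    {r : Data × ℕ} (hr : r ∈ (p.eval O (Code.enc a)).support) :
    ∃ b ∈ (f O a).support, r.1 = Code.enc b := by
  have := Prog.mem_support_output hr
  rw [hp, PMF.mem_support_map_iff] at this
  obtain ⟨b, hb, h⟩ := this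
  exact ⟨b, hb, h.symm⟩

theorem PolyRand.comp {g : (Data → Data) → β → PMF γ} {f : (Data → Data) → α → PMF β}
    (hg : PolyRand g) (hf : PolyRand f) : PolyRand fun O a => (f O a).bind (g O) := by
  obtain ⟨q, hq, hqT⟩ := hg
  obtain ⟨p, hp, hpT⟩ := hf
  refine ⟨.comp q p, fun O a => ?_, fun L => ?_⟩
  · rw [Prog.output_comp, hp, PMF.bind_map, PMF.map_bind]
    congr 1
    funext b
    exact hq O b
  · obtain ⟨T, hT⟩ := hpT L
    obtain ⟨U, hU⟩ := hqT L
    refine ⟨T + U.comp (Polynomial.X + T), fun O n a hO hn r hr => ?_⟩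
    simp only [Prog.eval, mem_support_andThen] at hr
    obtain ⟨r₁, h₁, r₂, h₂, rfl⟩ := hr
    obtain ⟨b, -, hb⟩ := exists_of_mem_eval hp h₁
    have t₁ := hT O n a hO hn r₁ h₁
    have s₁ := (Prog.size_le_time O _ _ _ h₁).2
    rw [hb] at h₂ s₁
    have t₂ := hU O (n + T.eval n) b (hO.mono (by omega)) (by omega) r₂ h₂
    simp only [Polynomial.eval_add, Polynomial.eval_comp, Polynomial.eval_X]
    omega

instance : Code Data := ⟨fun d => d, fun _ _ h => h⟩

instance : Code (α × β) :=
  ⟨fun p => .cons (Code.enc p.1) (Code.enc p.2), fun p q h => by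
    simp only [Data.cons.injEq] at h
    exact Prod.ext (Code.inj h.1) (Code.inj h.2)⟩

theorem PolyRand.pair {f : (Data → Data) → α → PMF β} {g : (Data → Data) → α → PMF γ}
    (hf : PolyRand f) (hg : PolyRand g) :
    PolyRand fun O a => (f O a).bind fun b => (g O a).map fun c => (b, c) := by
  obtain ⟨p, hp, hpT⟩ := hf
  obtain ⟨q, hq, hqT⟩ := hg
  refine ⟨.pair p q, fun O a => ?_, fun L => ?_⟩
  · simp only [Prog.output_pair, hp, hq, PMF.bind_map, PMF.map_bind, PMF.map_comp]
    rfl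
  · obtain ⟨T, hT⟩ := hpT L
    obtain ⟨U, hU⟩ := hqT L
    refine ⟨T + U + 1, fun O n a hO hn r hr => ?_⟩
    simp only [Prog.eval, mem_support_andThen, PMF.support_pure, Set.mem_singleton_iff] at hr
    obtain ⟨r₁, h₁, r₂, ⟨r₃, h₃, r₄, rfl, rfl⟩, rfl⟩ := hr
    have t₁ := hT O n a hO hn r₁ h₁
    have t₂ := hU O n a hO hn r₃ h₃
    simp only [Polynomial.eval_add, Polynomial.eval_one]
    omega

theorem PolyRand.of_eq {f g : (Data → Data) → α → PMF β} (hf : PolyRand f)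
    (h : ∀ O a, f O a = g O a) : PolyRand g := by
  have : f = g := by funext O a; exact h O a
  exact this ▸ hf

theorem PolyRand.comp_det {g : (Data → Data) → β → PMF γ} {f : α → β}
    (hg : PolyRand g) (hf : Poly f) : PolyRand fun O a => g O (f a) :=
  (PolyRand.comp hg hf).of_eq fun _ _ => PMF.pure_bind _ _

theorem PolyRand.map {f : (Data → Data) → α → PMF β} {g : β → γ}
    (hf : PolyRand f) (hg : Poly g) : PolyRand fun O a => (f O a).map g :=
  (PolyRand.comp hg hf).of_eq fun _ _ => rfl

/-- Random choice of `b` by `f`, which is kept together with the input. -/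
theorem PolyRand.keep {f : (Data → Data) → α → PMF β} (hf : PolyRand f)
    (hid : Poly fun a : α => a) :
    PolyRand fun O a => (f O a).map fun b => (a, b) :=
  (PolyRand.pair hid hf).of_eq fun _ _ => PMF.pure_bind _ _

theorem PolyRand.of_step {f : (Data → Data) → α → PMF β} (p : Prog) (T : Polynomial ℕ)
    (h : ∀ O (a : α), p.output O (Code.enc a) = (f O a).map Code.enc)
    (hT : ∀ O (a : α), ∀ r ∈ (p.eval O (Code.enc a)).support, r.2 ≤ T.eval (Code.enc a).size) :
    PolyRand f :=
  ⟨p, h, fun _ => ⟨T, fun O _ a _ hn r hr => (hT O a r hr).trans (eval_mono _ hn)⟩⟩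

/-- A function that is computed by a single elementary operation. -/
theorem Poly.of_step {f : α → β} (p : Prog)
    (h : ∀ O a, p.eval O (Code.enc a) = step (Code.enc a) (Code.enc (f a)))
    (hs : ∀ a, (Code.enc (f a)).size ≤ (Code.enc a).size + 3) : Poly f := by
  refine PolyRand.of_step p (2 * Polynomial.X + 4) (fun O a => ?_) (fun O a r hr => ?_)
  · rw [Prog.output, h, map_fst_step, PMF.pure_map]
  · rw [h, mem_support_step] at hr
    subst hr
    have := hs a
    simp
    omega

@[fun_prop]
theorem Poly.id' : Poly fun a : α => a :=
  Poly.of_step .id (fun _ _ => rfl) fun _ => by omega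

theorem Data.size_fst_le (d : Data) : d.fst.size ≤ d.size := by
  cases d <;> simp [Data.fst, Data.size]; omega

theorem Data.size_snd_le (d : Data) : d.snd.size ≤ d.size := by
  cases d <;> simp [Data.snd, Data.size]

theorem Data.size_pos (d : Data) : 1 ≤ d.size := by
  cases d <;> simp [Data.size]; omega

@[fun_prop]
theorem Poly.fst' : Poly fun p : α × β => p.1 :=
  Poly.of_step .fst (fun _ _ => rfl) fun p => by
    have := Data.size_fst_le (Code.enc p)
    exact this.trans (by omega)

@[fun_prop]
theorem Poly.snd' : Poly fun p : α × β => p.2 :=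
  Poly.of_step .snd (fun _ _ => rfl) fun p => by
    have := Data.size_snd_le (Code.enc p)
    exact this.trans (by omega)

@[fun_prop]
theorem Poly.comp {g : β → γ} {f : α → β} (hg : Poly g) (hf : Poly f) : Poly fun a => g (f a) :=
  PolyRand.of_eq (PolyRand.comp (g := fun _ b => PMF.pure (g b)) hg hf) fun _ _ => PMF.pure_bind _ _

@[fun_prop]
theorem Poly.prodMk {f : α → β} {g : α → γ} (hf : Poly f) (hg : Poly g) :
    Poly fun a => (f a, g a) :=
  (PolyRand.pair hf hg).of_eq fun _ _ => by simp [PMF.pure_bind, PMF.pure_map]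

theorem Poly.nilData : Poly fun _ : α => Data.nil :=
  Poly.of_step .nil (fun _ _ => rfl) fun _ => by simp [Code.enc, Data.size]

/-- A function may be computed through any function with the same encodings. -/
theorem Poly.recode {δ : Type} [Code δ] {f : α → β} {g : α → δ} (hf : Poly f)
    (h : ∀ a, Code.enc (f a) = Code.enc (g a)) : Poly g := by
  obtain ⟨p, hp, hT⟩ := hf
  refine ⟨p, fun O a => ?_, hT⟩
  rw [hp, PMF.pure_map, PMF.pure_map, h]

@[fun_prop]
theorem Poly.enc : Poly fun a : α => Code.enc a :=
  Poly.recode Poly.id' fun _ => rfl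

@[fun_prop]
theorem Poly.const (b : β) : Poly fun _ : α => b := by
  have h : ∀ d : Data, Poly fun _ : α => d := by
    intro d
    induction d with
    | nil => exact Poly.nilData
    | cons a b iha ihb => exact (Poly.prodMk iha ihb).recode fun _ => rfl
  exact (h (Code.enc b)).recode fun _ => rfl

theorem PolyRand.flip : PolyRand (α := α) (β := Data)
    fun _ _ => (PMF.uniformOfFintype Bool).map Data.ofBool := by
  refine PolyRand.of_step .flip (Polynomial.X + 4) (fun O a => ?_) (fun O a r hr => ?_)
  · rw [Prog.output_flip, PMF.map_comp]; rfl
  · simp only [Prog.eval, PMF.mem_support_bind_iff] at hr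
    obtain ⟨b, -, hb⟩ := hr
    rw [mem_support_step] at hb
    subst hb
    cases b <;> simp [Data.ofBool, Data.size] <;> omega

/-- Querying the oracle. -/
theorem PolyRand.query : PolyRand (α := Data) (β := Data) fun O q => PMF.pure (O q) := by
  refine ⟨.query, fun O a => ?_, fun L => ⟨1 + Polynomial.X + L.comp (2 * Polynomial.X), ?_⟩⟩
  · rw [Prog.output_query, PMF.pure_map]; rfl
  · intro O n a hO hn r hr
    simp only [Prog.eval, mem_support_step] at hr
    subst hr
    have h1 : (O (Code.enc a)).size ≤ _ := hO (Code.enc a)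
    have h2 : L.eval (n + (Code.enc a).size) ≤ L.eval (2 * n) := eval_mono _ (by omega)
    simp only [Polynomial.eval_add, Polynomial.eval_comp, Polynomial.eval_mul,
      Polynomial.eval_ofNat, Polynomial.eval_X, Polynomial.eval_one]
    omega

/-- Case distinction on whether the encoding of a value is the empty tree. -/
theorem PolyRand.ite_nil {t : α → β} {f g : (Data → Data) → α → PMF γ} (ht : Poly t)
    (hf : PolyRand f) (hg : PolyRand g) :
    PolyRand fun O a => if Code.enc (t a) = Data.nil then g O a else f O a := by
  obtain ⟨s, hs, hsT⟩ := ht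
  obtain ⟨p, hp, hpT⟩ := hf
  obtain ⟨q, hq, hqT⟩ := hg
  refine ⟨.cond s p q, fun O a => ?_, fun L => ?_⟩
  · simp only [Prog.output_cond, hs, hp, hq, PMF.pure_map, PMF.pure_bind]
    split_ifs <;> rfl
  · obtain ⟨S, hS⟩ := hsT L
    obtain ⟨T, hT⟩ := hpT L
    obtain ⟨U, hU⟩ := hqT L
    refine ⟨S + T + U, fun O n a hO hn r hr => ?_⟩
    simp only [Prog.eval, mem_support_andThen] at hr
    obtain ⟨r₁, h₁, r₂, h₂, rfl⟩ := hr
    have t₁ := hS O n a hO hn r₁ h₁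
    simp only [Polynomial.eval_add]
    split_ifs at h₂
    · have := hU O n a hO hn r₂ h₂
      omega
    · have := hT O n a hO hn r₂ h₂
      omega

theorem iterDist_congr_map {k : σ → PMF σ} {k' : Data → PMF Data}
    (h : ∀ s, k' (Code.enc s) = (k s).map Code.enc) (a : σ) (n : ℕ) :
    iterDist k' (Code.enc a) n = (iterDist k a n).map Code.enc :=
  iterDist_map Code.enc k k' h a n

/-- Iteration of a random step. All states that are reached have to be of polynomial size. -/
theorem PolyRand.iterate {l : α → Data} {i : α → σ} {k : (Data → Data) → σ → PMF σ}
    (hl : Poly l) (hi : Poly i) (hk : PolyRand k)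
    (hb : ∀ L : Polynomial ℕ, ∃ T : Polynomial ℕ, ∀ (O : Data → Data) (n : ℕ) (a : α),
      OracleBdd L n O → (Code.enc a).size ≤ n → ∀ m ≤ (l a).toList.length,
        ∀ s ∈ (iterDist (k O) (i a) m).support, (Code.enc s).size ≤ T.eval n) :
    PolyRand fun O a => iterDist (k O) (i a) (l a).toList.length := by
  have hli := hl.prodMk hi
  obtain ⟨p, hp, hpT⟩ := hk
  obtain ⟨q, hq, hqT⟩ := hli
  refine ⟨.comp (.iter p) q, fun O a => ?_, fun L => ?_⟩
  · rw [Prog.output_comp, hq, PMF.pure_map, PMF.pure_bind, Prog.output_iter]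
    exact iterDist_congr_map (hp O) _ _
  · obtain ⟨Q, hQ⟩ := hqT L
    obtain ⟨T, hT⟩ := hpT L
    obtain ⟨B, hB⟩ := hb L
    refine ⟨Q + (1 + 2 * Q) + Q * T.comp (Polynomial.X + B), fun O n a hO hn r hr => ?_⟩
    simp only [Prog.eval, mem_support_andThen] at hr
    obtain ⟨r₁, h₁, r₂, h₂, rfl⟩ := hr
    have t₁ := hQ O n a hO hn r₁ h₁
    have s₁ := (Prog.size_le_time O _ _ _ h₁).2
    obtain ⟨b, hb1, hb⟩ := exists_of_mem_eval hq h₁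
    rw [PMF.mem_support_pure_iff] at hb1
    subst hb1
    rw [hb] at h₂ s₁
    beta_reduce at s₁
    have e1 : (Code.enc (l a, i a)).fst = l a := rfl
    have e2 : (Code.enc (l a, i a)).snd = Code.enc (i a) := rfl
    rw [e1] at h₂
    have hlen : ∀ d : Data, d.toList.length ≤ d.size := by
      intro d
      induction d with
      | nil => simp [Data.toList]
      | cons a b _ ih => simp [Data.toList, Data.size]; omega
    have hlen' := hlen (l a)
    have s2 := Data.size_fst_le (Code.enc (l a, i a))
    have s3 := Data.size_snd_le (Code.enc (l a, i a))
    rw [e1] at s2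
    -- The states of the iteration are encodings, and each step has the same bound on its time.
    have main : ∀ m ≤ (l a).toList.length, ∀ r ∈ (Nat.rec (motive := fun _ => PMF (Data × ℕ))
        (step (Code.enc (l a, i a)) (Code.enc (l a, i a)).snd)
        (fun _ m => andThen m (p.eval O)) m).support,
        (∃ s ∈ (iterDist (k O) (i a) m).support, r.1 = Code.enc s) ∧
          r.2 ≤ 1 + 2 * Q.eval n + m * T.eval (n + B.eval n) := by
      intro m
      induction m with
      | zero =>
        intro _ r hr
        rw [show Nat.rec _ _ 0 = step _ _ from rfl, mem_support_step] at hr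
        subst hr
        refine ⟨⟨i a, by simp [iterDist], rfl⟩, ?_⟩
        simp
        omega
      | succ m ih =>
        intro hm r hr
        rw [mem_support_andThen] at hr
        obtain ⟨r₁, h₁, r₂, h₂, rfl⟩ := hr
        obtain ⟨⟨s, hs, hs'⟩, ht⟩ := ih (by omega) r₁ h₁
        rw [hs'] at h₂
        have hsz := hB O n a hO hn m (by omega) s hs
        have t₂ := hT O (n + B.eval n) s (hO.mono (by omega)) (by omega) r₂ h₂
        obtain ⟨s', hs1, hs2⟩ := exists_of_mem_eval hp h₂
        refine ⟨⟨s', ?_, hs2⟩, ?_⟩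
        · rw [iterDist, PMF.mem_support_bind_iff]
          exact ⟨s, hs, hs1⟩
        · have := Nat.add_one_mul m (T.eval (n + B.eval n))
          simp only
          omega
    have := (main _ le_rfl r₂ h₂).2
    have h5 : (l a).toList.length * T.eval (n + B.eval n) ≤ Q.eval n * T.eval (n + B.eval n) :=
      Nat.mul_le_mul_right _ (by omega)
    simp only [Polynomial.eval_add, Polynomial.eval_mul, Polynomial.eval_comp, Polynomial.eval_X,
      Polynomial.eval_one, Polynomial.eval_ofNat]
    omega

end

/-! ### Polynomial-time functions on lists and numbers -/

instance : Code Bool := ⟨Data.ofBool, fun a b h => by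
  rw [← Data.toBool_ofBool a, h, Data.toBool_ofBool]⟩

/-- Numbers are written in unary. -/
instance : Code ℕ := ⟨Data.unary, fun a b h => by
  have := congrArg (fun d => d.toList.length) h
  simpa [Data.unary, Data.toList_ofList] using this⟩

instance {α : Type} [Code α] : Code (List α) :=
  ⟨fun l => Data.ofList (l.map Code.enc), fun a b h => by
    have := congrArg Data.toList h
    simp only [Data.toList_ofList] at this
    exact List.map_injective_iff.mpr Code.inj this⟩

section

variable {α β γ δ σ : Type} [Code α] [Code β] [Code γ] [Code δ] [Code σ]

theorem enc_cons (b : β) (l : List β) : Code.enc (b :: l) = .cons (Code.enc b) (Code.enc l) := rfl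

theorem enc_nil : Code.enc ([] : List β) = .nil := rfl

theorem enc_str (s : Str) : Code.enc s = Data.ofStr s := rfl

theorem size_enc_cons (b : β) (l : List β) :
    (Code.enc (b :: l)).size = 1 + (Code.enc b).size + (Code.enc l).size := rfl

theorem size_enc_nil : (Code.enc ([] : List β)).size = 1 := rfl

theorem size_enc_prod (b : β) (c : γ) :
    (Code.enc (b, c)).size = 1 + (Code.enc b).size + (Code.enc c).size := rfl

theorem size_enc_nat (n : ℕ) : (Code.enc n).size = 2 * n + 1 := by
  show (Data.unary n).size = _
  induction n with
  | zero => rfl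
  | succ n ih =>
    have : Data.unary (n + 1) = .cons .nil (Data.unary n) := by
      simp [Data.unary, List.replicate_succ, Data.ofList]
    rw [this, Data.size, ih, Data.size]
    omega

theorem size_enc_bool (b : Bool) : (Code.enc b).size ≤ 3 := by
  cases b <;> simp [Code.enc, Data.ofBool, Data.size]

theorem size_enc_append (l m : List β) :
    (Code.enc (l ++ m)).size + 1 = (Code.enc l).size + (Code.enc m).size := by
  induction l with
  | nil => simp [size_enc_nil]; omega
  | cons b l ih => simp only [List.cons_append, size_enc_cons]; omega

theorem length_le_size (l : List β) : l.length ≤ (Code.enc l).size := by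
  induction l with
  | nil => simp
  | cons b l ih => simp only [size_enc_cons, List.length_cons]; omega

theorem size_le_of_mem {b : β} {l : List β} (h : b ∈ l) :
    (Code.enc b).size ≤ (Code.enc l).size := by
  induction l with
  | nil => simp at h
  | cons c l ih =>
    simp only [size_enc_cons]
    rcases List.mem_cons.mp h with rfl | h
    · omega
    · have := ih h
      omega

theorem size_le_length_mul {l : List β} {B : ℕ} (h : ∀ b ∈ l, (Code.enc b).size ≤ B) :
    (Code.enc l).size ≤ 1 + l.length * (B + 1) := by
  induction l with
  | nil => simp [size_enc_nil]
  | cons b l ih =>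
    have h1 := h b (by simp)
    have h2 := ih fun c hc => h c (by simp [hc])
    rw [size_enc_cons, List.length_cons, Nat.add_one_mul]
    omega

theorem size_enc_le_of_prefix {l m : List β} (h : l <+: m) :
    (Code.enc l).size ≤ (Code.enc m).size := by
  obtain ⟨t, rfl⟩ := h
  have := size_enc_append l t
  have := Data.size_pos (Code.enc t)
  omega

theorem size_enc_le_of_suffix {l m : List β} (h : l <:+ m) :
    (Code.enc l).size ≤ (Code.enc m).size := by
  obtain ⟨t, rfl⟩ := h
  have := size_enc_append t l
  have := Data.size_pos (Code.enc t)
  omega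

@[fun_prop]
theorem Poly.cons' {f : α → β} {g : α → List β} (hf : Poly f) (hg : Poly g) :
    Poly fun a => f a :: g a :=
  (hf.prodMk hg).recode fun _ => rfl

/-- Case distinction on a list, the basis of all computations with lists. -/
theorem Poly.list_match {l : α → List β} {f : α → γ} {g : α → β → List β → γ} (hl : Poly l)
    (hf : Poly f) (hg : Poly fun p : α × β × List β => g p.1 p.2.1 p.2.2) :
    Poly fun a => match l a with
      | [] => f a
      | b :: t => g a b t := by
  -- On nonempty lists, the input of `g` is the input together with the list itself.
  obtain ⟨p, hp, hT⟩ := hg.comp (f := fun q : α × β × List β => q) Poly.id'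
  obtain ⟨q, hq, hqT⟩ := (Poly.id' (α := α)).prodMk hl
  obtain ⟨r, hr, hrT⟩ := hf
  obtain ⟨s, hs, hsT⟩ := hl
  refine ⟨.cond s (.comp p q) r, fun O a => ?_, fun L => ?_⟩
  · simp only [Prog.output_cond, hs, hr, PMF.pure_map, PMF.pure_bind, Prog.output_comp, hq]
    cases h : l a with
    | nil => simp [enc_nil]
    | cons b t =>
      rw [if_neg (by simp [enc_cons])]
      have := hp O (a, b, t)
      rw [PMF.pure_map] at this
      exact this
  · obtain ⟨S, hS⟩ := hsT L
    obtain ⟨R, hR⟩ := hrT L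
    obtain ⟨Q, hQ⟩ := hqT L
    obtain ⟨T, hT⟩ := hT L
    refine ⟨S + R + (Q + T.comp (Polynomial.X + Q)), fun O n a hO hn x hx => ?_⟩
    simp only [Prog.eval, mem_support_andThen] at hx
    obtain ⟨r₁, h₁, r₂, h₂, rfl⟩ := hx
    obtain ⟨b, hb, hb'⟩ := exists_of_mem_eval hs h₁
    rw [PMF.mem_support_pure_iff] at hb
    subst hb
    rw [hb'] at h₂
    have t₁ := hS O n a hO hn r₁ h₁
    simp only [Polynomial.eval_add, Polynomial.eval_comp, Polynomial.eval_X]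
    cases h : l a with
    | nil =>
      rw [h, enc_nil, if_pos rfl] at h₂
      have := hR O n a hO hn r₂ h₂
      omega
    | cons b t =>
      rw [h, if_neg (by simp [enc_cons]), mem_support_andThen] at h₂
      obtain ⟨r₃, h₃, r₄, h₄, rfl⟩ := h₂
      obtain ⟨c, hc, hc'⟩ := exists_of_mem_eval hq h₃
      rw [PMF.mem_support_pure_iff] at hc
      subst hc
      have t₃ := hQ O n a hO hn r₃ h₃
      have s₃ := (Prog.size_le_time O _ _ _ h₃).2
      have hc₂ : r₃.1 = Code.enc (a, b, t) :=
        hc'.trans (congrArg (fun m => Code.enc (a, m)) h)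
      rw [hc₂] at h₄ s₃
      have := hT O (n + Q.eval n) (a, b, t) (hO.mono (by omega)) (s₃.trans (by omega)) r₄ h₄
      simp only
      omega

/-- Iteration, as often as a list is long; all states have to be of polynomial size. -/
theorem Poly.iterate {l : α → List β} {i : α → σ} {k : σ → σ} (hl : Poly l) (hi : Poly i)
    (hk : Poly k) (hb : ∃ T : Polynomial ℕ, ∀ a, ∀ m ≤ (l a).length,
      (Code.enc (k^[m] (i a))).size ≤ T.eval (Code.enc a).size) :
    Poly fun a => k^[(l a).length] (i a) := by
  obtain ⟨T, hT⟩ := hb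
  have h : ∀ l : List β, (Code.enc l).toList.length = l.length := fun l => by
    show (Data.ofList (l.map Code.enc)).toList.length = l.length
    simp [Data.toList_ofList]
  refine (PolyRand.iterate (k := fun _ s => PMF.pure (k s)) (hl.recode (g := fun a =>
    Code.enc (l a)) fun _ => rfl) hi hk fun L => ⟨T, fun O n a _ hn m hm s hs => ?_⟩).of_eq
    fun O a => ?_
  · rw [h] at hm
    rw [iterDist_pure, PMF.mem_support_pure_iff] at hs
    subst hs
    exact (hT a m hm).trans (eval_mono _ hn)
  · rw [iterDist_pure, h]

/-- A fold along a list; all states have to be of polynomial size. -/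
theorem Poly.foldl {l : α → List β} {i : α → σ} {g : α → σ → β → σ} (hl : Poly l) (hi : Poly i)
    (hg : Poly fun p : α × σ × β => g p.1 p.2.1 p.2.2)
    (hb : ∃ T : Polynomial ℕ, ∀ a t, t <+: l a →
      (Code.enc (t.foldl (g a) (i a))).size ≤ T.eval (Code.enc a).size) :
    Poly fun a => (l a).foldl (g a) (i a) := by
  obtain ⟨T, hT⟩ := hb
  obtain ⟨U, hU⟩ := hl.size_le
  -- The state consists of the parameter, the remaining list and the value of the fold so far.
  let k : α × List β × σ → α × List β × σ := fun x => match x.2.1 with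
    | [] => x
    | b :: t => (x.1, t, g x.1 x.2.2 b)
  have hk : Poly k := by
    refine Poly.list_match (by fun_prop) (by fun_prop) ?_
    refine Poly.prodMk (by fun_prop) (Poly.prodMk (by fun_prop) ?_)
    exact hg.comp (f := fun p : (α × List β × σ) × β × List β => (p.1.1, p.1.2.2, p.2.1))
      (by fun_prop)
  have hkm : ∀ a m, k^[m] (a, l a, i a) = (a, (l a).drop m, ((l a).take m).foldl (g a) (i a)) := by
    intro a m
    induction m with
    | zero => simp
    | succ m ih =>
      rw [Function.iterate_succ_apply', ih]
      cases h : (l a).drop m with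
      | nil =>
        have : (l a).length ≤ m := by simpa using h
        simp [k, List.drop_eq_nil_of_le, List.take_of_length_le, this, Nat.le_succ_of_le this]
      | cons b t =>
        have h1 : (l a).drop (m + 1) = t := by
          rw [← List.tail_drop, h]; rfl
        have h2 : (l a).take (m + 1) = (l a).take m ++ [b] := by
          rw [List.take_add_one, ← List.head?_drop, h]; rfl
        simp only [k, h1, h2, List.foldl_append, List.foldl_cons, List.foldl_nil]
  have key := Poly.iterate (l := l) (i := fun a => (a, l a, i a)) (k := k)
    hl (by fun_prop) hk ⟨2 + Polynomial.X + U + T, fun a m _ => ?_⟩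
  · refine ((Poly.snd'.comp Poly.snd').comp key).recode fun a => ?_
    rw [hkm]
    simp
  · rw [hkm, size_enc_prod, size_enc_prod]
    have h1 := hT a _ (List.take_prefix m (l a))
    have h2 := size_enc_le_of_suffix (List.drop_suffix m (l a))
    have h3 := hU a
    simp only [Polynomial.eval_add, Polynomial.eval_X, Polynomial.eval_ofNat]
    omega

/-- A fold in which every step increases the size of the state by a polynomial amount. -/
theorem Poly.foldl_of_add {l : α → List β} {i : α → σ} {g : α → σ → β → σ} (hl : Poly l)
    (hi : Poly i) (hg : Poly fun p : α × σ × β => g p.1 p.2.1 p.2.2)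
    (hb : ∃ T : Polynomial ℕ, ∀ a s, ∀ b ∈ l a,
      (Code.enc (g a s b)).size ≤ (Code.enc s).size + T.eval (Code.enc a).size) :
    Poly fun a => (l a).foldl (g a) (i a) := by
  obtain ⟨T, hT⟩ := hb
  obtain ⟨U, hU⟩ := hl.size_le
  obtain ⟨I, hI⟩ := hi.size_le
  refine Poly.foldl hl hi hg ⟨I + U * T, fun a t ht => ?_⟩
  have key : ∀ t : List β, (∀ b ∈ t, b ∈ l a) → ∀ s, (Code.enc (t.foldl (g a) s)).size ≤
      (Code.enc s).size + t.length * T.eval (Code.enc a).size := by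
    intro t
    induction t with
    | nil => simp
    | cons b t ih =>
      intro h s
      have h1 := hT a s b (h b (by simp))
      have h2 := ih (fun c hc => h c (by simp [hc])) (g a s b)
      rw [List.foldl_cons, List.length_cons, Nat.add_one_mul]
      omega
  have h1 := key t (fun b hb => ht.subset hb) (i a)
  have h2 := hI a
  have h3 : t.length * T.eval (Code.enc a).size ≤ U.eval _ * T.eval (Code.enc a).size :=
    Nat.mul_le_mul_right _ (((length_le_size t).trans (size_enc_le_of_prefix ht)).trans (hU a))
  simp only [Polynomial.eval_add, Polynomial.eval_mul]
  omega

/-- A bound on the size of `g a b`, where `b` ranges over a list computed from `a`. -/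
theorem Poly.size_le_of_mem {l : α → List β} {g : α → β → γ} (hl : Poly l)
    (hg : Poly fun p : α × β => g p.1 p.2) :
    ∃ T : Polynomial ℕ, ∀ a, ∀ b ∈ l a, (Code.enc (g a b)).size ≤ T.eval (Code.enc a).size := by
  obtain ⟨U, hU⟩ := hl.size_le
  obtain ⟨T, hT⟩ := hg.size_le
  refine ⟨T.comp (1 + Polynomial.X + U), fun a b hb => (hT (a, b)).trans ?_⟩
  rw [Polynomial.eval_comp]
  refine eval_mono _ ?_
  have h1 := hU a
  have h2 := Eunomia.size_le_of_mem hb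
  simp only [size_enc_prod, Polynomial.eval_add, Polynomial.eval_X, Polynomial.eval_one]
  omega

/-! #### Truth values -/

@[fun_prop]
theorem Poly.decide_eq [DecidableEq β] {f g : α → β} (hf : Poly f) (hg : Poly g) :
    Poly fun a => decide (f a = g a) := by
  have : Poly fun p : β × β => decide (p.1 = p.2) := by
    refine Poly.of_step .eq (fun O p => ?_) fun p => ?_
    · show step _ (Data.ofBool (decide (Code.enc p.1 = Code.enc p.2))) = _
      congr 2
      exact decide_eq_decide.mpr Code.inj.eq_iff
    · exact (size_enc_bool _).trans (by omega)
  exact this.comp (hf.prodMk hg)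

@[fun_prop]
theorem Poly.ite {P : α → Prop} [∀ a, Decidable (P a)] {f g : α → β}
    (hP : Poly fun a => decide (P a)) (hf : Poly f) (hg : Poly g) :
    Poly fun a => if P a then f a else g a := by
  refine (PolyRand.ite_nil hP hf hg).of_eq fun O a => ?_
  by_cases h : P a <;> simp [h, Code.enc, Data.ofBool]

theorem Poly.decide_not {P : α → Prop} [∀ a, Decidable (P a)]
    (hP : Poly fun a => decide (P a)) : Poly fun a => decide (¬ P a) := by
  have : Poly fun a => if P a then false else true := by fun_prop
  exact this.recode fun a => by by_cases h : P a <;> simp [h]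

theorem Poly.decide_and {P Q : α → Prop} [∀ a, Decidable (P a)] [∀ a, Decidable (Q a)]
    (hP : Poly fun a => decide (P a)) (hQ : Poly fun a => decide (Q a)) :
    Poly fun a => decide (P a ∧ Q a) := by
  have : Poly fun a => if P a then decide (Q a) else false := by fun_prop
  exact this.recode fun a => by by_cases h : P a <;> simp [h]

/-! #### Lists -/

@[fun_prop]
theorem Poly.reverse {l : α → List β} (hl : Poly l) : Poly fun a => (l a).reverse := by
  have : Poly fun l : List β => l.foldl (fun s b => b :: s) [] := by
    refine Poly.foldl_of_add (g := fun _ s b => b :: s) (by fun_prop) (by fun_prop) (by fun_prop)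
      ⟨1 + Polynomial.X, fun a s b hb => ?_⟩
    have := Eunomia.size_le_of_mem hb
    simp only [size_enc_cons, Polynomial.eval_add, Polynomial.eval_one, Polynomial.eval_X]
    omega
  refine (this.comp hl).recode fun a => ?_
  simp

@[fun_prop]
theorem Poly.append {l m : α → List β} (hl : Poly l) (hm : Poly m) :
    Poly fun a => l a ++ m a := by
  have : Poly fun p : List β × List β => p.1.reverse.foldl (fun s b => b :: s) p.2 := by
    refine Poly.foldl_of_add (g := fun _ s b => b :: s) (by fun_prop) (by fun_prop) (by fun_prop)
      ⟨1 + Polynomial.X, fun a s b hb => ?_⟩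
    have := Eunomia.size_le_of_mem (List.mem_reverse.mp hb)
    obtain ⟨a, a'⟩ := a
    dsimp only at this
    simp only [size_enc_cons, size_enc_prod, Polynomial.eval_add, Polynomial.eval_one,
      Polynomial.eval_X]
    omega
  refine (this.comp (hl.prodMk hm)).recode fun a => ?_
  simp

@[fun_prop]
theorem Poly.map {l : α → List β} {g : α → β → γ} (hl : Poly l)
    (hg : Poly fun p : α × β => g p.1 p.2) : Poly fun a => (l a).map (g a) := by
  have : Poly fun a => (l a).foldl (fun s b => g a b :: s) [] := by
    obtain ⟨T, hT⟩ := Poly.size_le_of_mem hl hg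
    refine Poly.foldl_of_add (g := fun a s b => g a b :: s) hl (by fun_prop) ?_
      ⟨1 + T, fun a s b hb => ?_⟩
    · exact (hg.comp (f := fun p : α × List γ × β => (p.1, p.2.2)) (by fun_prop)).cons'
        (by fun_prop)
    · have := hT a b hb
      simp only [size_enc_cons, Polynomial.eval_add, Polynomial.eval_one]
      omega
  refine this.reverse.recode fun a => ?_
  simp

@[fun_prop]
theorem Poly.flatten {l : α → List (List β)} (hl : Poly l) : Poly fun a => (l a).flatten := by
  have : Poly fun l : List (List β) => l.foldl (fun s b => s ++ b) [] := by
    refine Poly.foldl_of_add (g := fun _ s b => s ++ b) (by fun_prop) (by fun_prop) (by fun_prop)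
      ⟨Polynomial.X, fun a s b hb => ?_⟩
    have h1 := Eunomia.size_le_of_mem hb
    have h2 := size_enc_append s b
    rw [Polynomial.eval_X]
    omega
  refine (this.comp hl).recode fun a => congrArg Code.enc ?_
  rw [← List.nil_append (l a).flatten]
  generalize ([] : List β) = s
  generalize l a = m
  induction m generalizing s with
  | nil => simp
  | cons b m ih => simp only [List.foldl_cons, List.flatten_cons, ih, List.append_assoc]

@[fun_prop]
theorem Poly.flatMap {l : α → List β} {g : α → β → List γ} (hl : Poly l)
    (hg : Poly fun p : α × β => g p.1 p.2) : Poly fun a => (l a).flatMap (g a) :=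
  (hl.map hg).flatten.recode fun a => by rw [List.flatMap_def]

@[fun_prop]
theorem Poly.filter {l : α → List β} {P : α → β → Bool} (hl : Poly l)
    (hP : Poly fun p : α × β => P p.1 p.2) : Poly fun a => (l a).filter (P a) := by
  have : Poly fun a => (l a).flatMap fun b => if P a b = true then [b] else [] := by
    refine Poly.flatMap hl (Poly.ite (hP.recode fun _ => ?_) ?_ ?_)
    · simp
    · fun_prop
    · fun_prop
  refine this.recode fun a => ?_
  congr 1
  generalize l a = m
  induction m with
  | nil => rfl
  | cons b m ih =>
    rw [List.flatMap_cons, ih, List.filter_cons]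
    split_ifs <;> rfl

/-- The element at the head of a list, with a default value. -/
@[fun_prop]
theorem Poly.headD {l : α → List β} {d : α → β} (hl : Poly l) (hd : Poly d) :
    Poly fun a => (l a).headD (d a) :=
  (Poly.list_match (g := fun _ b _ => b) hl hd (by fun_prop)).recode fun a => by
    cases l a <;> rfl

@[fun_prop]
theorem Poly.tail {l : α → List β} (hl : Poly l) : Poly fun a => (l a).tail :=
  (Poly.list_match (f := fun _ => []) (g := fun _ _ t => t) hl (by fun_prop)
    (by fun_prop)).recode fun a => by cases l a <;> rfl

/-- A number is a list without information. -/
theorem Poly.replicate : Poly fun n : ℕ => List.replicate n Data.nil :=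
  Poly.id'.recode fun n => by
    show Data.unary n = Data.ofList (List.map (fun d => d) (List.replicate n Data.nil))
    rw [List.map_id', Data.unary]

@[fun_prop]
theorem Poly.succ {f : α → ℕ} (hf : Poly f) : Poly fun a => f a + 1 :=
  (Poly.nilData.prodMk hf).recode fun a => by
    show Data.cons .nil (Data.unary (f a)) = Data.unary (f a + 1)
    simp [Data.unary, List.replicate_succ, Data.ofList]

@[fun_prop]
theorem Poly.length {l : α → List β} (hl : Poly l) : Poly fun a => (l a).length :=
  (hl.map (g := fun _ _ => Data.nil) (by fun_prop)).recode fun a => by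
    show Data.ofList (List.map (fun d => d) _) = Data.unary _
    simp [Data.unary, List.map_const']

/-- Counting up to a number. -/
@[fun_prop]
theorem Poly.range {f : α → ℕ} (hf : Poly f) : Poly fun a => List.range (f a) := by
  have h : ∀ n, (List.replicate n Data.nil).foldl (fun s _ => s ++ [s.length]) [] =
      List.range n := by
    intro n
    induction n with
    | zero => rfl
    | succ n ih => rw [List.replicate_succ', List.foldl_append, ih]; simp [List.range_succ]
  have : Poly fun n : ℕ =>
      (List.replicate n Data.nil).foldl (fun s _ => s ++ [s.length]) [] := by
    refine Poly.foldl (g := fun _ s _ => s ++ [s.length]) Poly.replicate (by fun_prop)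
      (by fun_prop) ⟨1 + Polynomial.X * (Polynomial.X + 1), fun n t ht => ?_⟩
    rw [List.prefix_replicate_iff] at ht
    rw [ht.2, h]
    refine (size_le_length_mul (B := (Code.enc n).size) ?_).trans ?_
    · intro b hb
      rw [List.mem_range] at hb
      simp only [size_enc_nat]
      omega
    · simp only [List.length_range, size_enc_nat, Polynomial.eval_add, Polynomial.eval_one,
        Polynomial.eval_mul, Polynomial.eval_X]
      refine Nat.add_le_add_left (Nat.mul_le_mul_right _ ?_) _
      omega
  exact (this.comp hf).recode fun a => by rw [h]

@[fun_prop]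
theorem Poly.drop {l : α → List β} {f : α → ℕ} (hl : Poly l) (hf : Poly f) :
    Poly fun a => (l a).drop (f a) := by
  have h : ∀ n (m : List β), List.tail^[(List.range n).length] m = m.drop n := by
    intro n m
    rw [List.length_range]
    induction n with
    | zero => rfl
    | succ n ih => rw [Function.iterate_succ_apply', ih, List.tail_drop]
  have : Poly fun p : ℕ × List β => List.tail^[(List.range p.1).length] p.2 := by
    refine Poly.iterate (by fun_prop) (by fun_prop) (by fun_prop) ⟨Polynomial.X, fun p m _ => ?_⟩
    have h1 := h m p.2
    rw [List.length_range] at h1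
    rw [h1, Polynomial.eval_X]
    have := size_enc_le_of_suffix (List.drop_suffix m p.2)
    have h3 : (Code.enc p).size = 1 + (Code.enc p.1).size + (Code.enc p.2).size := rfl
    omega
  exact (this.comp (hf.prodMk hl)).recode fun a => by rw [h]

@[fun_prop]
theorem Poly.getD {l : α → List β} {f : α → ℕ} {d : α → β} (hl : Poly l) (hf : Poly f)
    (hd : Poly d) : Poly fun a => (l a).getD (f a) (d a) :=
  ((hl.drop hf).headD hd).recode fun a => by
    rw [List.headD_eq_head?_getD, List.head?_drop, List.getD_eq_getElem?_getD]

@[fun_prop]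
theorem Poly.sub {f g : α → ℕ} (hf : Poly f) (hg : Poly g) : Poly fun a => f a - g a :=
  ((Poly.range hf).drop hg).length.recode fun a => by rw [List.length_drop, List.length_range]

@[fun_prop]
theorem Poly.add {f g : α → ℕ} (hf : Poly f) (hg : Poly g) : Poly fun a => f a + g a :=
  ((Poly.range hf).append (Poly.range hg)).length.recode fun a => by simp

@[fun_prop]
theorem Poly.mul {f g : α → ℕ} (hf : Poly f) (hg : Poly g) : Poly fun a => f a * g a :=
  ((Poly.range hf).flatMap (g := fun a _ => List.range (g a)) (by fun_prop)).length.recode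
    fun a => by simp

@[fun_prop]
theorem Poly.decide_le {f g : α → ℕ} (hf : Poly f) (hg : Poly g) :
    Poly fun a => decide (f a ≤ g a) :=
  ((hf.sub hg).decide_eq (Poly.const 0)).recode fun a => by
    congr 1; exact decide_eq_decide.mpr Nat.sub_eq_zero_iff_le

@[fun_prop]
theorem Poly.decide_lt {f g : α → ℕ} (hf : Poly f) (hg : Poly g) :
    Poly fun a => decide (f a < g a) :=
  (hf.succ.decide_le hg).recode fun _ => rfl

@[fun_prop]
theorem Poly.half {f : α → ℕ} (hf : Poly f) : Poly fun a => f a / 2 := by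
  have : Poly fun a => ((List.range (f a)).filter fun k => decide (2 * (k + 1) ≤ f a)).length :=
    by fun_prop
  refine this.recode fun a => ?_
  congr 1
  have h : ∀ n m, ((List.range m).filter fun k => decide (2 * (k + 1) ≤ n)).length =
      min m (n / 2) := by
    intro n m
    induction m with
    | zero => simp
    | succ m ih =>
      rw [List.range_succ, List.filter_append, List.length_append, ih]
      by_cases h : 2 * (m + 1) ≤ n
      · simp [h]; omega
      · simp [h]; omega
  rw [h]
  omega

theorem Poly.polynomial (T : Polynomial ℕ) {f : α → ℕ} (hf : Poly f) :
    Poly fun a => T.eval (f a) := by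
  induction T using Polynomial.induction_on' with
  | add p q hp hq => simpa only [Polynomial.eval_add] using hp.add hq
  | monomial k c =>
    simp only [Polynomial.eval_monomial]
    refine (Poly.const c).mul ?_
    induction k with
    | zero => simp only [pow_zero]; fun_prop
    | succ k ih => simp only [pow_succ]; fun_prop

@[fun_prop]
theorem Poly.take {l : α → List β} {f : α → ℕ} (hl : Poly l) (hf : Poly f) :
    Poly fun a => (l a).take (f a) := by
  have : Poly fun a => ((l a).reverse.drop ((l a).length - f a)).reverse := by fun_prop
  exact this.recode fun a => by
    rw [List.reverse_drop, List.reverse_reverse, List.length_reverse]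
    rcases le_total (f a) (l a).length with h | h
    · rw [Nat.sub_sub_self h]
    · rw [List.take_of_length_le h, List.take_of_length_le (by omega)]

@[fun_prop]
theorem Poly.inits {l : α → List β} (hl : Poly l) : Poly fun a => (l a).inits := by
  have : Poly fun a => (List.range ((l a).length + 1)).map fun k => (l a).take k := by fun_prop
  refine this.recode fun a => ?_
  congr 1
  refine List.ext_getElem (by simp) fun i h₁ h₂ => ?_
  simp

@[fun_prop]
theorem Poly.zip {l : α → List β} {m : α → List γ} (hl : Poly l) (hm : Poly m) :
    Poly fun a => (l a).zip (m a) := by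
  have key : Poly fun p : List β × List γ => p.1.foldl
      (fun (s : List (β × γ) × List γ) b => match s.2 with
        | [] => s
        | c :: t => ((b, c) :: s.1, t)) ([], p.2) := by
    refine Poly.foldl_of_add (g := fun _ (s : List (β × γ) × List γ) b => match s.2 with
        | [] => s
        | c :: t => ((b, c) :: s.1, t)) (by fun_prop) (by fun_prop) ?_
        ⟨Polynomial.X + 1, fun a s b hb => ?_⟩
    · exact Poly.list_match (by fun_prop) (by fun_prop) (by fun_prop)
    · have h1 := Eunomia.size_le_of_mem hb
      obtain ⟨s, t⟩ := s
      obtain ⟨a, a'⟩ := a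
      cases t with
      | nil => simp only; omega
      | cons c t =>
        simp only [size_enc_prod, size_enc_cons, Polynomial.eval_add, Polynomial.eval_X,
          Polynomial.eval_one] at h1 ⊢
        omega
  refine ((Poly.fst'.comp (key.comp (hl.prodMk hm))).reverse).recode fun a => ?_
  congr 1
  have : ∀ (l : List β) (s : List (β × γ)) (m : List γ), (l.foldl
      (fun (s : List (β × γ) × List γ) b => match s.2 with
        | [] => s
        | c :: t => ((b, c) :: s.1, t)) (s, m)).1.reverse = s.reverse ++ l.zip m := by
    intro l
    induction l with
    | nil => simp
    | cons b l ih =>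
      intro s m
      cases m with
      | nil =>
        have := ih s []
        simpa using this
      | cons c m => simp [ih]
  simpa using this (l a) [] (m a)

@[fun_prop]
theorem Poly.zipWith {l : α → List β} {m : α → List γ} {g : α → β → γ → δ} (hl : Poly l)
    (hm : Poly m) (hg : Poly fun p : α × β × γ => g p.1 p.2.1 p.2.2) :
    Poly fun a => List.zipWith (g a) (l a) (m a) :=
  ((hl.zip hm).map (g := fun a p => g a p.1 p.2) hg).recode fun a => by
    congr 1
    generalize l a = x
    generalize m a = y
    induction x generalizing y with
    | nil => simp
    | cons b x ih => cases y <;> simp [ih]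

@[fun_prop]
theorem Poly.any {l : α → List β} {P : α → β → Bool} (hl : Poly l)
    (hP : Poly fun p : α × β => P p.1 p.2) : Poly fun a => (l a).any (P a) :=
  (Poly.decide_lt (Poly.const 0) (hl.filter hP).length).recode fun a => by
    congr 1
    rw [Bool.eq_iff_iff]
    simp [List.length_pos_iff_exists_mem]

@[fun_prop]
theorem Poly.decide_mem [DecidableEq β] {f : α → β} {l : α → List β} (hf : Poly f) (hl : Poly l) :
    Poly fun a => decide (f a ∈ l a) := by
  have : Poly fun a => (l a).any fun b => decide (b = f a) := by fun_prop
  refine this.recode fun a => ?_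
  congr 1
  rw [Bool.eq_iff_iff]
  simp

@[fun_prop]
theorem Poly.findIdx {l : α → List β} {P : α → β → Bool} (hl : Poly l)
    (hP : Poly fun p : α × β => P p.1 p.2) : Poly fun a => (l a).findIdx (P a) := by
  let g : α → Bool × ℕ → β → Bool × ℕ := fun a s b =>
    if s.1 = true then s else if P a b = true then (true, s.2) else (false, s.2 + 1)
  have hd : Poly fun p : α × (Bool × ℕ) × β => P p.1 p.2.2 :=
    hP.comp (f := fun p : α × (Bool × ℕ) × β => (p.1, p.2.2)) (by fun_prop)
  have hg : Poly fun p : α × (Bool × ℕ) × β => g p.1 p.2.1 p.2.2 := by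
    refine Poly.ite (by fun_prop) (by fun_prop) (Poly.ite (by fun_prop) ?_ ?_) <;> fun_prop
  have : Poly fun a => ((l a).foldl (g a) (false, 0)).2 := by
    refine Poly.snd'.comp (Poly.foldl_of_add hl (by fun_prop) hg ⟨5, fun a s b _ => ?_⟩)
    obtain ⟨c, n⟩ := s
    have h1 : (Polynomial.eval (Code.enc a).size 5 : ℕ) = 5 := by simp
    have h2 := size_enc_bool true
    have h3 := size_enc_bool false
    simp only [g]
    split_ifs <;> simp only [size_enc_prod, size_enc_nat] <;> omega
  refine this.recode fun a => ?_
  congr 1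
  have h1 : ∀ (m : List β) n, m.foldl (g a) (true, n) = (true, n) := by
    intro m n
    induction m with
    | nil => rfl
    | cons b m ih => simpa [g] using ih
  have h2 : ∀ (m : List β) n, (m.foldl (g a) (false, n)).2 = n + m.findIdx (P a) := by
    intro m
    induction m with
    | nil => simp
    | cons b m ih =>
      intro n
      rw [List.foldl_cons, List.findIdx_cons]
      by_cases hb : P a b = true
      · simp [g, hb, h1]
      · simp only [g, hb, if_false, Bool.false_eq_true, ih]
        simp
        omega
  simpa using h2 (l a) 0

end

/-! ### Reading the choice of the adversary -/

section

variable {α β γ δ σ : Type} [Code α] [Code β] [Code γ] [Code δ] [Code σ]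

@[fun_prop]
theorem Poly.dataFst : Poly Data.fst :=
  Poly.of_step .fst (fun _ _ => rfl) fun d => (Data.size_fst_le d).trans (Nat.le_add_right _ _)

@[fun_prop]
theorem Poly.dataSnd : Poly Data.snd :=
  Poly.of_step .snd (fun _ _ => rfl) fun d => (Data.size_snd_le d).trans (Nat.le_add_right _ _)

theorem Data.ofList_toList (d : Data) : Data.ofList d.toList = d := by
  induction d with
  | nil => rfl
  | cons a b _ ih => rw [toList, ofList, ih]

@[fun_prop]
theorem Poly.toList : Poly Data.toList :=
  Poly.id'.recode fun d => by
    show d = Data.ofList (d.toList.map fun x => x)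
    rw [List.map_id', Data.ofList_toList]

@[fun_prop]
theorem Poly.toBool : Poly Data.toBool := by
  have : Poly fun d : Data => if d = Data.nil then false else true := by fun_prop
  exact this.recode fun d => by cases d <;> simp [Data.toBool]

@[fun_prop]
theorem Poly.toStr : Poly Data.toStr := by
  unfold Data.toStr
  fun_prop

@[fun_prop]
theorem Poly.readCol : Poly readCol := by
  unfold Eunomia.readCol
  fun_prop

@[fun_prop]
theorem Poly.readLog : Poly readLog := by
  unfold Eunomia.readLog
  fun_prop

@[fun_prop]
theorem Poly.readSchema : Poly readSchema := by
  unfold Eunomia.readSchema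
  fun_prop

instance : Code Challenge where
  enc ch := Code.enc (ch.schema, ch.consts, ch.disps, ch.eqs, ch.log₀, ch.log₁)
  inj := fun a b h => by
    have := Code.inj h
    cases a
    cases b
    simp_all

@[fun_prop]
theorem Poly.readChallenge : Poly readChallenge := by
  have : Poly fun d : Data => (Eunomia.readSchema d.fst, d.snd.fst.toList.map Data.toStr,
      d.snd.snd.fst.toList.map Data.toStr,
      d.snd.snd.snd.fst.toList.map fun p => (Eunomia.readCol p.fst, Eunomia.readCol p.snd),
      Eunomia.readLog d.snd.snd.snd.snd.fst, Eunomia.readLog d.snd.snd.snd.snd.snd) := by fun_prop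
  exact this.recode fun _ => rfl

theorem Poly.challenge : Poly fun ch : Challenge =>
    (ch.schema, ch.consts, ch.disps, ch.eqs, ch.log₀, ch.log₁) := Poly.id'.recode fun _ => rfl

@[fun_prop]
theorem Poly.schema : Poly Challenge.schema := Poly.fst'.comp Poly.challenge

@[fun_prop]
theorem Poly.consts : Poly Challenge.consts := (Poly.fst'.comp Poly.snd').comp Poly.challenge

@[fun_prop]
theorem Poly.disps : Poly Challenge.disps :=
  (Poly.fst'.comp (Poly.snd'.comp Poly.snd')).comp Poly.challenge

@[fun_prop]
theorem Poly.eqs : Poly Challenge.eqs :=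
  (Poly.fst'.comp (Poly.snd'.comp (Poly.snd'.comp Poly.snd'))).comp Poly.challenge

@[fun_prop]
theorem Poly.log₀ : Poly Challenge.log₀ :=
  (Poly.fst'.comp (Poly.snd'.comp (Poly.snd'.comp (Poly.snd'.comp Poly.snd')))).comp Poly.challenge

@[fun_prop]
theorem Poly.log₁ : Poly Challenge.log₁ :=
  (Poly.snd'.comp (Poly.snd'.comp (Poly.snd'.comp (Poly.snd'.comp Poly.snd')))).comp Poly.challenge

/-! ### Classes of columns -/

@[fun_prop]
theorem Poly.columns : Poly columns := by
  unfold Eunomia.columns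
  fun_prop

@[fun_prop]
theorem Poly.timeColumns : Poly timeColumns := by
  unfold Eunomia.timeColumns
  fun_prop

/-- The result of a sequence of substitutions. -/
def label {β : Type} [DecidableEq β] (subs : List (β × β)) (z : β) : β :=
  subs.foldl (fun z s => if z = s.1 then s.2 else z) z

/-- Substitutions that identify the end points of each edge, obtained by contracting the edges one
after the other. -/
def contract {β : Type} [DecidableEq β] (E : List (β × β)) : List (β × β) :=
  E.foldl (fun subs e => subs ++ [(label subs e.2, label subs e.1)]) []

theorem label_append {β : Type} [DecidableEq β] (subs : List (β × β)) (s : β × β) (z : β) :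
    label (subs ++ [s]) z = if label subs z = s.1 then s.2 else label subs z := by
  rw [label, List.foldl_append]
  rfl

theorem contract_append {β : Type} [DecidableEq β] (E : List (β × β)) (e : β × β) :
    contract (E ++ [e]) =
      contract E ++ [(label (contract E) e.2, label (contract E) e.1)] := by
  simp [contract, List.foldl_append]

/-- Contraction of the edges computes the connected components. -/
theorem label_contract_eq_iff {β : Type} [DecidableEq β] (E : List (β × β)) (a b : β) :
    label (contract E) a = label (contract E) b ↔
      Relation.EqvGen (fun a b => (a, b) ∈ E) a b := by
  constructor
  · induction E using List.reverseRecOn generalizing a b with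
    | nil => intro h; simp only [contract, label, List.foldl_nil] at h; exact h ▸ .refl _
    | append_singleton E e ih =>
      intro h
      have up : ∀ a b, label (contract E) a = label (contract E) b →
          Relation.EqvGen (fun a b => (a, b) ∈ E ++ [e]) a b := fun a b h =>
        (ih a b h).mono fun a b h => List.mem_append_left _ h
      have he : Relation.EqvGen (fun a b => (a, b) ∈ E ++ [e]) e.1 e.2 := .rel _ _ (by simp)
      simp only [contract_append, label_append] at h
      split_ifs at h with h1 h2 h2
      · exact up _ _ (h1.trans h2.symm)
      · exact ((up _ _ h1).trans _ _ _ (he.symm)).trans _ _ _ (up _ _ h)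
      · exact ((up _ _ h).trans _ _ _ he).trans _ _ _ (up _ _ h2.symm)
      · exact up _ _ h
  · have key : ∀ a b, (a, b) ∈ E → label (contract E) a = label (contract E) b := by
      induction E using List.reverseRecOn with
      | nil => simp
      | append_singleton E e ih =>
        intro a b h
        rw [contract_append, label_append, label_append]
        rcases List.mem_append.mp h with h | h
        · rw [ih a b h]
        · simp only [List.mem_singleton] at h
          subst h
          simp only
          split_ifs <;> rfl
    intro h
    induction h with
    | rel a b h => exact key a b h
    | refl a => rfl
    | symm a b _ ih => exact ih.symm
    | trans a b c _ _ ih1 ih2 => exact ih1.trans ih2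

@[fun_prop]
theorem Poly.label [DecidableEq β] {s : α → List (β × β)} {f : α → β} (hs : Poly s)
    (hf : Poly f) : Poly fun a => label (s a) (f a) := by
  unfold Eunomia.label
  have hU := hs.size_le
  obtain ⟨U, hU⟩ := hU
  refine Poly.foldl_of_add (g := fun _ z s => if z = s.1 then s.2 else z) hs hf (by fun_prop)
    ⟨U, fun a z b hb => ?_⟩
  have h1 := Eunomia.size_le_of_mem hb
  have h2 := hU a
  obtain ⟨b, c⟩ := b
  rw [size_enc_prod] at h1
  simp only
  split_ifs <;> omega

theorem size_label_le [DecidableEq β] {B : ℕ} {subs : List (β × β)}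
    (hs : ∀ s ∈ subs, (Code.enc s.2).size ≤ B) {z : β} (hz : (Code.enc z).size ≤ B) :
    (Code.enc (Eunomia.label subs z)).size ≤ B := by
  induction subs using List.reverseRecOn with
  | nil => exact hz
  | append_singleton subs s ih =>
    rw [label_append]
    split_ifs
    · exact hs s (by simp)
    · exact ih fun t ht => hs t (by simp [ht])

@[fun_prop]
theorem Poly.contract [DecidableEq β] : Poly (contract : List (β × β) → List (β × β)) := by
  refine Poly.foldl (l := fun E : List (β × β) => E) (i := fun _ => [])
    (g := fun _ subs e => subs ++ [(Eunomia.label subs e.2, Eunomia.label subs e.1)])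
    (by fun_prop) (by fun_prop) (by fun_prop)
    ⟨1 + Polynomial.X * (1 + 2 * Polynomial.X + 1), fun E t ht => ?_⟩
  have hE : ∀ e ∈ t, (Code.enc e.1).size ≤ (Code.enc E).size ∧
      (Code.enc e.2).size ≤ (Code.enc E).size := by
    intro e he
    have := Eunomia.size_le_of_mem (ht.subset he)
    obtain ⟨e, e'⟩ := e
    rw [size_enc_prod] at this
    constructor <;> dsimp only <;> omega
  have hlen : t.length ≤ (Code.enc E).size :=
    (length_le_size t).trans (size_enc_le_of_prefix ht)
  change (Code.enc (Eunomia.contract t)).size ≤ _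
  have key : ∀ B : ℕ, (∀ e ∈ t, (Code.enc e.1).size ≤ B ∧ (Code.enc e.2).size ≤ B) →
      (Eunomia.contract t).length = t.length ∧ ∀ s ∈ Eunomia.contract t,
        (Code.enc s.1).size ≤ B ∧ (Code.enc s.2).size ≤ B := by
    intro B
    clear hE hlen ht
    induction t using List.reverseRecOn with
    | nil => simp [Eunomia.contract]
    | append_singleton t e ih =>
      intro h
      obtain ⟨h1, h2⟩ := ih fun e he => h e (by simp [he])
      have he := h e (by simp)
      rw [contract_append]
      refine ⟨by simp [h1], fun s hs => ?_⟩
      rcases List.mem_append.mp hs with hs | hs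
      · exact h2 s hs
      · rw [List.mem_singleton] at hs
        subst hs
        exact ⟨size_label_le (fun s hs => (h2 s hs).2) he.2,
          size_label_le (fun s hs => (h2 s hs).2) he.1⟩
  obtain ⟨h1, h2⟩ := key _ hE
  refine (size_le_length_mul (B := 1 + 2 * (Code.enc E).size) fun s hs => ?_).trans ?_
  · have := h2 s hs
    obtain ⟨s, s'⟩ := s
    rw [size_enc_prod]
    dsimp only at this
    omega
  · rw [h1]
    simp only [Polynomial.eval_add, Polynomial.eval_one, Polynomial.eval_mul, Polynomial.eval_X,
      Polynomial.eval_ofNat]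
    exact Nat.add_le_add_left (Nat.mul_le_mul_right _ hlen) _

/-- The pairs of columns that generate the classes. -/
def classEdges (S : Schema) (δ : EqScheme) : List (Col × Col) :=
  δ ++ (timeColumns S).flatMap fun a => (timeColumns S).map fun b => (a, b)

/-- The position of the first column of the class of `a`, which is used as the name of the class.
-/
def classIdx (S : Schema) (δ : EqScheme) (a : Col) : ℕ :=
  (columns S).findIdx fun a' =>
    decide (label (contract (classEdges S δ)) a' = label (contract (classEdges S δ)) a)

theorem label_classEdges_eq_iff (S : Schema) (δ : EqScheme) (a b : Col) :
    label (contract (classEdges S δ)) a = label (contract (classEdges S δ)) b ↔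
      SameClass S δ a b := by
  rw [label_contract_eq_iff, SameClass]
  have : (fun a b => (a, b) ∈ classEdges S δ) =
      fun a b => (a, b) ∈ δ ∨ (a ∈ timeColumns S ∧ b ∈ timeColumns S) := by
    funext a b
    simp [classEdges]
  rw [this]

theorem findIdx_sameClass (S : Schema) (δ : EqScheme) (a : Col)
    [∀ a', Decidable (SameClass S δ a' a)] :
    ((columns S).findIdx fun a' => decide (SameClass S δ a' a)) = classIdx S δ a := by
  rw [classIdx]
  congr 1
  funext a'
  exact decide_eq_decide.mpr (label_classEdges_eq_iff S δ a' a).symm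

@[fun_prop]
theorem Poly.classIdx {S : α → Schema} {d : α → EqScheme} {f : α → Col} (hS : Poly S)
    (hd : Poly d) (hf : Poly f) : Poly fun a => classIdx (S a) (d a) (f a) := by
  unfold Eunomia.classIdx Eunomia.classEdges
  fun_prop

theorem classIdx_lt {S : Schema} {δ : EqScheme} {a : Col} (h : a ∈ columns S) :
    classIdx S δ a < (columns S).length :=
  List.findIdx_lt_length_of_exists ⟨a, h, by simp⟩

/-- The class index is a complete invariant of the class. -/
theorem classIdx_eq_iff {S : Schema} {δ : EqScheme} {a b : Col} (ha : a ∈ columns S) :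
    classIdx S δ a = classIdx S δ b ↔ SameClass S δ a b := by
  rw [← label_classEdges_eq_iff]
  constructor
  · intro h
    have hlt := classIdx_lt (δ := δ) ha
    have h1 := List.findIdx_getElem (w := hlt)
    have h2 := List.findIdx_getElem (w := h ▸ hlt)
    rw [decide_eq_true_eq] at h1 h2
    have h3 : (columns S)[classIdx S δ a] = (columns S)[classIdx S δ b]'(h ▸ hlt) := by
      congr 1
    exact h1.symm.trans ((congrArg _ h3).trans h2)
  · intro h
    simp only [classIdx, h]

/-! ### Logs -/

/-- Cell-wise application of a function that may depend on the column. -/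
def mapLog (F : Col → Str → Str) (S : Schema) (L : Log) : Log :=
  List.zipWith (fun T rows =>
    rows.map fun r => List.zipWith (fun a v => F (T.1, a.1) v) T.2 r) S L

@[fun_prop]
theorem Poly.mapLog {F : α → Col → Str → Str} {S : α → Schema} {L : α → Log}
    (hF : Poly fun p : α × Col × Str => F p.1 p.2.1 p.2.2) (hS : Poly S) (hL : Poly L) :
    Poly fun x => mapLog (F x) (S x) (L x) := by
  unfold Eunomia.mapLog
  have : Poly fun p : (((α × (Str × List (Str × Bool)) × List (List Str)) × List Str) ×
      (Str × Bool) × Str) => F p.1.1.1 (p.1.1.2.1.1, p.2.1.1) p.2.2 :=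
    hF.comp (f := fun p : (((α × (Str × List (Str × Bool)) × List (List Str)) × List Str) ×
      (Str × Bool) × Str) => (p.1.1.1, (p.1.1.2.1.1, p.2.1.1), p.2.2)) (by fun_prop)
  fun_prop

@[fun_prop]
theorem Poly.cells {S : α → Schema} {L : α → Log} (hS : Poly S) (hL : Poly L) :
    Poly fun x => cells (S x) (L x) := by
  unfold Eunomia.cells
  fun_prop

@[fun_prop]
theorem Poly.timeStamps {S : α → Schema} {L : α → Log} (hS : Poly S) (hL : Poly L) :
    Poly fun x => timeStamps (S x) (L x) := by
  unfold Eunomia.timeStamps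
  have : Poly fun p : α × (Col × Str) => decide (p.2.1 ∈ Eunomia.timeColumns (S p.1)) := by
    exact (Poly.decide_mem (f := fun p : α × (Col × Str) => p.2.1)
      (l := fun p => Eunomia.timeColumns (S p.1)) (by fun_prop) (by fun_prop)).recode fun p =>
        congrArg Code.enc (decide_eq_decide.mpr Iff.rfl)
  fun_prop

@[fun_prop]
theorem Poly.timePairs {S : α → Schema} {D : α → List Str} {L : α → Log} (hS : Poly S)
    (hD : Poly D) (hL : Poly L) : Poly fun x => timePairs (S x) (D x) (L x) := by
  unfold Eunomia.timePairs
  fun_prop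

end

/-! ### Comparison of sums of integers in binary -/

/-- The value of the digits of `s` from position `k` on, divided by `2 ^ k`; the sign is inverted
if `neg` is set. -/
def digitsFrom (neg : Bool) (s : Str) (k : ℕ) : ℤ :=
  if s.headD false = neg then (Nat.ofDigits 2 ((s.tail.drop k).map Bool.toNat) : ℤ)
  else -(Nat.ofDigits 2 ((s.tail.drop k).map Bool.toNat) : ℤ)

/-- The signed digit of `s` at position `k`, plus one. -/
def signedDigit (neg : Bool) (s : Str) (k : ℕ) : ℕ :=
  if s.headD false = neg then (if s.tail.getD k false = true then 2 else 1)
  else (if s.tail.getD k false = true then 0 else 1)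

theorem ofDigits_int_nil : Nat.ofDigits (2 : ℤ) [] = 0 := rfl

theorem ofDigits_int_cons (d : ℕ) (l : List ℕ) :
    Nat.ofDigits (2 : ℤ) (d :: l) = d + 2 * Nat.ofDigits (2 : ℤ) l := rfl

theorem digitsFrom_step (neg : Bool) (s : Str) (k : ℕ) :
    digitsFrom neg s k = signedDigit neg s k - 1 + 2 * digitsFrom neg s (k + 1) := by
  have h : (Nat.ofDigits 2 ((s.tail.drop k).map Bool.toNat) : ℤ) =
      (if s.tail.getD k false = true then 1 else 0) +
        2 * (Nat.ofDigits 2 ((s.tail.drop (k + 1)).map Bool.toNat) : ℤ) := by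
    rw [List.getD_eq_getElem?_getD, ← List.head?_drop, ← List.tail_drop]
    cases s.tail.drop k with
    | nil => simp [ofDigits_int_nil]
    | cons b t => cases b <;> simp [ofDigits_int_cons]
  unfold digitsFrom signedDigit
  rw [h]
  split_ifs <;> push_cast <;> ring

theorem digitsFrom_zero (s : Str) : digitsFrom false s 0 = toInt s := by
  cases s with
  | nil => simp [digitsFrom, toInt, ofDigits_int_nil]
  | cons b t => cases b <;> simp [digitsFrom, toInt]

theorem digitsFrom_zero_neg (s : Str) : digitsFrom true s 0 = -toInt s := by
  cases s with
  | nil => simp [digitsFrom, toInt, ofDigits_int_nil]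
  | cons b t => cases b <;> simp [digitsFrom, toInt]

theorem digitsFrom_eq_zero {neg : Bool} {s : Str} {k : ℕ} (h : s.length ≤ k) :
    digitsFrom neg s k = 0 := by
  have : s.tail.drop k = [] := List.drop_eq_nil_of_le (by rw [List.length_tail]; omega)
  simp [digitsFrom, this, ofDigits_int_nil]

/-- The carry, plus four, in the digit-wise computation of `-r - s + t + u` for
`p = ((r, s), (t, u))`, from the `n` least significant digits. The offset keeps the number natural:
each of the four signed digits is at least `-1`, so the carry is never less than `-4`. The offset
reproduces itself, since the four digits are shifted by one each and `(4 + 4) / 2 = 4`. -/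
def carry (p : (Str × Str) × Str × Str) (n : ℕ) : ℕ :=
  (List.range n).foldl (fun c k => (c + (signedDigit true p.1.1 k + signedDigit true p.1.2 k +
    signedDigit false p.2.1 k + signedDigit false p.2.2 k)) / 2) 4

/-- Comparison of sums of binary integers by their signed digits, which takes polynomial time. -/
theorem toInt_add_le_iff (p : (Str × Str) × Str × Str) :
    toInt p.1.1 + toInt p.1.2 ≤ toInt p.2.1 + toInt p.2.2 ↔
      4 ≤ carry p (p.1.1.length + p.1.2.length + p.2.1.length + p.2.2.length) := by
  -- Halving the carry and rounding down does not change whether the total is nonnegative.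
  have key : ∀ n, 0 ≤ (carry p n : ℤ) - 4 + (digitsFrom true p.1.1 n + digitsFrom true p.1.2 n +
      digitsFrom false p.2.1 n + digitsFrom false p.2.2 n) ↔
      toInt p.1.1 + toInt p.1.2 ≤ toInt p.2.1 + toInt p.2.2 := by
    intro n
    induction n with
    | zero =>
      simp only [digitsFrom_zero, digitsFrom_zero_neg, carry, List.range_zero, List.foldl_nil]
      omega
    | succ n ih =>
      rw [← ih, digitsFrom_step true p.1.1 n, digitsFrom_step true p.1.2 n,
        digitsFrom_step false p.2.1 n, digitsFrom_step false p.2.2 n]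
      have : carry p (n + 1) = (carry p n + (signedDigit true p.1.1 n + signedDigit true p.1.2 n +
          signedDigit false p.2.1 n + signedDigit false p.2.2 n)) / 2 := by
        simp [carry, List.range_succ]
      rw [this]
      push_cast
      omega
  rw [← key (p.1.1.length + p.1.2.length + p.2.1.length + p.2.2.length),
    digitsFrom_eq_zero (by omega), digitsFrom_eq_zero (by omega), digitsFrom_eq_zero (by omega),
    digitsFrom_eq_zero (by omega)]
  omega

section

variable {α β γ δ σ : Type} [Code α] [Code β] [Code γ] [Code δ] [Code σ]

@[fun_prop]
theorem Poly.signedDigit {f : α → Bool} {s : α → Str} {k : α → ℕ} (hf : Poly f) (hs : Poly s)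
    (hk : Poly k) : Poly fun a => signedDigit (f a) (s a) (k a) := by
  unfold Eunomia.signedDigit
  fun_prop

theorem signedDigit_le (neg : Bool) (s : Str) (k : ℕ) : signedDigit neg s k ≤ 2 := by
  unfold signedDigit
  split_ifs <;> omega

@[fun_prop]
theorem Poly.carry : Poly fun p : ((Str × Str) × Str × Str) × ℕ => carry p.1 p.2 := by
  unfold Eunomia.carry
  refine Poly.foldl_of_add (g := fun (p : ((Str × Str) × Str × Str) × ℕ) c k =>
    (c + (Eunomia.signedDigit true p.1.1.1 k + Eunomia.signedDigit true p.1.1.2 k +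
    Eunomia.signedDigit false p.1.2.1 k + Eunomia.signedDigit false p.1.2.2 k)) / 2)
    (by fun_prop) (by fun_prop) (by fun_prop) ⟨8, fun p c k _ => ?_⟩
  have h1 := signedDigit_le true p.1.1.1 k
  have h2 := signedDigit_le true p.1.1.2 k
  have h3 := signedDigit_le false p.1.2.1 k
  have h4 := signedDigit_le false p.1.2.2 k
  simp only [size_enc_nat, Polynomial.eval_ofNat]
  omega

@[fun_prop]
theorem Poly.decide_toInt_add_le {f g : α → Str × Str} (hf : Poly f) (hg : Poly g) :
    Poly fun a => decide (toInt (f a).1 + toInt (f a).2 ≤ toInt (g a).1 + toInt (g a).2) := by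
  have : Poly fun p : (Str × Str) × Str × Str =>
      decide (4 ≤ Eunomia.carry p (p.1.1.length + p.1.2.length + p.2.1.length + p.2.2.length)) := by
    have h : Poly fun p : (Str × Str) × Str × Str =>
        Eunomia.carry p (p.1.1.length + p.1.2.length + p.2.1.length + p.2.2.length) :=
      Poly.carry.comp (f := fun p : (Str × Str) × Str × Str => (p, p.1.1.length + p.1.2.length +
        p.2.1.length + p.2.2.length)) (by fun_prop)
    fun_prop
  refine (this.comp (hf.prodMk hg)).recode fun a => congrArg Code.enc ?_
  exact decide_eq_decide.mpr (toInt_add_le_iff (f a, g a)).symm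

/-! ### The rank of a sum -/

/-- One element of `l` for each value of `f`. -/
def representatives {β : Type} (f : β → ℤ) (l : List β) : List β :=
  l.foldl (fun s b => if (s.any fun c => decide (f b = f c)) = true then s else b :: s) []

theorem representatives_append {β : Type} (f : β → ℤ) (l : List β) (b : β) :
    representatives f (l ++ [b]) = if ((representatives f l).any fun c => decide (f b = f c)) = true
      then representatives f l else b :: representatives f l := by
  rw [representatives, List.foldl_append]
  rfl

theorem representatives_spec {β : Type} (f : β → ℤ) (l : List β) :
    ((representatives f l).map f).Nodup ∧
      ((representatives f l).map f).toFinset = (l.map f).toFinset := by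
  induction l using List.reverseRecOn with
  | nil => simp [representatives]
  | append_singleton l b ih =>
    obtain ⟨h1, h2⟩ := ih
    rw [representatives_append]
    have hmem : ((representatives f l).any fun c => decide (f b = f c)) = true ↔
        f b ∈ (representatives f l).map f := by
      simp only [List.any_eq_true, decide_eq_true_eq, List.mem_map]
      exact exists_congr fun c => and_congr_right fun _ => eq_comm
    split_ifs with h
    · rw [hmem] at h
      refine ⟨h1, ?_⟩
      have : f b ∈ (l.map f).toFinset := by rw [← h2]; exact List.mem_toFinset.mpr h
      rw [List.map_append, List.toFinset_append, h2]
      ext z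
      simp only [List.map_cons, List.map_nil, List.toFinset_cons, List.toFinset_nil,
        Finset.mem_union, Finset.mem_insert, Finset.notMem_empty, or_false]
      constructor
      · exact Or.inl
      · rintro (hz | rfl)
        · exact hz
        · exact this
    · rw [hmem] at h
      rw [List.map_cons]
      refine ⟨List.nodup_cons.mpr ⟨h, h1⟩, ?_⟩
      rw [List.toFinset_cons, h2, List.map_append, List.toFinset_append]
      ext z
      simp

/-- An algorithm for ranks: duplicate values are removed before counting. -/
theorem rank_eq (P : List (Str × Str)) (p : Str × Str) :
    rank P p = ((representatives (fun q => toInt q.1 + toInt q.2) P).filter fun q =>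
      decide (toInt q.1 + toInt q.2 ≤ toInt p.1 + toInt p.2)).length := by
  obtain ⟨h1, h2⟩ := representatives_spec (fun q : Str × Str => toInt q.1 + toInt q.2) P
  have h3 : ((P.map fun q => toInt q.1 + toInt q.2).toFinset.filter
      fun z => z ≤ toInt p.1 + toInt p.2) =
      (((representatives (fun q => toInt q.1 + toInt q.2) P).map fun q =>
        toInt q.1 + toInt q.2).filter fun z => decide (z ≤ toInt p.1 + toInt p.2)).toFinset := by
    rw [← h2]
    ext z
    simp
  rw [rank, h3, List.toFinset_card_of_nodup (h1.filter _), List.filter_map, List.length_map]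
  rfl

@[fun_prop]
theorem Poly.rank {P : α → List (Str × Str)} {p : α → Str × Str} (hP : Poly P) (hp : Poly p) :
    Poly fun a => rank (P a) (p a) := by
  have hd : Poly fun p : (Str × Str) × Str × Str =>
      decide (toInt p.1.1 + toInt p.1.2 = toInt p.2.1 + toInt p.2.2) := by
    have h1 : Poly fun p : (Str × Str) × Str × Str =>
      decide (toInt p.1.1 + toInt p.1.2 ≤ toInt p.2.1 + toInt p.2.2) := by fun_prop
    have h2 : Poly fun p : (Str × Str) × Str × Str =>
      decide (toInt p.2.1 + toInt p.2.2 ≤ toInt p.1.1 + toInt p.1.2) := by fun_prop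
    exact (Poly.decide_and h1 h2).recode fun p =>
      congrArg Code.enc (decide_eq_decide.mpr (by omega))
  have hr : Poly fun P : List (Str × Str) =>
      representatives (fun q => toInt q.1 + toInt q.2) P := by
    unfold representatives
    refine Poly.foldl_of_add (g := fun _ (s : List (Str × Str)) b =>
      if (s.any fun c => decide (toInt b.1 + toInt b.2 = toInt c.1 + toInt c.2)) = true then s
      else b :: s) (by fun_prop) (by fun_prop) ?_ ⟨1 + Polynomial.X, fun P s b hb => ?_⟩
    · have : Poly fun p : (List (Str × Str) × List (Str × Str) × Str × Str) × Str × Str =>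
          decide (toInt p.1.2.2.1 + toInt p.1.2.2.2 = toInt p.2.1 + toInt p.2.2) :=
        hd.comp (f := fun p : (List (Str × Str) × List (Str × Str) × Str × Str) × Str × Str =>
          (p.1.2.2, p.2)) (by fun_prop)
      have h3 : Poly fun p : List (Str × Str) × List (Str × Str) × Str × Str => p.2.1.any
          fun c => decide (toInt p.2.2.1 + toInt p.2.2.2 = toInt c.1 + toInt c.2) :=
        Poly.any (by fun_prop) this
      refine Poly.ite (h3.recode fun _ => by simp) (by fun_prop) (by fun_prop)
    · have := Eunomia.size_le_of_mem hb
      simp only [Polynomial.eval_add, Polynomial.eval_one, Polynomial.eval_X]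
      split_ifs
      · omega
      · rw [size_enc_cons]
        omega
  have h4 : Poly fun a => representatives (fun q => toInt q.1 + toInt q.2) (P a) := hr.comp hP
  have : Poly fun a => ((representatives (fun q => toInt q.1 + toInt q.2) (P a)).filter fun q =>
      decide (toInt q.1 + toInt q.2 ≤ toInt (p a).1 + toInt (p a).2)).length := by fun_prop
  exact this.recode fun a => by rw [rank_eq]

@[fun_prop]
theorem Poly.oped {F : α → Str → Str} {P : α → List (Str × Str)}
    (hF : Poly fun p : α × Str => F p.1 p.2) (hP : Poly P) : Poly fun a => oped (F a) (P a) := by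
  unfold Eunomia.oped
  have h1 : Poly fun p : α × Str × Str => F p.1 p.2.1 :=
    hF.comp (f := fun p : α × Str × Str => (p.1, p.2.1)) (by fun_prop)
  have h2 : Poly fun p : α × Str × Str => F p.1 p.2.2 :=
    hF.comp (f := fun p : α × Str × Str => (p.1, p.2.2)) (by fun_prop)
  fun_prop

/-! ### What the adversary receives, for an arbitrary encryption of the cells -/

/-- Some timestamp column, if there is one. -/
def timeCol (S : Schema) : Col := (timeColumns S).headD ([], [])

/-- What the adversary receives if `F a v` stands for the encryption of the value `v` in the
column `a`. -/
def viewWith (F : Col → Str → Str) (ch : Challenge) (L : Log) : Data :=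
  .cons (writeLog (mapLog F ch.schema L))
    (.cons (writeOPED (oped (F (timeCol ch.schema)) (timePairs ch.schema ch.disps L)))
      (.cons (Data.ofList (((timePairs ch.schema ch.disps L).inits.map
          (oped (F (timeCol ch.schema)))).map writeOPED))
        (writeConstants ((columns ch.schema).flatMap fun a =>
          (ch.consts.filter fun c => decide ((a, c) ∈ cells ch.schema L)).map
            fun c => (a, c, F a c)))))

theorem timePairs_eq_nil {S : Schema} {D : List Str} {L : Log} (h : timeColumns S = []) :
    timePairs S D L = [] := by
  simp [timePairs, timeStamps, h]

theorem view_eq (e : Str → Str → Str) (K : KeySet) (ch : Challenge) (L : Log) :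
    view e K ch L = viewWith (fun a => e (K a)) ch L := by
  have h : ∀ P : List (Str × Str), P <+: timePairs ch.schema ch.disps L →
      oped (e (timeKey ch.schema K)) P = oped (e (K (timeCol ch.schema))) P := by
    intro P hP
    cases hT : timeColumns ch.schema with
    | nil =>
      rw [timePairs_eq_nil hT, List.prefix_nil] at hP
      rw [hP]
      rfl
    | cons a T => simp [timeKey, timeCol, hT]
  have h2 : opedConstruction e K ch.schema ch.disps L =
      (timePairs ch.schema ch.disps L).inits.map (oped (e (K (timeCol ch.schema)))) :=
    List.map_congr_left fun P hP => h P ((List.mem_inits _ _).mp hP)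
  unfold view viewWith
  rw [h2]
  simp only [encryptLogDET, h _ List.prefix_rfl]
  rfl

theorem poly_viewWith {F : α → Col → Str → Str} {ch : α → Challenge} {L : α → Log}
    (hF : Poly fun p : α × Col × Str => F p.1 p.2.1 p.2.2) (hch : Poly ch) (hL : Poly L) :
    Poly fun a => viewWith (F a) (ch a) (L a) := by
  have hT : Poly fun p : α × Str => F p.1 (timeCol (ch p.1).schema) p.2 := by
    refine hF.comp (f := fun p : α × Str => (p.1, timeCol (ch p.1).schema, p.2)) ?_
    unfold timeCol
    fun_prop
  have h1 : Poly fun a => Eunomia.mapLog (F a) (ch a).schema (L a) :=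
    Poly.mapLog hF (by fun_prop) hL
  have h2 : Poly fun a => oped (F a (timeCol (ch a).schema))
      (timePairs (ch a).schema (ch a).disps (L a)) := Poly.oped hT (by fun_prop)
  have h3 : Poly fun a => (timePairs (ch a).schema (ch a).disps (L a)).inits.map
      (oped (F a (timeCol (ch a).schema))) := by
    have : Poly fun p : α × List (Str × Str) =>
        oped (F p.1 (timeCol (ch p.1).schema)) p.2 :=
      Poly.oped (hT.comp (f := fun p : (α × List (Str × Str)) × Str => (p.1.1, p.2))
        (by fun_prop)) (by fun_prop)
    fun_prop
  have h4 : Poly fun a => (columns (ch a).schema).flatMap fun c =>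
      ((ch a).consts.filter fun v => decide ((c, v) ∈ cells (ch a).schema (L a))).map
        fun v => (c, v, F a c v) := by
    have h5 : Poly fun p : (α × Col) × Str =>
        decide ((p.1.2, p.2) ∈ cells (ch p.1.1).schema (L p.1.1)) :=
      (Poly.decide_mem (f := fun p : (α × Col) × Str => (p.1.2, p.2))
        (l := fun p => cells (ch p.1.1).schema (L p.1.1)) (by fun_prop) (by fun_prop)).recode
        fun p => congrArg Code.enc (decide_eq_decide.mpr Iff.rfl)
    have h6 : Poly fun p : (α × Col) × Str => F p.1.1 p.1.2 p.2 :=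
      hF.comp (f := fun p : (α × Col) × Str => (p.1.1, p.1.2, p.2)) (by fun_prop)
    fun_prop
  exact (h1.prodMk (h2.prodMk (h3.prodMk h4))).recode fun a => rfl

end

/-! ### Running a program with a simulated oracle -/

theorem Data.fst_cons (a b : Data) : (Data.cons a b).fst = a := rfl

theorem Data.snd_cons (a b : Data) : (Data.cons a b).snd = b := rfl

namespace Prog

/-- The program `p`, run on the second component of the input. A query `q` is answered by running
`h` on the pair of the first component of the input, which remains unchanged, and `q`. -/
def simulate (h : Prog) : Prog → Prog
  | id => comp id snd
  | nil => comp nil snd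
  | fst => comp fst snd
  | snd => comp snd snd
  | eq => comp eq snd
  | flip => comp flip snd
  | query => h
  | comp p q => comp (simulate h p) (pair fst (simulate h q))
  | pair p q => pair (simulate h p) (simulate h q)
  | cond p q r => cond (simulate h p) (simulate h q) (simulate h r)
  | iter p => comp snd (comp (iter (pair fst (simulate h p)))
      (pair (comp fst snd) (pair fst (comp snd snd))))

/-- The simulation has the output that `p` has with the simulated oracle. -/
theorem output_simulate {h : Prog} {O O' : Data → Data} {e : Data}
    (hh : ∀ q, h.output O (.cons e q) = PMF.pure (O' q)) (p : Prog) :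
    ∀ x, (simulate h p).output O (.cons e x) = p.output O' x := by
  induction p with
  | id | nil | fst | snd | eq | flip =>
    intro x
    rw [simulate, output_comp, output_snd, PMF.pure_bind]
    rfl
  | query => intro x; rw [simulate, hh, output_query]
  | comp p q ihp ihq =>
    intro x
    simp only [simulate, output_comp, output_pair, output_fst, PMF.pure_bind, Data.fst_cons, ihq,
      PMF.bind_map, Function.comp_def, ihp]
  | pair p q ihp ihq => intro x; simp only [simulate, output_pair, ihp, ihq]
  | cond p q r ihp ihq ihr => intro x; simp only [simulate, output_cond, ihp, ihq, ihr]
  | iter p ihp =>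
    intro x
    have h1 : ∀ s, (pair fst (simulate h p)).output O (.cons e s) =
        (p.output O' s).map (Data.cons e) := by
      intro s
      simp only [output_pair, output_fst, PMF.pure_bind, Data.fst_cons, ihp]
    simp only [simulate, output_comp, output_pair, output_fst, output_snd, PMF.pure_bind,
      Data.fst_cons, Data.snd_cons, PMF.pure_map, output_iter]
    rw [iterDist_map (Data.cons e) (p.output O') _ h1, PMF.bind_map]
    have h2 : output O snd ∘ Data.cons e = PMF.pure := by
      funext s
      exact output_snd O _
    rw [h2, PMF.bind_pure]

/-- Moving the environment `e` from the input of an iteration to its state. -/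
theorem time_rearrange (O : Data → Data) (e x : Data) (r : Data × ℕ)
    (hr : r ∈ ((pair (comp fst snd) (pair fst (comp snd snd))).eval O (.cons e x)).support) :
    r.1 = .cons x.fst (.cons e x.snd) ∧ r.2 ≤ 20 * (e.size + x.size + 1) := by
  have h1 := Data.size_fst_le x
  have h2 := Data.size_snd_le x
  rw [eval, mem_support_andThen] at hr
  obtain ⟨r₁, m₁, r₂, m₂, rfl⟩ := hr
  rw [eval, mem_support_andThen] at m₁
  obtain ⟨r₃, m₃, r₄, m₄, rfl⟩ := m₁
  rw [eval, mem_support_step] at m₃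
  subst m₃
  rw [eval, mem_support_step] at m₄
  subst m₄
  rw [mem_support_andThen] at m₂
  obtain ⟨r₅, m₅, r₆, m₆, rfl⟩ := m₂
  rw [PMF.mem_support_pure_iff] at m₆
  subst m₆
  rw [eval, mem_support_andThen] at m₅
  obtain ⟨r₁, m₁, r₂, m₂, rfl⟩ := m₅
  rw [eval, mem_support_step] at m₁
  subst m₁
  rw [mem_support_andThen] at m₂
  obtain ⟨r₅, m₅, r₆, m₆, rfl⟩ := m₂
  rw [PMF.mem_support_pure_iff] at m₆
  subst m₆
  rw [eval, mem_support_andThen] at m₅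
  obtain ⟨r₃, m₃, r₄, m₄, rfl⟩ := m₅
  rw [eval, mem_support_step] at m₃
  subst m₃
  rw [eval, mem_support_step] at m₄
  subst m₄
  refine ⟨rfl, ?_⟩
  simp only [Data.fst_cons, Data.snd_cons, Data.size]
  omega

/-- The case of iteration in `time_simulate`. -/
theorem time_simulate_iter {h : Prog} {O O' : Data → Data} {e : Data} {T H G : ℕ}
    (hG : 30 * (e.size + T + 1) + H ≤ G) {p : Prog}
    (ihp : ∀ x, ∀ r ∈ ((simulate h p).eval O (.cons e x)).support,
      ∃ t, (r.1, t) ∈ (p.eval O' x).support ∧ (t ≤ T → r.2 + G ≤ 2 * (G * t))) :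
    ∀ x, ∀ r ∈ ((simulate h (iter p)).eval O (.cons e x)).support,
      ∃ t, (r.1, t) ∈ ((iter p).eval O' x).support ∧ (t ≤ T → r.2 + G ≤ 2 * (G * t)) := by
  intro x r hr
  simp only [simulate] at hr
  rw [eval, mem_support_andThen] at hr
  obtain ⟨r₂, h₂, r₃, h₃, rfl⟩ := hr
  rw [eval, mem_support_step] at h₃
  subst h₃
  rw [eval, mem_support_andThen] at h₂
  obtain ⟨r₀, h₀, r₁, h₁, rfl⟩ := h₂
  obtain ⟨e₀, t₀⟩ := time_rearrange O e x r₀ h₀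
  rw [e₀] at h₁
  simp only [eval, Data.fst_cons, Data.snd_cons] at h₁
  -- The term `3 * G` pays for the final projection and for setting up the iteration.
  have main : ∀ (n : ℕ) (r : Data × ℕ),
      r ∈ (Nat.rec (motive := fun _ => PMF (Data × ℕ))
        (step (.cons x.fst (.cons e x.snd)) (.cons e x.snd))
        (fun _ m => andThen m (eval O (pair fst (simulate h p)))) n).support →
      ∃ s t, r.1 = .cons e s ∧ (s, t) ∈ (Nat.rec (motive := fun _ => PMF (Data × ℕ))
        (step x x.snd) (fun _ m => andThen m (eval O' p)) n).support ∧ x.size ≤ t ∧ s.size ≤ t ∧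
        (t ≤ T → r.2 + 3 * G ≤ 2 * (G * t)) := by
    intro n
    induction n with
    | zero =>
      intro r hr
      rw [show Nat.rec _ _ 0 = step _ _ from rfl, mem_support_step] at hr
      subst hr
      refine ⟨x.snd, 1 + x.size + x.snd.size, rfl, mem_support_step.mpr rfl, by omega, by omega,
        fun ht => ?_⟩
      have hx := Data.size_fst_le x
      have := Data.size_pos x
      have := Data.size_pos x.snd
      have : G * 3 ≤ G * (1 + x.size + x.snd.size) := Nat.mul_le_mul_left _ (by omega)
      simp only [Data.size]
      omega
    | succ n ih =>
      intro r hr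
      rw [mem_support_andThen] at hr
      obtain ⟨r₁, h₁, r₂, h₂, rfl⟩ := hr
      obtain ⟨s, t, hs, m₁, hx, hst, b₁⟩ := ih r₁ h₁
      rw [hs] at h₂
      simp only [eval, mem_support_andThen, mem_support_step, PMF.mem_support_pure_iff] at h₂
      obtain ⟨_, rfl, _, ⟨r₃, h₃, _, rfl, rfl⟩, rfl⟩ := h₂
      obtain ⟨t₃, m₃, b₃⟩ := ihp s r₃ h₃
      have s₃ := size_le_time _ _ _ _ m₃
      simp only at s₃
      refine ⟨r₃.1, t + t₃, rfl, mem_support_andThen.mpr ⟨_, m₁, _, m₃, rfl⟩, by omega,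
        by omega, fun ht => ?_⟩
      have b₁ := b₁ (by omega)
      have b₃ := b₃ (by omega)
      rw [Nat.mul_add]
      simp only [Data.size, Data.fst_cons]
      omega
  obtain ⟨s, t, hs, m, hx, hst, b⟩ := main _ r₁ h₁
  refine ⟨t, ?_, fun ht => ?_⟩
  · rw [hs]
    exact m
  · have b := b ht
    simp only [hs, Data.size, Data.snd_cons]
    omega

/-- Each run of the simulation corresponds to a run of `p` with the simulated oracle; it takes
longer by at most a factor that accounts for copying the environment `e` and for the time `H` of
the handler `h` on queries of size at most `T`. The summand `G` on the left makes the bound strong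
enough for an induction on `p`: in a composition it pays for the copying between the parts. -/
theorem time_simulate {h : Prog} {O O' : Data → Data} {e : Data} {T H G : ℕ}
    (hh : ∀ q, h.output O (.cons e q) = PMF.pure (O' q))
    (hH : ∀ q, q.size ≤ T → ∀ r ∈ (h.eval O (.cons e q)).support, r.2 ≤ H)
    (hG : 30 * (e.size + T + 1) + H ≤ G) (p : Prog) :
    ∀ x, ∀ r ∈ ((simulate h p).eval O (.cons e x)).support,
      ∃ t, (r.1, t) ∈ (p.eval O' x).support ∧ (t ≤ T → r.2 + G ≤ 2 * (G * t)) := by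
  have hmul : ∀ t, 1 ≤ t → G ≤ G * t := fun t ht => Nat.le_mul_of_pos_right _ ht
  -- An elementary operation, applied to the second component of the input.
  have hbasic : ∀ (x : Data) (f : Data → Data) (r : Data × ℕ),
      r ∈ (andThen (step (.cons e x) x) fun z => step z (f z)).support →
      ∃ t, (r.1, t) ∈ (step x (f x)).support ∧ (t ≤ T → r.2 + G ≤ 2 * (G * t)) := by
    intro x f r hr
    simp only [mem_support_andThen, mem_support_step] at hr
    obtain ⟨_, rfl, _, rfl, rfl⟩ := hr
    refine ⟨_, mem_support_step.mpr rfl, fun ht => ?_⟩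
    have := hmul (1 + x.size + (f x).size) (by omega)
    simp only [Data.size]
    omega
  induction p with
  | id => exact fun x r hr => hbasic x (fun z => z) r hr
  | nil => exact fun x r hr => hbasic x (fun _ => Data.nil) r hr
  | fst => exact fun x r hr => hbasic x Data.fst r hr
  | snd => exact fun x r hr => hbasic x Data.snd r hr
  | eq => exact fun x r hr => hbasic x (fun z => Data.ofBool (decide (z.fst = z.snd))) r hr
  | flip =>
    intro x r hr
    simp only [simulate, eval, mem_support_andThen, PMF.mem_support_bind_iff] at hr
    obtain ⟨r₁, h₁, r₂, ⟨b, hb, h₂⟩, rfl⟩ := hr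
    obtain ⟨t, ht, ht'⟩ := hbasic x (fun _ => Data.ofBool b) (r₂.1, r₁.2 + r₂.2)
      (mem_support_andThen.mpr ⟨r₁, h₁, r₂, h₂, rfl⟩)
    exact ⟨t, (PMF.mem_support_bind_iff _ _ _).mpr ⟨b, hb, ht⟩, ht'⟩
  | query =>
    intro x r hr
    change r ∈ (eval O h (.cons e x)).support at hr
    have h1 := mem_support_output hr
    rw [hh, PMF.mem_support_pure_iff] at h1
    refine ⟨1 + x.size + (O' x).size, ?_, fun ht => ?_⟩
    · rw [h1]
      exact mem_support_step.mpr rfl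
    · have h2 := hH x (by omega) r hr
      have := hmul (1 + x.size + (O' x).size) (by omega)
      omega
  | comp p q ihp ihq =>
    intro x r hr
    simp only [simulate, eval, mem_support_andThen, mem_support_step, PMF.mem_support_pure_iff]
      at hr
    obtain ⟨_, ⟨_, rfl, _, ⟨r₁, h₁, _, rfl, rfl⟩, rfl⟩, r₂, h₂, rfl⟩ := hr
    obtain ⟨t₁, m₁, b₁⟩ := ihq x r₁ h₁
    obtain ⟨t₂, m₂, b₂⟩ := ihp _ r₂ h₂
    refine ⟨t₁ + t₂, mem_support_andThen.mpr ⟨_, m₁, _, m₂, rfl⟩, fun ht => ?_⟩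
    have s₁ := size_le_time _ _ _ _ m₁
    simp only at s₁
    have b₁ := b₁ (by omega)
    have b₂ := b₂ (by omega)
    rw [Nat.mul_add]
    simp only [Data.size, Data.fst_cons]
    omega
  | pair p q ihp ihq =>
    intro x r hr
    simp only [simulate, eval, mem_support_andThen, PMF.mem_support_pure_iff] at hr
    obtain ⟨r₁, h₁, _, ⟨r₂, h₂, _, rfl, rfl⟩, rfl⟩ := hr
    obtain ⟨t₁, m₁, b₁⟩ := ihp x r₁ h₁
    obtain ⟨t₂, m₂, b₂⟩ := ihq x r₂ h₂
    refine ⟨t₁ + (t₂ + 1), ?_, fun ht => ?_⟩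
    · simp only [eval, mem_support_andThen, PMF.mem_support_pure_iff]
      exact ⟨_, m₁, _, ⟨_, m₂, _, rfl, rfl⟩, rfl⟩
    · have b₁ := b₁ (by omega)
      have b₂ := b₂ (by omega)
      rw [Nat.mul_add G t₁, Nat.mul_add G t₂]
      simp only
      omega
  | cond p q r ihp ihq ihr =>
    intro x s hs
    simp only [simulate, eval, mem_support_andThen] at hs
    obtain ⟨r₁, h₁, r₂, h₂, rfl⟩ := hs
    obtain ⟨t₁, m₁, b₁⟩ := ihp x r₁ h₁
    have : ∃ t, (r₂.1, t) ∈ (if r₁.1 = Data.nil then eval O' r x else eval O' q x).support ∧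
        (t ≤ T → r₂.2 + G ≤ 2 * (G * t)) := by
      split_ifs at h₂ ⊢
      · exact ihr x r₂ h₂
      · exact ihq x r₂ h₂
    obtain ⟨t₂, m₂, b₂⟩ := this
    refine ⟨t₁ + t₂, ?_, fun ht => ?_⟩
    · rw [eval, mem_support_andThen]
      exact ⟨(r₁.1, t₁), m₁, (r₂.1, t₂), m₂, rfl⟩
    have b₁ := b₁ (by omega)
    have b₂ := b₂ (by omega)
    rw [Nat.mul_add]
    simp only
    omega
  | iter p ihp => exact time_simulate_iter hG ihp

end Prog

/-! ### Polynomial-time programs as parts of other programs -/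

/-- A program that runs in polynomial time may be run without its oracle as a part of any other
program. -/
theorem PolyRand.of_polyTime {p : Prog} (hp : p.PolyTime) :
    PolyRand (α := Data) (β := Data) fun _ x => p.output noOracle x := by
  have hh : ∀ (O : Data → Data) q, Prog.nil.output O (.cons .nil q) = PMF.pure (noOracle q) :=
    fun O q => Prog.output_nil O _
  refine ⟨.comp (.simulate .nil p) (.pair .nil .id), fun O x => ?_, fun L => ?_⟩
  · rw [Prog.output_comp, Prog.output_pair, Prog.output_nil, PMF.pure_bind, Prog.output_id,
      PMF.pure_map, PMF.pure_bind, Prog.output_simulate (hh O)]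
    exact (PMF.map_id _).symm
  · obtain ⟨T, hT⟩ := hp 1
    refine ⟨(3 * Polynomial.X + 4) + 2 * ((31 * T + 70) * T), fun O n x hO hn r hr => ?_⟩
    rw [Prog.eval, mem_support_andThen] at hr
    obtain ⟨r₁, h₁, r₂, h₂, rfl⟩ := hr
    simp only [Prog.eval, mem_support_andThen, mem_support_step, PMF.mem_support_pure_iff] at h₁
    obtain ⟨_, rfl, _, ⟨_, rfl, _, rfl, rfl⟩, rfl⟩ := h₁
    have hxn : x.size ≤ n := hn
    obtain ⟨t, ht, hb⟩ := Prog.time_simulate (T := T.eval n) (H := T.eval n + 5)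
      (G := 31 * T.eval n + 70) (hh O)
      (fun q hq r hr => by
        rw [Prog.eval, mem_support_step] at hr
        subst hr
        simp only [Data.size]
        omega)
      (by simp only [Data.size]; omega) p x r₂ h₂
    have ht' := hT noOracle x (fun q => oracleBdd_noOracle x.size q) _ ht
    change t ≤ _ at ht'
    have hTn := eval_mono T hxn
    have hb := hb (ht'.trans hTn)
    have hm : (31 * T.eval n + 70) * t ≤ (31 * T.eval n + 70) * T.eval n :=
      Nat.mul_le_mul_left _ (ht'.trans hTn)
    have hx : (Code.enc x : Data) = x := rfl
    simp only [Polynomial.eval_add, Polynomial.eval_mul, Polynomial.eval_X,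
      Polynomial.eval_ofNat, Data.size, hx]
    omega

/-- A polynomial-time program may be run with an oracle that is simulated in polynomial time,
provided that its input is not much shorter than that of the whole program: only then is a reply of
polynomial size in the input of the latter also of polynomial size in the input of the former. -/
theorem exists_polyTime_simulate {η : Type} [Code η] {F : (Data → Data) → Data → PMF (η × Data)}
    {g : (Data → Data) → η × Data → Data} {p : Prog} (hF : PolyRand F)
    (hg : PolyRand fun O s => PMF.pure (g O s)) (hp : p.PolyTime)
    (hs : ∀ O x, ∀ s ∈ (F O x).support, x.size ≤ s.2.size) :
    ∃ B : Prog, B.PolyTime ∧ ∀ O x, B.output O x =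
      (F O x).bind fun s => p.output (fun q => g O (s.1, q)) s.2 := by
  obtain ⟨f, hf, hfT⟩ := hF
  obtain ⟨h, hh, hhT⟩ := hg
  have hh' : ∀ (O : Data → Data) (e : η) (q : Data),
      h.output O (.cons (Code.enc e) q) = PMF.pure (g O (e, q)) := fun O e q => by
    have := hh O (e, q)
    rw [PMF.pure_map] at this
    exact this
  have henc : ∀ (e : η) (y : Data), (Code.enc (e, y) : Data) = .cons (Code.enc e) y :=
    fun _ _ => rfl
  refine ⟨.comp (.simulate h p) f, fun L => ?_, fun O x => ?_⟩
  · obtain ⟨S, hS⟩ := hfT L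
    obtain ⟨R, hR⟩ := hhT L
    obtain ⟨T, hT⟩ := hp (R.comp (1 + Polynomial.X + S))
    refine ⟨S + 2 * ((30 * (S + T.comp S + 1) + R.comp (1 + Polynomial.X + S + T.comp S)) *
      T.comp S), fun O x hO r hr => ?_⟩
    rw [Prog.eval, mem_support_andThen] at hr
    obtain ⟨r₁, h₁, r₂, h₂, rfl⟩ := hr
    set n := x.size with hn
    have hO' : OracleBdd L n O := hO
    have t₁ := hS O n x hO' le_rfl r₁ h₁
    have s₁ := (Prog.size_le_time O _ _ _ h₁).2
    obtain ⟨⟨e, y⟩, hey, he⟩ := exists_of_mem_eval hf h₁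
    have hxy : n ≤ y.size := hs O x _ hey
    rw [he, henc] at h₂ s₁
    simp only [Data.size] at s₁
    have hTS : T.eval y.size ≤ T.eval (S.eval n) := eval_mono _ (by omega)
    obtain ⟨t, ht, hb⟩ := Prog.time_simulate (O' := fun q => g O (e, q)) (T := T.eval (S.eval n))
      (H := R.eval (1 + n + S.eval n + T.eval (S.eval n)))
      (G := 30 * (S.eval n + T.eval (S.eval n) + 1) +
        R.eval (1 + n + S.eval n + T.eval (S.eval n))) (hh' O e)
      (fun q hq r hr => hR O _ (e, q) (hO'.mono (by omega))
        (by rw [henc]; simp only [Data.size]; omega) r hr)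
      (by omega) p y r₂ h₂
    have ht' := hT (fun q => g O (e, q)) y (fun q => by
      have hq : g O (e, q) ∈ (h.output O (.cons (Code.enc e) q)).support := by simp [hh']
      rw [Prog.output, PMF.mem_support_map_iff] at hq
      obtain ⟨r, hr, hr'⟩ := hq
      have h3 := hR O (1 + n + S.eval n + q.size) (e, q) (hO'.mono (by omega))
        (by rw [henc]; simp only [Data.size]; omega) r hr
      have h4 := (Prog.size_le_time O _ _ _ hr).2
      have h5 : S.eval n ≤ S.eval (y.size + q.size) := eval_mono _ (by omega)
      have h6 : R.eval (1 + n + S.eval n + q.size) ≤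
          R.eval (1 + (y.size + q.size) + S.eval (y.size + q.size)) := eval_mono _ (by omega)
      simp only [Polynomial.eval_add, Polynomial.eval_comp, Polynomial.eval_X,
        Polynomial.eval_one]
      rw [← hr']
      omega) _ ht
    change t ≤ _ at ht'
    have hb := hb (ht'.trans hTS)
    have hm := Nat.mul_le_mul_left (30 * (S.eval n + T.eval (S.eval n) + 1) +
        R.eval (1 + n + S.eval n + T.eval (S.eval n))) (ht'.trans hTS)
    simp only [Polynomial.eval_add, Polynomial.eval_mul, Polynomial.eval_comp, Polynomial.eval_X,
      Polynomial.eval_ofNat, Polynomial.eval_one]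
    omega
  · have := hf O x
    rw [Prog.output_comp, show f.output O x = _ from this, PMF.bind_map]
    congr 1
    funext s
    exact Prog.output_simulate (hh' O s.1) p s.2

/-! ### Sampling -/

section

variable {α β γ δ σ : Type} [Code α] [Code β] [Code γ] [Code δ] [Code σ]

theorem enc_list_length (l : List β) : (Code.enc l).toList.length = l.length := by
  show (Data.ofList (l.map Code.enc)).toList.length = l.length
  simp [Data.toList_ofList]

theorem iid_bind_comm {τ : Type} (p : PMF τ) (n : ℕ) :
    ((iid p n).bind fun l => p.map fun a => a :: l) = iid p (n + 1) := by
  rw [iid]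
  exact PMF.bind_comm _ _ _

/-- Independent samples of a distribution that is determined by the input. -/
theorem PolyRand.iid {f : (Data → Data) → α → PMF β} {l : α → List γ} (hf : PolyRand f)
    (hl : Poly l) : PolyRand fun O a => iid (f O a) (l a).length := by
  have hk : PolyRand fun O (s : α × List β) => (f O s.1).map fun b => (s.1, b :: s.2) := by
    refine (((hf.comp_det Poly.fst').keep Poly.id').map (g := fun t : (α × List β) × β =>
      (t.1.1, t.2 :: t.1.2)) (by fun_prop)).of_eq fun O s => ?_
    rw [PMF.map_comp]
    rfl
  have hdist : ∀ (O : Data → Data) (a : α) m,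
      iterDist (fun s : α × List β => (f O s.1).map fun b => (s.1, b :: s.2)) (a, []) m =
        (Eunomia.iid (f O a) m).map fun t => (a, t) := by
    intro O a m
    induction m with
    | zero => simp [iterDist, Eunomia.iid, PMF.pure_map]
    | succ m ih =>
      rw [iterDist, ih, ← iid_bind_comm, PMF.bind_map, PMF.map_bind]
      congr 1
      funext t
      simp only [Function.comp, PMF.map_comp]
      rfl
  have := PolyRand.iterate (l := fun a => Code.enc (l a)) (i := fun a : α => (a, ([] : List β)))
    (by fun_prop) (by fun_prop) hk fun L => ?_
  · refine (this.map (g := fun s : α × List β => s.2) (by fun_prop)).of_eq fun O a => ?_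
    rw [hdist, enc_list_length, PMF.map_comp]
    exact PMF.map_id _
  · obtain ⟨T, hT⟩ := hf.size_le L
    obtain ⟨U, hU⟩ := hl.size_le
    refine ⟨1 + Polynomial.X + (1 + U * (T + 1)), fun O n a hO hn m hm s hs => ?_⟩
    rw [hdist, PMF.mem_support_map_iff] at hs
    obtain ⟨t, ht, rfl⟩ := hs
    have key : ∀ m, ∀ t ∈ (Eunomia.iid (f O a) m).support,
        t.length = m ∧ ∀ b ∈ t, (Code.enc b).size ≤ T.eval n := by
      intro m
      induction m with
      | zero => intro t ht; simp [Eunomia.iid] at ht; simp [ht]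
      | succ m ih =>
        intro t ht
        simp only [Eunomia.iid, PMF.mem_support_bind_iff, PMF.mem_support_map_iff] at ht
        obtain ⟨b, hb, t, ht, rfl⟩ := ht
        refine ⟨by simp [(ih t ht).1], fun c hc => ?_⟩
        rcases List.mem_cons.mp hc with rfl | hc
        · exact hT O n a hO hn _ hb
        · exact (ih t ht).2 c hc
    obtain ⟨h1, h2⟩ := key m t ht
    have h3 := size_le_length_mul h2
    rw [enc_list_length] at hm
    have h4 : t.length * (T.eval n + 1) ≤ U.eval n * (T.eval n + 1) := by
      refine Nat.mul_le_mul_right _ ?_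
      have := length_le_size (l a)
      have := hU a
      have := eval_mono U hn
      omega
    simp only [size_enc_prod, Polynomial.eval_add, Polynomial.eval_mul, Polynomial.eval_X,
      Polynomial.eval_one]
    omega

/-- A uniformly random number below `2 ^ k`. -/
noncomputable def dyadic : ℕ → PMF ℕ
  | 0 => PMF.pure 0
  | k + 1 => (dyadic k).bind fun j =>
      (PMF.uniformOfFintype Bool).map fun b => if b = true then j + 2 ^ k else j

theorem lt_of_mem_dyadic {k j : ℕ} (h : j ∈ (dyadic k).support) : j < 2 ^ k := by
  induction k generalizing j with
  | zero => simp [dyadic] at h; simp [h]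
  | succ k ih =>
    simp only [dyadic, PMF.mem_support_bind_iff, PMF.mem_support_map_iff] at h
    obtain ⟨i, hi, b, -, rfl⟩ := h
    have := ih hi
    rw [pow_succ]
    split_ifs <;> omega

/-- The averages over the first `2 ^ k` natural numbers. -/
theorem dyadic_bind_apply {τ : Type} (k : ℕ) (f : ℕ → PMF τ) (t : τ) :
    2 ^ k * (dyadic k).bind f t = ∑ j ∈ Finset.range (2 ^ k), f j t := by
  induction k generalizing f with
  | zero => simp [dyadic]
  | succ k ih =>
    have h2 : (2 : ENNReal) * 2⁻¹ = 1 := ENNReal.mul_inv_cancel (by norm_num) (by norm_num)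
    rw [dyadic, PMF.bind_bind, pow_succ, mul_assoc, mul_left_comm, ih, Finset.mul_sum,
      pow_succ, Nat.mul_two, Finset.sum_range_add, ← Finset.sum_add_distrib]
    refine Finset.sum_congr rfl fun j _ => ?_
    rw [PMF.bind_map, PMF.bind_apply, tsum_fintype]
    simp only [PMF.uniformOfFintype_apply, Fintype.sum_bool, Fintype.card_bool, Nat.cast_ofNat,
      Function.comp_apply, if_true, Bool.false_eq_true, if_false, mul_add, ← mul_assoc, h2, one_mul]
    rw [add_comm, add_comm j]

/-- The number of doublings that lead from one to at least `N`, where at most `r` are performed. -/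
def doublings (N : ℕ) : ℕ → ℕ
  | 0 => 0
  | r + 1 => if 2 ^ doublings N r < N then doublings N r + 1 else doublings N r

theorem two_pow_doublings_le (N r : ℕ) : 2 ^ doublings N r ≤ 2 * N + 1 := by
  induction r with
  | zero => simp [doublings]
  | succ r ih =>
    rw [doublings]
    split_ifs with h
    · rw [pow_succ]; omega
    · exact ih

theorem le_two_pow_doublings (N : ℕ) : N ≤ 2 ^ doublings N N := by
  have : ∀ r, N ≤ 2 ^ doublings N r ∨ doublings N r = r := by
    intro r
    induction r with
    | zero => exact Or.inr rfl
    | succ r ih =>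
      rw [doublings]
      split_ifs with h
      · rcases ih with ih | ih
        · omega
        · exact Or.inr (by rw [ih])
      · exact Or.inl (by omega)
  rcases this N with h | h
  · exact h
  · rw [h]; exact Nat.lt_two_pow_self.le

theorem PolyRand.dyadic {f : α → ℕ} (hf : Poly f) :
    PolyRand fun _ a => dyadic (doublings (f a) (f a)) := by
  -- The state consists of `N`, the current power of two and the number chosen so far.
  let k : ℕ × ℕ × ℕ → PMF (ℕ × ℕ × ℕ) := fun s =>
    if s.2.1 < s.1 then (PMF.uniformOfFintype Bool).map fun b =>
      (s.1, 2 * s.2.1, if b = true then s.2.2 + s.2.1 else s.2.2) else PMF.pure s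
  have hk : PolyRand fun _ : Data → Data => k := by
    have h1 : PolyRand fun (_ : Data → Data) (s : ℕ × ℕ × ℕ) =>
        (PMF.uniformOfFintype Bool).map fun b =>
          (s.1, 2 * s.2.1, if b = true then s.2.2 + s.2.1 else s.2.2) := by
      refine ((PolyRand.flip.keep Poly.id').map (g := fun t : (ℕ × ℕ × ℕ) × Data =>
        (t.1.1, 2 * t.1.2.1, if t.2 ≠ Data.nil then t.1.2.2 + t.1.2.1 else t.1.2.2)) ?_).of_eq
        fun O s => ?_
      · have : Poly fun t : (ℕ × ℕ × ℕ) × Data => decide (t.2 ≠ Data.nil) :=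
          Poly.decide_not (by fun_prop)
        fun_prop
      · rw [PMF.map_comp, PMF.map_comp]
        congr 1
        funext b
        cases b <;> simp [Data.ofBool]
    have h2 : PolyRand fun (_ : Data → Data) (s : ℕ × ℕ × ℕ) => PMF.pure s := Poly.id'
    refine (PolyRand.ite_nil (t := fun s : ℕ × ℕ × ℕ => decide (s.2.1 < s.1)) (by fun_prop)
      h1 h2).of_eq fun O s => ?_
    by_cases h : s.2.1 < s.1 <;> simp [k, h, Code.enc, Data.ofBool]
  have hdist : ∀ N m, iterDist k (N, 1, 0) m =
      (Eunomia.dyadic (doublings N m)).map fun j => (N, 2 ^ doublings N m, j) := by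
    intro N m
    induction m with
    | zero => simp [iterDist, doublings, Eunomia.dyadic, PMF.pure_map]
    | succ m ih =>
      rw [iterDist, ih, PMF.bind_map]
      by_cases h : 2 ^ doublings N m < N
      · have hd : doublings N (m + 1) = doublings N m + 1 := by rw [doublings, if_pos h]
        rw [hd, Eunomia.dyadic, PMF.map_bind]
        congr 1
        funext j
        simp only [Function.comp, k, h, if_true, PMF.map_comp, pow_succ, mul_comm 2]
        rfl
      · have hd : doublings N (m + 1) = doublings N m := by rw [doublings, if_neg h]
        rw [hd, ← PMF.bind_pure_comp]
        congr 1
        funext j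
        simp [k, h]
  have := PolyRand.iterate (l := fun a => Code.enc (List.range (f a)))
    (i := fun a : α => (f a, (1 : ℕ), (0 : ℕ))) (by fun_prop) (by fun_prop) hk fun L => ?_
  · refine (this.map (g := fun s : ℕ × ℕ × ℕ => s.2.2) (by fun_prop)).of_eq fun O a => ?_
    rw [hdist, enc_list_length, List.length_range, PMF.map_comp]
    exact PMF.map_id _
  · obtain ⟨U, hU⟩ := hf.size_le
    refine ⟨20 * (U + 1), fun O n a hO hn m hm s hs => ?_⟩
    rw [hdist, PMF.mem_support_map_iff] at hs
    obtain ⟨j, hj, rfl⟩ := hs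
    have h1 := lt_of_mem_dyadic hj
    have h2 := two_pow_doublings_le (f a) m
    have h3 := (hU a).trans (eval_mono U hn)
    rw [size_enc_nat] at h3
    simp only [size_enc_prod, size_enc_nat, Polynomial.eval_add, Polynomial.eval_mul,
      Polynomial.eval_one, Polynomial.eval_ofNat]
    omega

/-- A list of oracle queries. -/
theorem PolyRand.queryList {l : α → List Str} (hl : Poly l) :
    PolyRand fun O a => PMF.pure ((l a).map fun m => (m, (O (Data.ofStr m)).toStr)) := by
  let upd : (List Str × List (Str × Str)) × Data → List Str × List (Str × Str) := fun p =>
    match p.1.1 with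
    | [] => p.1
    | m :: t => (t, p.1.2 ++ [(m, p.2.toStr)])
  let k : (Data → Data) → List Str × List (Str × Str) → List Str × List (Str × Str) :=
    fun O s => upd (s, O (Data.ofStr (s.1.headD [])))
  have hk : PolyRand fun O s => PMF.pure (k O s) := by
    have hu : Poly upd := (Poly.list_match
      (l := fun p : (List Str × List (Str × Str)) × Data => p.1.1) (f := fun p => p.1)
      (g := fun p m t => (t, p.1.2 ++ [(m, p.2.toStr)])) (by fun_prop) (by fun_prop)
      (by fun_prop)).recode fun p => by
        rcases h : p.1.1 with _ | ⟨m, t⟩ <;> simp only [upd, h]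
    have hq : Poly fun s : List Str × List (Str × Str) => Data.ofStr (s.1.headD []) :=
      (show Poly fun s : List Str × List (Str × Str) => s.1.headD [] by fun_prop).recode
        fun _ => rfl
    refine (((PolyRand.query.comp_det hq).keep Poly.id').map hu).of_eq fun O s => ?_
    rw [PMF.pure_map, PMF.pure_map]
  have hkm : ∀ O (m : List Str) i, (k O)^[i] (m, []) =
      (m.drop i, (m.take i).map fun m => (m, (O (Data.ofStr m)).toStr)) := by
    intro O m i
    induction i with
    | zero => simp
    | succ i ih =>
      rw [Function.iterate_succ_apply', ih]
      cases h : m.drop i with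
      | nil =>
        have : m.length ≤ i := by simpa using h
        simp [k, upd, List.drop_eq_nil_of_le, List.take_of_length_le, this, Nat.le_succ_of_le this]
      | cons b t =>
        have h1 : m.drop (i + 1) = t := by
          rw [← List.tail_drop, h]; rfl
        have h2 : m.take (i + 1) = m.take i ++ [b] := by
          rw [List.take_add_one, ← List.head?_drop, h]; rfl
        simp only [k, upd, h1, h2, List.map_append, List.map_cons, List.map_nil, List.headD_cons]
  have := PolyRand.iterate (l := fun a => Code.enc (l a))
    (i := fun a => (l a, ([] : List (Str × Str)))) (by fun_prop) (by fun_prop) hk fun L => ?_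
  · refine (this.map (g := fun s : List Str × List (Str × Str) => s.2) (by fun_prop)).of_eq
      fun O a => ?_
    rw [iterDist_pure, hkm, enc_list_length, PMF.pure_map, List.take_length]
  · obtain ⟨U, hU⟩ := hl.size_le
    obtain ⟨V, hV⟩ := Poly.toStr.size_le
    refine ⟨1 + U + (1 + U * (2 + U + V.comp (L.comp (Polynomial.X + U)))),
      fun O n a hO hn i hi s hs => ?_⟩
    rw [iterDist_pure, PMF.mem_support_pure_iff, hkm] at hs
    subst hs
    have hUn := (hU a).trans (eval_mono U hn)
    have h1 := size_enc_le_of_suffix (List.drop_suffix i (l a))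
    have h2 := size_le_length_mul (l := ((l a).take i).map fun m => (m, (O (Data.ofStr m)).toStr))
      (B := 1 + U.eval n + V.eval (L.eval (n + U.eval n))) fun p hp => by
        rw [List.mem_map] at hp
        obtain ⟨m, hm, rfl⟩ := hp
        have h3 := size_le_of_mem (List.mem_of_mem_take hm)
        have h4 := hO (Data.ofStr m)
        have h5 : L.eval (n + (Data.ofStr m).size) ≤ L.eval (n + U.eval n) :=
          eval_mono _ (by rw [← enc_str]; omega)
        have h6 := (hV (O (Data.ofStr m))).trans (eval_mono V (h4.trans h5))
        rw [size_enc_prod]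
        omega
    rw [List.length_map] at h2
    have h3 : ((l a).take i).length ≤ U.eval n :=
      (List.length_take_le' _ _).trans ((length_le_size _).trans hUn)
    have h4 := Nat.mul_le_mul_right (1 + U.eval n + V.eval (L.eval (n + U.eval n)) + 1) h3
    have h5 : 1 + U.eval n + V.eval (L.eval (n + U.eval n)) + 1 =
      2 + U.eval n + V.eval (L.eval (n + U.eval n)) := by omega
    rw [h5] at h2 h4
    simp only [size_enc_prod, Polynomial.eval_add, Polynomial.eval_mul, Polynomial.eval_comp,
      Polynomial.eval_X, Polynomial.eval_one, Polynomial.eval_ofNat]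
    omega

end

/-! ### The hybrid logs -/

/-- The log that has the values of `L₁` in the columns where `P` holds and those of `L₀`
elsewhere. -/
def mixLog (P : Col → Bool) (S : Schema) (L₀ L₁ : Log) : Log :=
  List.zipWith (fun T rows =>
    List.zipWith (fun r₀ r₁ => List.zipWith (fun a v => if P (T.1, a.1) = true then v.2 else v.1)
      T.2 (r₀.zip r₁)) rows.1 rows.2) S (L₀.zip L₁)

/-- The log whose classes of index less than `i` carry the values of the second log of the
challenge, the others those of the first. -/
def hybridLog (ch : Challenge) (i : ℕ) : Log :=
  mixLog (fun a => decide (classIdx ch.schema ch.eqs a < i)) ch.schema ch.log₀ ch.log₁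

section

variable {α β γ δ σ : Type} [Code α] [Code β] [Code γ] [Code δ] [Code σ]

theorem poly_hybridLog {c : α → Challenge} {i : α → ℕ} (hc : Poly c) (hi : Poly i) :
    Poly fun a => hybridLog (c a) (i a) := by
  unfold hybridLog mixLog
  fun_prop

/-! ### The distinguisher -/

theorem poly_enc (E : DetEnc) : Poly fun p : ℕ × Str × Str => E.enc p.1 p.2.1 p.2.2 := by
  have h := PolyRand.of_polyTime E.encProg_polyTime
  have h1 : Poly fun p : ℕ × Str × Str => Data.ofStr (E.enc p.1 p.2.1 p.2.2) :=
    (h.comp_det (f := fun p : ℕ × Str × Str => Code.enc p) Poly.enc).of_eq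
      fun O p => E.encProg_output noOracle p.1 p.2.1 p.2.2
  exact h1.recode fun _ => rfl

/-- What the distinguisher samples: the output of the first stage of the adversary, a key for each
class, and the index of the class that is encrypted by the oracle. The security parameter in unary
is kept as well. -/
abbrev Sample := ((Data × Data) × List Str) × ℕ

/-- The choice of the adversary. -/
def Sample.challenge (s : Sample) : Challenge := readChallenge s.1.1.2.fst

theorem poly_sample_challenge : Poly Sample.challenge := by
  unfold Sample.challenge
  fun_prop

/-- The encryption of a value in a column: the class whose index was sampled is encrypted by `f`, a
class of any other index by `E` with the key sampled for it. -/
def Sample.cellEnc (E : DetEnc) (s : Sample) (f : Str → Str) (a : Col) (m : Str) : Str :=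
  if classIdx s.challenge.schema s.challenge.eqs a = s.2 then f m
  else E.enc s.1.1.1.toList.length
    (s.1.2.getD (classIdx s.challenge.schema s.challenge.eqs a) []) m

/-- The encryption oracle of the game, if `F a v` stands for the encryption of the value `v` in the
column `a`. -/
def encOracleWith (F : Col → Str → Str) (ch : Challenge) : Data → Data := fun q =>
  if readCol q.fst ∈ columns ch.schema ∧
      q.snd.toStr ∉ ch.log₀.flatten.flatten ∧ q.snd.toStr ∉ ch.log₁.flatten.flatten then
    Data.ofStr (F (readCol q.fst) q.snd.toStr)
  else Data.nil

theorem encOracle_eq (e : Str → Str → Str) (K : KeySet) (ch : Challenge) :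
    encOracle e K ch = encOracleWith (fun a => e (K a)) ch := rfl

/-- The input of the second stage of the adversary. -/
def Sample.guessInput (F : Col → Str → Str) (s : Sample) (i : ℕ) : Data :=
  .cons s.1.1.1 (.cons s.1.1.2.snd (viewWith F s.challenge (hybridLog s.challenge i)))

/-- All values that have to be encrypted to compute what the adversary receives. -/
def Challenge.values (ch : Challenge) : List Str :=
  ch.log₀.flatten.flatten ++ (ch.log₁.flatten.flatten ++ (ch.consts ++ ch.disps))

/-- Looking up a value in a table. -/
def lookupStr (t : List (Str × Str)) (m : Str) : Str :=
  ((t.filter fun p => decide (p.1 = m)).map fun p => p.2).headD []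

theorem lookupStr_map {f : Str → Str} {l : List Str} {m : Str} (h : m ∈ l) :
    lookupStr (l.map fun m => (m, f m)) m = f m := by
  induction l with
  | nil => simp at h
  | cons b l ih =>
    by_cases hb : b = m
    · subst hb
      simp [lookupStr]
    · have h' : m ∈ l := by
        rcases List.mem_cons.mp h with h | h
        · exact absurd h.symm hb
        · exact h
      have := ih h'
      simpa [lookupStr, hb] using this

theorem exists_of_mem_zipWith {β γ δ : Type} {f : β → γ → δ} {l : List β} {m : List γ} {d : δ}
    (h : d ∈ List.zipWith f l m) : ∃ b ∈ l, ∃ c ∈ m, d = f b c := by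
  induction l generalizing m with
  | nil => simp at h
  | cons b l ih =>
    cases m with
    | nil => simp at h
    | cons c m =>
      rw [List.zipWith_cons_cons, List.mem_cons] at h
      rcases h with h | h
      · exact ⟨b, by simp, c, by simp, h⟩
      · obtain ⟨b', hb, c', hc, h⟩ := ih h
        exact ⟨b', by simp [hb], c', by simp [hc], h⟩

theorem mem_flatten_flatten {L : Log} {v : Str} :
    v ∈ L.flatten.flatten ↔ ∃ t ∈ L, ∃ r ∈ t, v ∈ r := by
  simp only [List.mem_flatten]
  constructor
  · rintro ⟨r, ⟨t, ht, hr⟩, hv⟩; exact ⟨t, ht, r, hr, hv⟩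
  · rintro ⟨t, ht, r, hr, hv⟩; exact ⟨r, ⟨t, ht, hr⟩, hv⟩

theorem mem_flatten_flatten_of_cells {S : Schema} {L : Log} {e : Col × Str} (h : e ∈ cells S L) :
    e.2 ∈ L.flatten.flatten := by
  obtain ⟨l, hl, he⟩ := List.mem_flatten.mp h
  obtain ⟨T, -, t, ht, rfl⟩ := exists_of_mem_zipWith hl
  obtain ⟨r, hr, he⟩ := List.mem_flatMap.mp he
  obtain ⟨a, -, v, hv, rfl⟩ := exists_of_mem_zipWith he
  exact mem_flatten_flatten.mpr ⟨t, ht, r, hr, hv⟩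

theorem mem_values_of_mem_hybridLog {ch : Challenge} {i : ℕ} {v : Str}
    (h : v ∈ (hybridLog ch i).flatten.flatten) : v ∈ ch.values := by
  obtain ⟨t, ht, r, hr, hv⟩ := mem_flatten_flatten.mp h
  obtain ⟨T, -, rr, hrr, rfl⟩ := exists_of_mem_zipWith ht
  obtain ⟨r₀, h₀, r₁, h₁, rfl⟩ := exists_of_mem_zipWith hr
  obtain ⟨a, -, w, hw, rfl⟩ := exists_of_mem_zipWith hv
  obtain ⟨k₀, k₁⟩ := List.of_mem_zip (a := rr.1) (b := rr.2) hrr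
  obtain ⟨w₀, w₁⟩ := List.of_mem_zip (a := w.1) (b := w.2) hw
  simp only [Challenge.values, List.mem_append]
  split_ifs
  · exact Or.inr (Or.inl (mem_flatten_flatten.mpr ⟨_, k₁, _, h₁, w₁⟩))
  · exact Or.inl (mem_flatten_flatten.mpr ⟨_, k₀, _, h₀, w₀⟩)

theorem mem_columns_of_cells {S : Schema} {L : Log} {e : Col × Str} (h : e ∈ cells S L) :
    e.1 ∈ columns S := by
  obtain ⟨l, hl, he⟩ := List.mem_flatten.mp h
  obtain ⟨T, hT, t, -, rfl⟩ := exists_of_mem_zipWith hl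
  obtain ⟨r, -, he⟩ := List.mem_flatMap.mp he
  obtain ⟨a, ha, v, -, rfl⟩ := exists_of_mem_zipWith he
  exact List.mem_flatMap.mpr ⟨T, hT, List.mem_map.mpr ⟨a, ha, rfl⟩⟩

theorem mem_columns_of_timeColumns {S : Schema} {a : Col} (h : a ∈ timeColumns S) :
    a ∈ columns S := by
  obtain ⟨T, hT, ha⟩ := List.mem_flatMap.mp h
  obtain ⟨c, hc, rfl⟩ := List.mem_map.mp ha
  exact List.mem_flatMap.mpr ⟨T, hT, List.mem_map.mpr ⟨c, (List.mem_filter.mp hc).1, rfl⟩⟩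

theorem timeCol_mem {S : Schema} {a : Col} (h : a ∈ timeColumns S) :
    timeCol S ∈ timeColumns S := by
  unfold timeCol
  cases hT : timeColumns S with
  | nil => rw [hT] at h; simp at h
  | cons b T => simp

theorem mapLog_congr {F G : Col → Str → Str} {S : Schema} {L : Log}
    (h : ∀ e ∈ cells S L, F e.1 e.2 = G e.1 e.2) : mapLog F S L = mapLog G S L := by
  induction S generalizing L with
  | nil => rfl
  | cons T S ih =>
    cases L with
    | nil => rfl
    | cons t L =>
      have hc : cells (T :: S) (t :: L) = (t.flatMap fun r =>
          List.zipWith (fun a v => ((T.1, a.1), v)) T.2 r) ++ cells S L := rfl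
      rw [hc] at h
      have h1 : mapLog F S L = mapLog G S L := ih fun e he => h e (by simp [he])
      have h2 : ∀ r ∈ t, List.zipWith (fun a v => F (T.1, a.1) v) T.2 r =
          List.zipWith (fun a v => G (T.1, a.1) v) T.2 r := by
        intro r hr
        have h3 : ∀ e ∈ List.zipWith (fun (a : Str × Bool) v => (((T.1, a.1), v) : Col × Str))
            T.2 r, F e.1 e.2 = G e.1 e.2 := fun e he =>
          h e (List.mem_append_left _ (List.mem_flatMap.mpr ⟨r, hr, he⟩))
        have h4 := List.map_congr_left h3
        simpa only [List.map_zipWith] using h4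
      show List.cons _ (mapLog F S L) = List.cons _ (mapLog G S L)
      rw [h1]
      congr 1
      exact List.map_congr_left h2

/-- What the adversary receives depends only on the encryptions of the values in the log, of the
policy constants and of the displacements. -/
theorem viewWith_congr {F G : Col → Str → Str} {ch : Challenge} {L : Log}
    (h : ∀ a ∈ columns ch.schema, ∀ v,
      v ∈ L.flatten.flatten ∨ v ∈ ch.consts ∨ v ∈ ch.disps → F a v = G a v) :
    viewWith F ch L = viewWith G ch L := by
  have h1 : ∀ P : List (Str × Str), P <+: timePairs ch.schema ch.disps L →
      oped (F (timeCol ch.schema)) P = oped (G (timeCol ch.schema)) P := by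
    intro P hP
    refine List.map_congr_left fun p hp => ?_
    obtain ⟨t, ht, hp⟩ := List.mem_flatMap.mp (hP.subset hp)
    obtain ⟨d, hd, rfl⟩ := List.mem_map.mp hp
    obtain ⟨e, he, rfl⟩ := List.mem_map.mp ht
    obtain ⟨he, he'⟩ := List.mem_filter.mp he
    have hT := mem_columns_of_timeColumns (timeCol_mem (of_decide_eq_true he'))
    have he := mem_flatten_flatten_of_cells he
    simp only [h _ hT _ (Or.inl he), h _ hT _ (Or.inr (Or.inr hd))]
  have h2 : (timePairs ch.schema ch.disps L).inits.map (oped (F (timeCol ch.schema))) =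
      (timePairs ch.schema ch.disps L).inits.map (oped (G (timeCol ch.schema))) :=
    List.map_congr_left fun P hP => h1 P ((List.mem_inits _ _).mp hP)
  have h3 : ((columns ch.schema).flatMap fun a =>
      (ch.consts.filter fun c => decide ((a, c) ∈ cells ch.schema L)).map fun c => (a, c, F a c)) =
      (columns ch.schema).flatMap fun a =>
        (ch.consts.filter fun c => decide ((a, c) ∈ cells ch.schema L)).map
          fun c => (a, c, G a c) := by
    refine List.flatMap_congr fun a ha => List.map_congr_left fun c hc => ?_
    rw [h a ha c (Or.inr (Or.inl (List.mem_filter.mp hc).1))]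
  unfold viewWith
  rw [h1 _ List.prefix_rfl, h2, h3, mapLog_congr fun e he =>
    h e.1 (mem_columns_of_cells he) e.2 (Or.inl (mem_flatten_flatten_of_cells he))]

theorem encOracleWith_congr {F G : Col → Str → Str} {ch : Challenge}
    (h : ∀ a ∈ columns ch.schema, ∀ v, v ∉ ch.log₀.flatten.flatten → v ∉ ch.log₁.flatten.flatten →
      F a v = G a v) : encOracleWith F ch = encOracleWith G ch := by
  funext q
  unfold encOracleWith
  split_ifs with hq
  · rw [h _ hq.1 _ hq.2.1 hq.2.2]
  · rfl

/-- The input of the second stage can be computed from a finite table of values of `f`. -/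
theorem Sample.guessInput_lookupStr (E : DetEnc) (s : Sample) (f : Str → Str) (i : ℕ) :
    s.guessInput (s.cellEnc E (lookupStr (s.challenge.values.map fun m => (m, f m)))) i =
      s.guessInput (s.cellEnc E f) i := by
  unfold Sample.guessInput
  congr 2
  refine viewWith_congr fun a _ v hv => ?_
  have hv' : v ∈ s.challenge.values := by
    rcases hv with hv | hv | hv
    · exact mem_values_of_mem_hybridLog hv
    · simp [Challenge.values, hv]
    · simp [Challenge.values, hv]
  unfold Sample.cellEnc
  rw [lookupStr_map hv']

/-- The oracle that the distinguisher simulates for the adversary; the replies of the oracle of the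
distinguisher are passed on as they are. -/
def Sample.simOracle (E : DetEnc) (s : Sample) (O : Data → Data) (q : Data) : Data :=
  if readCol q.fst ∈ columns s.challenge.schema ∧ q.snd.toStr ∉ s.challenge.log₀.flatten.flatten ∧
      q.snd.toStr ∉ s.challenge.log₁.flatten.flatten then
    if classIdx s.challenge.schema s.challenge.eqs (readCol q.fst) = s.2 then
      O (Data.ofStr q.snd.toStr)
    else Data.ofStr (E.enc s.1.1.1.toList.length
      (s.1.2.getD (classIdx s.challenge.schema s.challenge.eqs (readCol q.fst)) []) q.snd.toStr)
  else Data.nil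

theorem Sample.simOracle_strOracle (E : DetEnc) (s : Sample) (f : Str → Str) :
    s.simOracle E (strOracle f) = encOracleWith (s.cellEnc E f) s.challenge := by
  funext q
  unfold Sample.simOracle encOracleWith Sample.cellEnc
  split_ifs
  · rw [strOracle, Data.toStr_ofStr]
  · rfl
  · rfl

theorem polyRand_simOracle (E : DetEnc) : PolyRand fun O (p : Sample × Data) =>
    PMF.pure (p.1.simOracle E O p.2) := by
  have hE := poly_enc E
  have hc := poly_sample_challenge
  have h1 : PolyRand fun (O : Data → Data) (p : Sample × Data) =>
      PMF.pure (O (Data.ofStr p.2.snd.toStr)) :=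
    PolyRand.query.comp_det ((show Poly fun p : Sample × Data => p.2.snd.toStr by fun_prop).recode
      fun _ => rfl)
  have h2 : Poly fun p : Sample × Data => Data.ofStr (E.enc p.1.1.1.1.toList.length
      (p.1.1.2.getD (classIdx p.1.challenge.schema p.1.challenge.eqs (readCol p.2.fst)) [])
      p.2.snd.toStr) :=
    (hE.comp (f := fun p : Sample × Data => (p.1.1.1.1.toList.length,
      p.1.1.2.getD (classIdx p.1.challenge.schema p.1.challenge.eqs (readCol p.2.fst)) [],
      p.2.snd.toStr)) (by fun_prop)).recode fun _ => rfl
  have h3 : PolyRand fun (O : Data → Data) (p : Sample × Data) =>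
      if classIdx p.1.challenge.schema p.1.challenge.eqs (readCol p.2.fst) = p.1.2 then
        PMF.pure (O (Data.ofStr p.2.snd.toStr)) else
      PMF.pure (Data.ofStr (E.enc p.1.1.1.1.toList.length
      (p.1.1.2.getD (classIdx p.1.challenge.schema p.1.challenge.eqs (readCol p.2.fst)) [])
      p.2.snd.toStr)) :=
    (PolyRand.ite_nil (t := fun p : Sample × Data => decide
      (classIdx p.1.challenge.schema p.1.challenge.eqs (readCol p.2.fst) = p.1.2))
      (by fun_prop) h1 h2).of_eq fun O p => by
        by_cases h : classIdx p.1.challenge.schema p.1.challenge.eqs (readCol p.2.fst) = p.1.2 <;>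
          simp [h, Code.enc, Data.ofBool]
  have h4 : Poly fun p : Sample × Data => decide (readCol p.2.fst ∈ columns p.1.challenge.schema ∧
      p.2.snd.toStr ∉ p.1.challenge.log₀.flatten.flatten ∧
      p.2.snd.toStr ∉ p.1.challenge.log₁.flatten.flatten) := by
    refine Poly.decide_and ?_ (Poly.decide_and (Poly.decide_not ?_) (Poly.decide_not ?_))
    · exact (Poly.decide_mem (f := fun p : Sample × Data => readCol p.2.fst)
        (l := fun p => columns p.1.challenge.schema) (by fun_prop) (by fun_prop)).recode
        fun p => congrArg Code.enc (decide_eq_decide.mpr Iff.rfl)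
    · exact (Poly.decide_mem (f := fun p : Sample × Data => p.2.snd.toStr)
        (l := fun p => p.1.challenge.log₀.flatten.flatten) (by fun_prop) (by fun_prop)).recode
        fun p => congrArg Code.enc (decide_eq_decide.mpr Iff.rfl)
    · exact (Poly.decide_mem (f := fun p : Sample × Data => p.2.snd.toStr)
        (l := fun p => p.1.challenge.log₁.flatten.flatten) (by fun_prop) (by fun_prop)).recode
        fun p => congrArg Code.enc (decide_eq_decide.mpr Iff.rfl)
  refine (PolyRand.ite_nil h4 h3 Poly.nilData).of_eq fun O p => ?_
  unfold Sample.simOracle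
  by_cases h : readCol p.2.fst ∈ columns p.1.challenge.schema ∧
      p.2.snd.toStr ∉ p.1.challenge.log₀.flatten.flatten ∧
      p.2.snd.toStr ∉ p.1.challenge.log₁.flatten.flatten
  · rw [if_neg (by simp [h, Code.enc, Data.ofBool]), if_pos h]
    split_ifs <;> rfl
  · rw [if_pos (by rw [decide_eq_false h]; rfl), if_neg h]

/-- Sampling for the input `x`, a number `κ` in unary; the index of the class is uniform below a
power of two that is at least `N.eval κ`. -/
noncomputable def samples (E : DetEnc) (A : Adversary) (N : Polynomial ℕ) (x : Data) :
    PMF Sample :=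
  (A.choose.output noOracle x).bind fun d =>
    (iid ((E.keyGen.output noOracle x).map Data.toStr)
      (columns (readChallenge d.fst).schema).length).bind fun ks =>
        (dyadic (doublings (N.eval x.toList.length) (N.eval x.toList.length))).map fun j =>
          (((x, d), ks), j)

theorem polyRand_samples (E : DetEnc) {A : Adversary} (hA : A.IsPPT) (N : Polynomial ℕ) :
    PolyRand fun _ x => samples E A N x := by
  have h1 : PolyRand fun (_ : Data → Data) (x : Data) =>
      (A.choose.output noOracle x).map fun d => (x, d) :=
    (PolyRand.of_polyTime hA.1).keep Poly.id'
  have h2 : PolyRand fun (_ : Data → Data) (p : Data × Data) =>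
      (iid ((E.keyGen.output noOracle p.1).map Data.toStr)
        (columns (readChallenge p.2.fst).schema).length).map fun ks => (p, ks) :=
    (PolyRand.iid (((PolyRand.of_polyTime E.keyGen_polyTime).map Poly.toStr).comp_det
      (f := fun p : Data × Data => p.1) (by fun_prop))
      (l := fun p : Data × Data => columns (readChallenge p.2.fst).schema) (by fun_prop)).keep
      Poly.id'
  have h3 : PolyRand fun (_ : Data → Data) (p : (Data × Data) × List Str) =>
      (dyadic (doublings (N.eval p.1.1.toList.length) (N.eval p.1.1.toList.length))).map
        fun j => (p, j) :=
    (PolyRand.dyadic (f := fun p : (Data × Data) × List Str => N.eval p.1.1.toList.length)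
      (Poly.polynomial N (by fun_prop))).keep Poly.id'
  refine (PolyRand.comp h3 (PolyRand.comp h2 h1)).of_eq fun O x => ?_
  simp only [samples, PMF.bind_map, PMF.bind_bind, Function.comp_def]

/-- The distinguisher in the hybrid argument: it plays the game with the adversary `A`, on the
hybrid log of index `b` more than that of the class that is encrypted by its own oracle. -/
theorem exists_distinguisher (E : DetEnc) {A : Adversary} (hA : A.IsPPT) (N : Polynomial ℕ)
    (b : ℕ) : ∃ B : Prog, B.PolyTime ∧ ∀ f x, B.output (strOracle f) x =
      (samples E A N x).bind fun s =>
        A.guess.output (encOracleWith (s.cellEnc E f) s.challenge)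
          (s.guessInput (s.cellEnc E f) (s.2 + b)) := by
  -- The queries that the view requires are asked in advance and stored in a table.
  let y : Sample × List (Str × Str) → Sample × Data := fun p =>
    (p.1, p.1.guessInput (p.1.cellEnc E (lookupStr p.2)) (p.1.2 + b))
  have hy : Poly y := by
    have hE := poly_enc E
    have hc := poly_sample_challenge
    have h1 : Poly fun p : (Sample × List (Str × Str)) × Col × Str =>
        p.1.1.cellEnc E (lookupStr p.1.2) p.2.1 p.2.2 := by
      have h2 : Poly fun p : (Sample × List (Str × Str)) × Col × Str =>
          E.enc p.1.1.1.1.1.toList.length (p.1.1.1.2.getD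
            (classIdx p.1.1.challenge.schema p.1.1.challenge.eqs p.2.1) []) p.2.2 :=
        hE.comp (f := fun p : (Sample × List (Str × Str)) × Col × Str =>
          (p.1.1.1.1.1.toList.length, p.1.1.1.2.getD
            (classIdx p.1.1.challenge.schema p.1.1.challenge.eqs p.2.1) [], p.2.2)) (by fun_prop)
      unfold Sample.cellEnc lookupStr
      fun_prop
    have h2 : Poly fun p : Sample × List (Str × Str) => viewWith (p.1.cellEnc E (lookupStr p.2))
        p.1.challenge (hybridLog p.1.challenge (p.1.2 + b)) :=
      poly_viewWith h1 (by fun_prop) (poly_hybridLog (by fun_prop) (by fun_prop))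
    have h3 : Poly fun p : Sample × List (Str × Str) => (p.1, p.1.1.1.1, p.1.1.1.2.snd,
        viewWith (p.1.cellEnc E (lookupStr p.2)) p.1.challenge
          (hybridLog p.1.challenge (p.1.2 + b))) := by fun_prop
    exact h3.recode fun _ => rfl
  have hq : Poly fun s : Sample => s.challenge.values := by
    have hc := poly_sample_challenge
    unfold Challenge.values
    fun_prop
  have hF := PolyRand.comp ((PolyRand.queryList hq).keep Poly.id' |>.map hy)
    (polyRand_samples E hA N)
  refine Exists.elim (exists_polyTime_simulate (g := fun O p => p.1.simOracle E O p.2) hF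
    (polyRand_simOracle E) hA.2 fun O x s hs => ?_) fun B ⟨hB, hB'⟩ => ?_
  · rw [PMF.mem_support_bind_iff] at hs
    obtain ⟨t, ht, hs⟩ := hs
    simp only [PMF.pure_map, PMF.mem_support_pure_iff] at hs
    have hx : t.1.1.1 = x := by
      simp only [samples, PMF.mem_support_bind_iff, PMF.mem_support_map_iff] at ht
      obtain ⟨d, -, ks, -, j, -, rfl⟩ := ht
      rfl
    rw [hs, ← hx]
    simp only [y, Sample.guessInput, Data.size]
    omega
  · refine ⟨B, hB, fun f x => ?_⟩
    rw [hB', PMF.bind_bind]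
    congr 1
    funext s
    simp only [PMF.pure_map, PMF.pure_bind, y]
    have h1 : (fun q => s.simOracle E (strOracle f) q) =
        encOracleWith (s.cellEnc E f) s.challenge := s.simOracle_strOracle E f
    rw [h1]
    congr 1
    simp only [strOracle, Data.toStr_ofStr]
    exact s.guessInput_lookupStr E f _

end

/-! ### Equivalent logs -/

theorem cells_cons (T : Str × List (Str × Bool)) (S : Schema) (t : List (List Str)) (L : Log) :
    cells (T :: S) (t :: L) = (t.flatMap fun r =>
      List.zipWith (fun a v => ((T.1, a.1), v)) T.2 r) ++ cells S L := rfl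

theorem cells_mapLog (F : Col → Str → Str) (S : Schema) (L : Log) :
    cells S (mapLog F S L) = (cells S L).map fun e => (e.1, F e.1 e.2) := by
  induction S generalizing L with
  | nil => rfl
  | cons T S ih =>
    cases L with
    | nil => rfl
    | cons t L =>
      show cells (T :: S) (List.cons _ (mapLog F S L)) = _
      rw [cells_cons, cells_cons, ih, List.map_append]
      congr 1
      rw [List.flatMap_map, List.map_flatMap]
      refine List.flatMap_congr fun r hr => ?_
      clear hr
      rw [List.map_zipWith]
      generalize T.2 = l
      induction l generalizing r with
      | nil => simp
      | cons a l ih => cases r <;> simp [ih]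

theorem mapLog_mapLog (F G : Col → Str → Str) (S : Schema) (L : Log) :
    mapLog F S (mapLog G S L) = mapLog (fun a v => F a (G a v)) S L := by
  induction S generalizing L with
  | nil => rfl
  | cons T S ih =>
    cases L with
    | nil => rfl
    | cons t L =>
      show List.cons _ (mapLog F S (mapLog G S L)) = List.cons _ _
      rw [ih]
      congr 1
      simp only [List.map_map]
      refine List.map_congr_left fun r hr => ?_
      clear hr
      simp only [Function.comp]
      generalize T.2 = l
      induction l generalizing r with
      | nil => simp
      | cons a l ih => cases r <;> simp [ih]

theorem hasSchema_mapLog {F : Col → Str → Str} {S : Schema} {L : Log} (h : HasSchema S L) :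
    HasSchema S (mapLog F S L) := by
  induction h with
  | nil => exact .nil
  | @cons T t S L hT _ ih =>
    refine .cons (fun r hr => ?_) ih
    obtain ⟨r', hr', rfl⟩ := List.mem_map.mp hr
    simp [hT r' hr']

theorem map_length_mapLog {F : Col → Str → Str} {S : Schema} {L : Log} (h : HasSchema S L) :
    (mapLog F S L).map List.length = L.map List.length := by
  induction h with
  | nil => rfl
  | @cons T t S L hT _ ih =>
    show List.cons _ ((mapLog F S L).map List.length) = List.cons _ _
    rw [ih]
    simp

/-- A log is determined by its cells and the numbers of rows. -/
theorem eq_of_cells_eq {S : Schema} {L L' : Log} (h : HasSchema S L) (h' : HasSchema S L')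
    (hr : L.map List.length = L'.map List.length) (hc : cells S L = cells S L') : L = L' := by
  induction h generalizing L' with
  | nil => cases h'; rfl
  | @cons T t S L hT hL ih =>
    cases h' with
    | @cons _ t' _ L' hT' hL' =>
      simp only [List.map_cons, List.cons.injEq] at hr
      rw [cells_cons, cells_cons] at hc
      have hlen : ∀ t : List (List Str), (∀ r ∈ t, r.length = T.2.length) →
          (t.flatMap fun r => List.zipWith (fun (a : Str × Bool) v => (((T.1, a.1), v) : Col × Str))
            T.2 r).length = t.length * T.2.length := by
        intro t
        induction t with
        | nil => simp
        | cons r t ih =>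
          intro h
          have h1 := ih fun r hr => h r (by simp [hr])
          have h2 := h r (by simp)
          rw [List.flatMap_cons, List.length_append, h1, List.length_cons, Nat.add_one_mul]
          simp [h2, add_comm]
      obtain ⟨h1, h2⟩ := List.append_inj hc (by rw [hlen t hT, hlen t' hT', hr.1])
      rw [ih hL' hr.2 h2]
      congr 1
      have hrow : ∀ r r' : List Str, r.length = T.2.length → r'.length = T.2.length →
          List.zipWith (fun (a : Str × Bool) v => (((T.1, a.1), v) : Col × Str)) T.2 r =
          List.zipWith (fun (a : Str × Bool) v => (((T.1, a.1), v) : Col × Str)) T.2 r' →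
          r = r' := by
        generalize T.2 = l
        intro r
        induction r generalizing l with
        | nil =>
          intro r' h1 h2 _
          cases r' with
          | nil => rfl
          | cons => simp at h1 h2; omega
        | cons v r ih =>
          intro r' h1 h2 h3
          cases r' with
          | nil => simp at h1 h2; omega
          | cons v' r' =>
            cases l with
            | nil => simp at h1
            | cons a l =>
              simp only [List.zipWith_cons_cons, List.cons.injEq, Prod.mk.injEq, true_and] at h3
              rw [h3.1, ih l r' (by simpa using h1) (by simpa using h2) h3.2]
      clear hlen ih h2 hc
      replace hr := hr.1
      induction t generalizing t' with
      | nil => exact (List.length_eq_zero_iff.mp hr.symm).symm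
      | cons r t ih =>
        cases t' with
        | nil => simp at hr
        | cons r' t' =>
          have e1 := hT r (by simp)
          have e2 := hT' r' (by simp)
          rw [List.flatMap_cons, List.flatMap_cons] at h1
          obtain ⟨h3, h4⟩ := List.append_inj h1 (by simp [e1, e2])
          rw [hrow r r' e1 e2 h3, ih (fun r hr => hT r (by simp [hr]))
            (fun r hr => hT' r (by simp [hr])) h4 (by simpa using hr)]

theorem mixLog_mapLog {P : Col → Bool} {M : Col → Str → Str} {S : Schema} {L : Log} :
    mixLog P S L (mapLog M S L) = mapLog (fun a v => if P a = true then M a v else v) S L := by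
  induction S generalizing L with
  | nil => simp [mixLog, mapLog]
  | cons T S ih =>
    cases L with
    | nil => rfl
    | cons t L =>
      show List.cons _ (mixLog P S L (mapLog M S L)) = List.cons _ _
      rw [ih]
      congr 1
      simp only
      rw [List.zipWith_map_right, List.zipWith_self]
      refine List.map_congr_left fun r hr => ?_
      clear hr
      generalize T.2 = l
      induction l generalizing r with
      | nil => simp
      | cons a l ih => cases r <;> simp [ih]

theorem mapLog_id {S : Schema} {L : Log} (h : HasSchema S L) : mapLog (fun _ v => v) S L = L := by
  refine eq_of_cells_eq (hasSchema_mapLog h) h (map_length_mapLog h) ?_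
  rw [cells_mapLog]
  simp

theorem timeStamps_mapLog (F : Col → Str → Str) (S : Schema) (L : Log) :
    timeStamps S (mapLog F S L) = ((cells S L).filter fun e =>
      decide (e.1 ∈ timeColumns S)).map fun e => F e.1 e.2 := by
  unfold timeStamps
  rw [cells_mapLog, List.filter_map, List.map_map]
  rfl

/-! ### Extension of a bijection between finite sets of strings -/

/-- A length-preserving injection of a finite set of strings extends to a length-preserving
permutation of all strings that moves nothing outside the set and its image. -/
theorem exists_perm_extension (V : List Str) (M : Str → Str)
    (hinj : ∀ v ∈ V, ∀ w ∈ V, M v = M w → v = w) (hlen : ∀ v ∈ V, (M v).length = v.length) :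
    ∃ σ : Equiv.Perm Str, (∀ v ∈ V, σ v = M v) ∧ (∀ v, (σ v).length = v.length) ∧
      ∀ v, v ∉ V → v ∉ V.map M → σ v = v := by
  induction V with
  | nil => exact ⟨1, by simp, by simp, by simp⟩
  | cons w V ih =>
    obtain ⟨σ, h1, h2, h3⟩ := ih (fun v hv u hu => hinj v (by simp [hv]) u (by simp [hu]))
      fun v hv => hlen v (by simp [hv])
    by_cases hw : w ∈ V
    · refine ⟨σ, fun v hv => ?_, h2, fun v hv hv' => h3 v (by simp_all) (by simp_all)⟩
      rcases List.mem_cons.mp hv with rfl | hv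
      · exact h1 _ hw
      · exact h1 _ hv
    -- Exchanging the present image of `w` with the desired one does not affect the images of `V`.
    refine ⟨Equiv.swap (σ w) (M w) * σ, fun v hv => ?_, fun v => ?_, fun v hv hv' => ?_⟩
    · rw [Equiv.Perm.mul_apply]
      by_cases hvw : v = w
      · rw [hvw, Equiv.swap_apply_left]
      · have hv : v ∈ V := by simpa [hvw] using hv
        rw [Equiv.swap_apply_of_ne_of_ne, h1 v hv]
        · exact fun h => hvw (σ.injective h)
        · rw [h1 v hv]
          exact fun h => hvw (hinj v (by simp [hv]) w (by simp) h)
    · rw [Equiv.Perm.mul_apply, ← h2 v]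
      have hwl : (M w).length = (σ w).length := by rw [hlen w (by simp), h2]
      by_cases h : σ v = σ w
      · rw [h, Equiv.swap_apply_left, hwl]
      · by_cases h' : σ v = M w
        · rw [h', Equiv.swap_apply_right, hwl]
        · rw [Equiv.swap_apply_of_ne_of_ne h h']
    · have hσ : σ v = v := h3 v (fun h => hv (by simp [h])) fun h => hv' (by
        rw [List.map_cons]; exact List.mem_cons_of_mem _ h)
      rw [Equiv.Perm.mul_apply, hσ, Equiv.swap_apply_of_ne_of_ne]
      · intro h
        have : v = w := σ.injective (hσ.trans h)
        exact hv (by simp [this])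
      · intro h
        exact hv' (by simp [h])

/-! ### Ranks -/

theorem card_toFinset_map_eq {β : Type} {f g : β → ℤ} {l : List β}
    (h : ∀ x ∈ l, ∀ y ∈ l, f x = f y ↔ g x = g y) :
    (l.map f).toFinset.card = (l.map g).toFinset.card := by
  induction l with
  | nil => rfl
  | cons x l ih =>
    have h1 := ih fun y hy z hz => h y (by simp [hy]) z (by simp [hz])
    have h2 : f x ∈ (l.map f).toFinset ↔ g x ∈ (l.map g).toFinset := by
      simp only [List.mem_toFinset, List.mem_map]
      exact exists_congr fun y => and_congr_right fun hy => h y (by simp [hy]) x (by simp)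
    rw [List.map_cons, List.map_cons, List.toFinset_cons, List.toFinset_cons,
      Finset.card_insert_eq_ite, Finset.card_insert_eq_ite]
    simp only [h1, h2]

/-- Ranks depend only on the order of the values. -/
theorem rank_map_eq {β : Type} {f g : β → Str × Str} {l : List β} {x : β} (hx : x ∈ l)
    (h : ∀ x ∈ l, ∀ y ∈ l, toInt (f x).1 + toInt (f x).2 ≤ toInt (f y).1 + toInt (f y).2 ↔
      toInt (g x).1 + toInt (g x).2 ≤ toInt (g y).1 + toInt (g y).2) :
    rank (l.map f) (f x) = rank (l.map g) (g x) := by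
  have key : ∀ f : β → Str × Str, rank (l.map f) (f x) = (((l.filter fun y =>
      decide (toInt (f y).1 + toInt (f y).2 ≤ toInt (f x).1 + toInt (f x).2)).map fun y =>
        toInt (f y).1 + toInt (f y).2).toFinset).card := by
    intro f
    rw [rank]
    congr 1
    ext z
    simp only [Finset.mem_filter, List.mem_toFinset, List.mem_map, List.mem_filter,
      decide_eq_true_eq]
    constructor
    · rintro ⟨⟨_, ⟨y, hy, rfl⟩, rfl⟩, hz⟩
      exact ⟨y, ⟨hy, hz⟩, rfl⟩
    · rintro ⟨y, ⟨hy, hz⟩, rfl⟩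
      exact ⟨⟨_, ⟨y, hy, rfl⟩, rfl⟩, hz⟩
  rw [key f, key g]
  have h1 : (l.filter fun y =>
      decide (toInt (f y).1 + toInt (f y).2 ≤ toInt (f x).1 + toInt (f x).2)) = l.filter fun y =>
      decide (toInt (g y).1 + toInt (g y).2 ≤ toInt (g x).1 + toInt (g x).2) :=
    List.filter_congr fun y hy => decide_eq_decide.mpr (h y hy x hx)
  rw [h1]
  refine card_toFinset_map_eq fun y hy z hz => ?_
  have hy := (List.mem_filter.mp hy).1
  have hz := (List.mem_filter.mp hz).1
  rw [le_antisymm_iff, le_antisymm_iff, h y hy z hz, h z hz y hy]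

/-- Two encryptions of logs look the same if the cells have the same encryptions, the policy
constants occur at the same places, and the timestamps have the same order. -/
theorem viewWith_mapLog_congr {F F' G G' : Col → Str → Str} {ch : Challenge} {L : Log}
    (hD : ∀ d ∈ ch.disps, d ∈ ch.consts)
    (hcell : ∀ e ∈ cells ch.schema L, F e.1 (G e.1 e.2) = F' e.1 (G' e.1 e.2))
    (hconst : ∀ a, ∀ c ∈ ch.consts, F a c = F' a c)
    (hocc : ∀ a, ∀ c ∈ ch.consts, (a, c) ∈ cells ch.schema (mapLog G ch.schema L) ↔
      (a, c) ∈ cells ch.schema (mapLog G' ch.schema L))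
    (hedd : EDD (timeStamps ch.schema (mapLog G ch.schema L))
      (timeStamps ch.schema (mapLog G' ch.schema L)) ch.disps)
    (htime : ∀ a ∈ timeColumns ch.schema, F a = F (timeCol ch.schema) ∧
      F' a = F' (timeCol ch.schema)) :
    viewWith F ch (mapLog G ch.schema L) = viewWith F' ch (mapLog G' ch.schema L) := by
  set X := (cells ch.schema L).filter fun e => decide (e.1 ∈ timeColumns ch.schema) with hX
  let W : List ((Col × Str) × Str) := X.flatMap fun e => ch.disps.map fun d => (e, d)
  have hW : ∀ G : Col → Str → Str, timePairs ch.schema ch.disps (mapLog G ch.schema L) =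
      W.map fun w => (G w.1.1 w.1.2, w.2) := by
    intro G
    rw [timePairs, timeStamps_mapLog, List.flatMap_map, List.map_flatMap]
    simp only [List.map_map]
    rfl
  have hord : ∀ w ∈ W, ∀ w' ∈ W,
      toInt (G w.1.1 w.1.2) + toInt w.2 ≤ toInt (G w'.1.1 w'.1.2) + toInt w'.2 ↔
      toInt (G' w.1.1 w.1.2) + toInt w.2 ≤ toInt (G' w'.1.1 w'.1.2) + toInt w'.2 := by
    intro w hw w' hw'
    obtain ⟨e, he, hw⟩ := List.mem_flatMap.mp hw
    obtain ⟨d, hd, rfl⟩ := List.mem_map.mp hw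
    obtain ⟨e', he', hw'⟩ := List.mem_flatMap.mp hw'
    obtain ⟨d', hd', rfl⟩ := List.mem_map.mp hw'
    obtain ⟨i, hi⟩ := List.getElem?_of_mem he
    obtain ⟨j, hj⟩ := List.getElem?_of_mem he'
    have := hedd.2 d' hd' d hd j i (G e'.1 e'.2) (G e.1 e.2) (G' e'.1 e'.2) (G' e.1 e.2)
      (by rw [timeStamps_mapLog, List.getElem?_map, ← hX, hj]; rfl)
      (by rw [timeStamps_mapLog, List.getElem?_map, ← hX, hi]; rfl)
      (by rw [timeStamps_mapLog, List.getElem?_map, ← hX, hj]; rfl)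
      (by rw [timeStamps_mapLog, List.getElem?_map, ← hX, hi]; rfl)
    exact this
  have hoped : ∀ k, oped (F (timeCol ch.schema)) ((W.map fun w => (G w.1.1 w.1.2, w.2)).take k) =
      oped (F' (timeCol ch.schema)) ((W.map fun w => (G' w.1.1 w.1.2, w.2)).take k) := by
    intro k
    rw [← List.map_take, ← List.map_take, oped, oped, List.map_map, List.map_map]
    refine List.map_congr_left fun w hw => ?_
    have hwW := List.mem_of_mem_take hw
    have hrank := rank_map_eq (f := fun w : (Col × Str) × Str => (G w.1.1 w.1.2, w.2))
      (g := fun w : (Col × Str) × Str => (G' w.1.1 w.1.2, w.2)) hw fun x hx y hy =>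
        hord x (List.mem_of_mem_take hx) y (List.mem_of_mem_take hy)
    simp only [Function.comp]
    rw [hrank]
    obtain ⟨e, he, hwW⟩ := List.mem_flatMap.mp hwW
    obtain ⟨d, hd, rfl⟩ := List.mem_map.mp hwW
    obtain ⟨he, he'⟩ := List.mem_filter.mp he
    have ht := htime e.1 (of_decide_eq_true he')
    have h1 := hcell e he
    rw [ht.1, ht.2] at h1
    simp only [h1, hconst _ d (hD d hd)]
  have hinits : ∀ P : List (Str × Str), P.inits = (List.range (P.length + 1)).map P.take := by
    intro P
    refine List.ext_getElem (by simp) fun i h₁ h₂ => ?_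
    simp
  have h1 := hoped W.length
  rw [List.take_of_length_le (by simp), List.take_of_length_le (by simp)] at h1
  have h2 : ((columns ch.schema).flatMap fun a => (ch.consts.filter fun c =>
        decide ((a, c) ∈ cells ch.schema (mapLog G ch.schema L))).map fun c => (a, c, F a c)) =
      (columns ch.schema).flatMap fun a => (ch.consts.filter fun c =>
        decide ((a, c) ∈ cells ch.schema (mapLog G' ch.schema L))).map
          fun c => (a, c, F' a c) := by
    refine List.flatMap_congr fun a _ => ?_
    rw [List.filter_congr fun c hc => decide_eq_decide.mpr (hocc a c hc)]
    refine List.map_congr_left fun c hc => ?_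
    rw [hconst a c (List.mem_filter.mp hc).1]
  unfold viewWith
  rw [hW G, hW G', h1, h2, hinits, hinits, mapLog_mapLog, mapLog_mapLog,
    mapLog_congr (F := fun a v => F a (G a v)) (G := fun a v => F' a (G' a v)) hcell,
    List.length_map, List.length_map]
  simp only [List.map_map, Function.comp_def, hoped]

/-! ### Neighbouring hybrids -/

theorem EDD.refl (u D : List Str) : EDD u u D := by
  refine ⟨rfl, fun d _ d' _ i j ui uj vi vj h1 h2 h3 h4 => ?_⟩
  obtain rfl : ui = vi := Option.some.inj (h1.symm.trans h3)
  obtain rfl : uj = vj := Option.some.inj (h2.symm.trans h4)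
  exact Iff.rfl

theorem classIdx_timeColumns {S : Schema} {δ : EqScheme} {a : Col} (ha : a ∈ timeColumns S) :
    classIdx S δ a = classIdx S δ (timeCol S) :=
  (classIdx_eq_iff (mem_columns_of_timeColumns ha)).mpr
    (Relation.EqvGen.rel _ _ (Or.inr ⟨ha, timeCol_mem ha⟩))

theorem LogEquiv.eq_mapLog {S : Schema} {δ : EqScheme} {C D : List Str} {L₀ L₁ : Log}
    (h : LogEquiv S δ C D L₀ L₁) {M : Col → Str → Str}
    (hM : cells S L₁ = (cells S L₀).map fun e => (e.1, M e.1 e.2)) : L₁ = mapLog M S L₀ := by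
  refine eq_of_cells_eq h.schema₁ (hasSchema_mapLog h.schema₀) ?_ ?_
  · rw [map_length_mapLog h.schema₀, h.rows]
  · rw [cells_mapLog, hM]

theorem hybridLog_eq_mapLog {ch : Challenge} {M : Col → Str → Str}
    (hM : ch.log₁ = mapLog M ch.schema ch.log₀) (i : ℕ) :
    hybridLog ch i = mapLog (fun a v => if classIdx ch.schema ch.eqs a < i then M a v else v)
      ch.schema ch.log₀ := by
  rw [hybridLog, hM, mixLog_mapLog]
  simp only [decide_eq_true_eq]

theorem hybridLog_zero {ch : Challenge} (h : ch.Valid) : hybridLog ch 0 = ch.log₀ := by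
  obtain ⟨M, -, -, hM, -, -⟩ := h.equiv.bij
  rw [hybridLog_eq_mapLog (h.equiv.eq_mapLog hM)]
  simpa using mapLog_id h.equiv.schema₀

theorem hybridLog_of_le {ch : Challenge} (h : ch.Valid) {i : ℕ}
    (hi : (columns ch.schema).length ≤ i) : hybridLog ch i = ch.log₁ := by
  obtain ⟨M, -, -, hM, -, -⟩ := h.equiv.bij
  have hM' := h.equiv.eq_mapLog hM
  rw [hybridLog_eq_mapLog hM', hM']
  exact mapLog_congr fun e he =>
    if_pos ((classIdx_lt (mem_columns_of_cells he)).trans_le hi)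

/-- The logs of two neighbouring hybrids differ only in the class `j`, and there by a permutation of
the strings that preserves lengths, fixes the policy constants, and fixes the values about which the
adversary may ask. If the permutation is applied before the encryption in one of the hybrids, then
the adversary cannot distinguish them at all. -/
theorem exists_perm_hybridLog {ch : Challenge} (h : ch.Valid) (j : ℕ) :
    ∃ σ : Equiv.Perm Str, (∀ v, (σ v).length = v.length) ∧
      ∀ (f : Str → Str) (g : Col → Str → Str), (∀ a b, classIdx ch.schema ch.eqs a =
          classIdx ch.schema ch.eqs b → g a = g b) →
        viewWith (fun a v => if classIdx ch.schema ch.eqs a = j then f (σ v) else g a v) ch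
            (hybridLog ch j) =
          viewWith (fun a v => if classIdx ch.schema ch.eqs a = j then f v else g a v) ch
            (hybridLog ch (j + 1)) ∧
        encOracleWith (fun a v => if classIdx ch.schema ch.eqs a = j then f (σ v) else g a v) ch =
          encOracleWith (fun a v => if classIdx ch.schema ch.eqs a = j then f v else g a v) ch := by
  classical
  obtain ⟨M, hclass, hbij, hM, hC, hlen⟩ := h.equiv.bij
  have hL := h.equiv.eq_mapLog hM
  set S := ch.schema
  set δ := ch.eqs
  let V : List Str := ((cells S ch.log₀).filter fun e => decide (classIdx S δ e.1 = j)).map Prod.snd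
  have hV : ∀ v, v ∈ V ↔ ∃ a, classIdx S δ a = j ∧ (a, v) ∈ cells S ch.log₀ := by
    intro v
    simp only [V, List.mem_map, List.mem_filter, decide_eq_true_eq]
    constructor
    · rintro ⟨⟨a, v⟩, ⟨h1, h2⟩, rfl⟩; exact ⟨a, h2, h1⟩
    · rintro ⟨a, h1, h2⟩; exact ⟨(a, v), ⟨h2, h1⟩, rfl⟩
  obtain ⟨m, hm⟩ : ∃ m : Str → Str, ∀ a ∈ columns S, classIdx S δ a = j → M a = m := by
    by_cases hex : ∃ a ∈ columns S, classIdx S δ a = j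
    · obtain ⟨a, ha, hj⟩ := hex
      exact ⟨M a, fun b hb hbj => hclass b a ((classIdx_eq_iff hb).mp (hbj.trans hj.symm))⟩
    · exact ⟨id, fun a ha hj => absurd ⟨a, ha, hj⟩ hex⟩
  obtain ⟨σ, hσ, hσl, hσf⟩ := exists_perm_extension V m (fun v hv w hw hvw => by
      obtain ⟨a, ha, hav⟩ := (hV v).mp hv
      obtain ⟨b, hb, hbw⟩ := (hV w).mp hw
      have hac := mem_columns_of_cells hav
      rw [← hm a hac ha] at hvw
      exact (hbij a hac).injOn ⟨a, .refl a, hav⟩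
        ⟨b, (classIdx_eq_iff hac).mp (ha.trans hb.symm), hbw⟩ hvw) fun v hv => by
      obtain ⟨a, ha, hav⟩ := (hV v).mp hv
      rw [← hm a (mem_columns_of_cells hav) ha]
      exact (hlen _ hav).symm
  have hσC : ∀ c ∈ ch.consts, σ c = c := by
    intro c hc
    by_cases h1 : c ∈ V
    · obtain ⟨a, ha, hac⟩ := (hV c).mp h1
      rw [hσ c h1, ← hm a (mem_columns_of_cells hac) ha]
      exact hC _ hac (Or.inl hc)
    · refine hσf c h1 fun h2 => ?_
      obtain ⟨v, hv, rfl⟩ := List.mem_map.mp h2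
      obtain ⟨a, ha, hav⟩ := (hV v).mp hv
      rw [← hm a (mem_columns_of_cells hav) ha] at hc h1
      have := hC _ hav (Or.inr hc)
      exact h1 (this ▸ hv)
  have hσo : ∀ v, v ∉ ch.log₀.flatten.flatten → v ∉ ch.log₁.flatten.flatten → σ v = v := by
    intro v h0 h1
    refine hσf v (fun h2 => ?_) fun h2 => ?_
    · obtain ⟨a, -, hav⟩ := (hV v).mp h2
      exact h0 (mem_flatten_flatten_of_cells hav)
    · obtain ⟨w, hw, rfl⟩ := List.mem_map.mp h2
      obtain ⟨a, ha, haw⟩ := (hV w).mp hw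
      rw [← hm a (mem_columns_of_cells haw) ha] at h1
      exact h1 (mem_flatten_flatten_of_cells (S := S) (e := (a, M a w))
        (hM ▸ List.mem_map.mpr ⟨_, haw, rfl⟩))
  refine ⟨σ, hσl, fun f g hg => ⟨?_, encOracleWith_congr fun a _ v h0 h1 => by rw [hσo v h0 h1]⟩⟩
  -- A constant occurs at the same places in all hybrids.
  have hocc : ∀ i a, ∀ c ∈ ch.consts, (a, c) ∈ cells S (mapLog
      (fun a v => if classIdx S δ a < i then M a v else v) S ch.log₀) ↔
        (a, c) ∈ cells S ch.log₀ := by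
    intro i a c hc
    rw [cells_mapLog, List.mem_map]
    constructor
    · rintro ⟨⟨b, v⟩, hbv, hE⟩
      simp only [Prod.mk.injEq] at hE
      obtain ⟨rfl, hE⟩ := hE
      split_ifs at hE
      · have := hC _ hbv (Or.inr (by rw [hE]; exact hc))
        rw [← hE, this]
        exact hbv
      · rwa [← hE]
    · intro hac
      refine ⟨_, hac, ?_⟩
      have := hC _ hac (Or.inl hc)
      simp only [this, ite_self]
  have htime : ∀ i, timeStamps S (mapLog (fun a v => if classIdx S δ a < i then M a v else v) S
      ch.log₀) = if classIdx S δ (timeCol S) < i then timeStamps S ch.log₁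
        else timeStamps S ch.log₀ := by
    intro i
    have h0 : timeStamps S ch.log₀ = ((cells S ch.log₀).filter fun e =>
        decide (e.1 ∈ timeColumns S)).map fun e => e.2 := rfl
    rw [timeStamps_mapLog, hL, timeStamps_mapLog, h0]
    split_ifs with hi
    all_goals
      refine List.map_congr_left fun e he => ?_
      have he := classIdx_timeColumns (δ := δ) (of_decide_eq_true (List.mem_filter.mp he).2)
      simp only [he, hi, if_true, if_false]
  rw [hybridLog_eq_mapLog hL, hybridLog_eq_mapLog hL]
  refine viewWith_mapLog_congr h.disps_subset (fun e he => ?_) (fun a c hc => ?_)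
    (fun a c hc => (hocc j a c hc).trans (hocc (j + 1) a c hc).symm) ?_ fun a ha => ?_
  · change (if classIdx S δ e.1 = j then f (σ (if classIdx S δ e.1 < j then M e.1 e.2 else e.2))
        else g e.1 (if classIdx S δ e.1 < j then M e.1 e.2 else e.2)) =
      if classIdx S δ e.1 = j then f (if classIdx S δ e.1 < j + 1 then M e.1 e.2 else e.2)
        else g e.1 (if classIdx S δ e.1 < j + 1 then M e.1 e.2 else e.2)
    rcases lt_trichotomy (classIdx S δ e.1) j with h1 | h1 | h1
    · simp only [h1, h1.ne, Nat.lt_add_right 1 h1, if_true, if_false]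
    · have := hσ e.2 ((hV _).mpr ⟨e.1, h1, he⟩)
      rw [← hm e.1 (mem_columns_of_cells he) h1] at this
      simp only [h1, lt_irrefl, Nat.lt_succ_self, if_true, if_false, this]
    · have h2 : ¬ classIdx S δ e.1 < j + 1 := by omega
      simp only [h1.ne', h1.not_gt, h2, if_false]
  · simp only [hσC c hc]
  · change EDD (timeStamps S (mapLog _ S ch.log₀)) (timeStamps S (mapLog _ S ch.log₀)) ch.disps
    rw [htime, htime]
    by_cases h1 : classIdx S δ (timeCol S) < j
    · rw [if_pos h1, if_pos (by omega)]
      exact EDD.refl _ _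
    · rw [if_neg h1]
      split_ifs
      · exact h.equiv.edd
      · exact EDD.refl _ _
  · have := classIdx_timeColumns (δ := δ) ha
    constructor <;>
    · funext v
      change (if classIdx S δ a = j then _ else _) = (if classIdx S δ (timeCol S) = j then _ else _)
      rw [this, hg _ _ this]

/-! ### Measurability of the acceptance probability -/

instance : Countable Data := by
  let c : Data → ℕ := fun d => Data.rec 0 (fun _ _ m n => Nat.pair m n + 1) d
  have hc : ∀ a b, c a = c b → a = b := by
    intro a
    induction a with
    | nil =>
      intro b h
      cases b with
      | nil => rfl
      | cons b₁ b₂ => exact absurd h (Nat.succ_ne_zero _).symm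
    | cons a₁ a₂ ih₁ ih₂ =>
      intro b h
      cases b with
      | nil => exact absurd h (Nat.succ_ne_zero _)
      | cons b₁ b₂ =>
        have h' : Nat.pair (c a₁) (c a₂) = Nat.pair (c b₁) (c b₂) := Nat.succ_injective h
        obtain ⟨h₁, h₂⟩ := Nat.pair_eq_pair.mp h'
        rw [ih₁ _ h₁, ih₂ _ h₂]
  exact Function.Injective.countable fun a b => hc a b

section

variable {Ω : Type} [MeasurableSpace Ω] {β γ : Type}

/-- A discrete random variable: all its fibres are measurable. -/
def DiscreteMeasurable (g : Ω → β) : Prop := ∀ b, MeasurableSet {ω | g ω = b}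

theorem DiscreteMeasurable.const (b : β) : DiscreteMeasurable fun _ : Ω => b :=
  fun _ => MeasurableSet.const _

theorem DiscreteMeasurable.comp [Countable β] {g : Ω → β} (hg : DiscreteMeasurable g) (h : β → γ) :
    DiscreteMeasurable fun ω => h (g ω) := by
  intro c
  have : {ω | h (g ω) = c} = ⋃ b : {b // h b = c}, {ω | g ω = b} := by
    ext ω
    simp
  rw [this]
  exact MeasurableSet.iUnion fun b => hg b

theorem DiscreteMeasurable.prodMk {g : Ω → β} {h : Ω → γ} (hg : DiscreteMeasurable g)
    (hh : DiscreteMeasurable h) : DiscreteMeasurable fun ω => (g ω, h ω) := by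
  rintro ⟨b, c⟩
  have : {ω | (g ω, h ω) = (b, c)} = {ω | g ω = b} ∩ {ω | h ω = c} := by
    ext ω
    simp
  rw [this]
  exact (hg b).inter (hh c)

theorem DiscreteMeasurable.listMap [Countable γ] {g : Ω → β → γ} (l : List β)
    (hg : ∀ b, DiscreteMeasurable fun ω => g ω b) : DiscreteMeasurable fun ω => l.map (g ω) := by
  induction l with
  | nil => exact DiscreteMeasurable.const _
  | cons b l ih => exact ((hg b).prodMk ih).comp fun p : γ × List γ => p.1 :: p.2

/-- A family of distributions whose point masses are measurable functions of the parameter. -/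
def MeasurablePMF (m : Ω → PMF β) : Prop := ∀ b, Measurable fun ω => m ω b

theorem DiscreteMeasurable.pure {g : Ω → β} (hg : DiscreteMeasurable g) :
    MeasurablePMF fun ω => PMF.pure (g ω) := by
  classical
  intro b
  simp only [PMF.pure_apply]
  refine Measurable.ite ?_ measurable_const measurable_const
  simpa only [eq_comm] using hg b

theorem MeasurablePMF.const (m : PMF β) : MeasurablePMF fun _ : Ω => m :=
  fun _ => measurable_const

theorem MeasurablePMF.bind [Countable β] {m : Ω → PMF β} {k : Ω → β → PMF γ}
    (hm : MeasurablePMF m) (hk : ∀ b, MeasurablePMF fun ω => k ω b) :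
    MeasurablePMF fun ω => (m ω).bind (k ω) := by
  intro c
  simp only [PMF.bind_apply]
  exact Measurable.tsum fun b => (hm b).mul (hk b c)

theorem MeasurablePMF.map [Countable β] {m : Ω → PMF β} (hm : MeasurablePMF m) (f : β → γ) :
    MeasurablePMF fun ω => (m ω).map f :=
  hm.bind fun _ => MeasurablePMF.const _

theorem MeasurablePMF.andThen {m : Ω → PMF (Data × ℕ)} {k : Ω → Data → PMF (Data × ℕ)}
    (hm : MeasurablePMF m) (hk : ∀ b, MeasurablePMF fun ω => k ω b) :
    MeasurablePMF fun ω => andThen (m ω) (k ω) :=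
  hm.bind fun r => (hk r.1).map _

/-- If the oracle depends measurably on a parameter, then so does the behaviour of a program. -/
theorem measurablePMF_eval {O : Ω → Data → Data} (hO : ∀ q, DiscreteMeasurable fun ω => O ω q)
    (p : Prog) : ∀ x, MeasurablePMF fun ω => p.eval (O ω) x := by
  induction p with
  | id => exact fun x => MeasurablePMF.const _
  | nil => exact fun x => MeasurablePMF.const _
  | fst => exact fun x => MeasurablePMF.const _
  | snd => exact fun x => MeasurablePMF.const _
  | eq => exact fun x => MeasurablePMF.const _
  | flip => exact fun x => MeasurablePMF.const _
  | query =>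
    intro x
    have h : DiscreteMeasurable fun ω => (O ω x, 1 + x.size + (O ω x).size) :=
      (hO x).comp fun y => (y, 1 + x.size + y.size)
    exact h.pure
  | comp p q hp hq =>
    intro x
    have h := (hq x).andThen hp
    simpa only [Prog.eval] using h
  | pair p q hp hq =>
    intro x
    have h := (hp x).andThen fun y => (hq x).andThen fun z =>
      MeasurablePMF.const (Ω := Ω) (PMF.pure (Data.cons y z, 1))
    simpa only [Prog.eval] using h
  | cond p q r hp hq hr =>
    intro x
    have h := (hp x).andThen (k := fun ω y => if y = Data.nil then r.eval (O ω) x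
      else q.eval (O ω) x) fun y => by
        split_ifs
        · exact hr x
        · exact hq x
    simpa only [Prog.eval] using h
  | iter p hp =>
    intro x
    simp only [Prog.eval]
    induction x.fst.toList.length with
    | zero => exact MeasurablePMF.const _
    | succ n ih => exact ih.andThen hp

theorem measurable_acceptProb {O : Ω → Data → Data} (hO : ∀ q, DiscreteMeasurable fun ω => O ω q)
    {x : Ω → Data} (hx : DiscreteMeasurable x) (p : Prog) :
    Measurable fun ω => p.acceptProb (O ω) (x ω) := by
  have h : MeasurablePMF fun ω => (PMF.pure (x ω)).bind fun y => p.eval (O ω) y :=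
    hx.pure.bind (measurablePMF_eval hO p)
  simp only [PMF.pure_bind] at h
  exact ((h.map Prod.fst).map Data.toBool) true

end

/-! ### The hybrid argument: the ideal world -/

theorem discreteMeasurable_randomFunction (len : ℕ → ℕ) (m : Str) :
    DiscreteMeasurable fun ω => randomFunction len ω m := by
  refine DiscreteMeasurable.listMap (g := fun (ω : Str × ℕ → Bool) i => ω (m, i)) _ fun i b => ?_
  have h : Measurable fun ω : Str × ℕ → Bool => ω (m, i) := measurable_pi_apply (m, i)
  exact h (measurableSet_singleton b)

/-- The probability that the adversary answers `true` when it is given the hybrid log of index `i`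
and the class that was sampled is encrypted by `f`. -/
noncomputable def Sample.accept (E : DetEnc) (A : Adversary) (s : Sample) (f : Str → Str) (i : ℕ) :
    ENNReal :=
  A.guess.acceptProb (encOracleWith (s.cellEnc E f) s.challenge) (s.guessInput (s.cellEnc E f) i)

theorem measurable_accept (E : DetEnc) (A : Adversary) (s : Sample) (len : ℕ → ℕ) (i : ℕ) :
    Measurable fun ω => s.accept E A (randomFunction len ω) i := by
  refine measurable_acceptProb (fun q => ?_) ?_ A.guess
  · unfold encOracleWith Sample.cellEnc
    by_cases hq : readCol q.fst ∈ columns s.challenge.schema ∧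
        q.snd.toStr ∉ s.challenge.log₀.flatten.flatten ∧
        q.snd.toStr ∉ s.challenge.log₁.flatten.flatten
    · simp only [if_pos hq]
      split_ifs
      · exact (discreteMeasurable_randomFunction len _).comp Data.ofStr
      · exact DiscreteMeasurable.const _
    · simp only [if_neg hq]
      exact DiscreteMeasurable.const _
  · -- Only the values of the random function in a finite table matter.
    have h := (DiscreteMeasurable.listMap
      (g := fun (ω : Str × ℕ → Bool) m => (m, randomFunction len ω m)) s.challenge.values fun m =>
        (DiscreteMeasurable.const m).prodMk (discreteMeasurable_randomFunction len m)).comp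
          fun t => s.guessInput (s.cellEnc E (lookupStr t)) i
    simpa only [Sample.guessInput_lookupStr] using h

/-- Permuting the arguments of a random function does not change its distribution. -/
theorem lintegral_fairBits_perm (σ : Equiv.Perm Str) (g : (Str × ℕ → Bool) → ENNReal) :
    ∫⁻ ω, g (fun p => ω (σ p.1, p.2)) ∂fairBits = ∫⁻ ω, g ω ∂fairBits := by
  let e : Str × ℕ ≃ Str × ℕ := (σ.prodCongr (Equiv.refl ℕ)).symm
  have h := Measure.infinitePi_map_piCongrLeft
    (μ := fun _ : Str × ℕ => (PMF.uniformOfFintype Bool).toMeasure) e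
  have h2 := lintegral_map_equiv (μ := fairBits) g
    (MeasurableEquiv.piCongrLeft (fun _ : Str × ℕ => Bool) e)
  have h3 : Measure.map (MeasurableEquiv.piCongrLeft (fun _ : Str × ℕ => Bool) e) fairBits =
    fairBits := h
  rw [h3] at h2
  rw [h2]
  congr 1
  funext ω
  congr 1
  funext p
  obtain ⟨q, rfl⟩ := e.surjective p
  rw [MeasurableEquiv.coe_piCongrLeft, Equiv.piCongrLeft_apply_apply]
  exact congrArg ω (e.symm_apply_apply q)

theorem randomFunction_perm {len : ℕ → ℕ} {σ : Equiv.Perm Str}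
    (hσ : ∀ v, (σ v).length = v.length) (ω : Str × ℕ → Bool) (v : Str) :
    randomFunction len (fun p => ω (σ p.1, p.2)) v = randomFunction len ω (σ v) := by
  rw [randomFunction, randomFunction, hσ]

/-- With a random function, neighbouring hybrids cannot be distinguished. -/
theorem lintegral_accept_succ (E : DetEnc) (A : Adversary) (s : Sample) (len : ℕ → ℕ)
    (hs : s.challenge.Valid) :
    ∫⁻ ω, s.accept E A (randomFunction len ω) s.2 ∂fairBits =
      ∫⁻ ω, s.accept E A (randomFunction len ω) (s.2 + 1) ∂fairBits := by
  obtain ⟨σ, hσ, h⟩ := exists_perm_hybridLog hs s.2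
  rw [← lintegral_fairBits_perm σ]
  congr 1
  funext ω
  obtain ⟨h1, h2⟩ := h (randomFunction len ω) (fun a v => E.enc s.1.1.1.toList.length
    (s.1.2.getD (classIdx s.challenge.schema s.challenge.eqs a) []) v) fun a b hab => by rw [hab]
  have h3 : s.cellEnc E (randomFunction len fun p => ω (σ p.1, p.2)) = fun a v =>
      if classIdx s.challenge.schema s.challenge.eqs a = s.2 then randomFunction len ω (σ v)
      else E.enc s.1.1.1.toList.length
        (s.1.2.getD (classIdx s.challenge.schema s.challenge.eqs a) []) v := by
    funext a v
    rw [Sample.cellEnc, randomFunction_perm hσ]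
  unfold Sample.accept Sample.guessInput
  rw [h3, h1, h2]
  rfl

/-! ### The hybrid argument: the real world -/

theorem bind_congr_of_mem_support {β γ : Type} {p : PMF β} {f g : β → PMF γ}
    (h : ∀ b ∈ p.support, f b = g b) : p.bind f = p.bind g := by
  ext c
  rw [PMF.bind_apply, PMF.bind_apply]
  refine tsum_congr fun b => ?_
  by_cases hb : p b = 0
  · rw [hb, zero_mul, zero_mul]
  · rw [h b ((PMF.mem_support_iff _ _).mpr hb)]

theorem length_of_mem_iid {β : Type} {p : PMF β} {n : ℕ} {l : List β}
    (h : l ∈ (iid p n).support) : l.length = n := by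
  induction n generalizing l with
  | zero =>
    simp only [iid, PMF.mem_support_pure_iff] at h
    simp [h]
  | succ n ih =>
    simp only [iid, PMF.mem_support_bind_iff, PMF.mem_support_map_iff] at h
    obtain ⟨a, -, l, hl, rfl⟩ := h
    simp [ih hl]

/-- Replacing one of several independent samples by a fresh one does not change their
distribution. -/
theorem iid_bind_set {β γ : Type} (p : PMF β) (n j : ℕ) (f : List β → PMF γ) :
    (p.bind fun k => (iid p n).bind fun l => f (l.set j k)) = (iid p n).bind f := by
  induction n generalizing j f with
  | zero => simp [iid]
  | succ n ih =>
    cases j with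
    | zero =>
      simp only [iid, PMF.bind_bind, PMF.bind_map, Function.comp_def, List.set_cons_zero,
        PMF.bind_const]
    | succ j =>
      simp only [iid, PMF.bind_bind, PMF.bind_map, Function.comp_def, List.set_cons_succ]
      rw [PMF.bind_comm]
      congr 1
      funext a
      exact ih j fun l => f (a :: l)

/-- The encryption of a value in a column, with the key of the class of the column. -/
noncomputable def keyedEnc (E : DetEnc) (κ : ℕ) (ch : Challenge) (ks : List Str) (a : Col)
    (m : Str) : Str :=
  E.enc κ (ks.getD (classIdx ch.schema ch.eqs a) []) m

/-- The answer of the adversary in the game with the hybrid log of index `i`, if its choice is `d`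
and the keys of the classes are `ks`. -/
noncomputable def hybridAnswer (E : DetEnc) (A : Adversary) (κ : ℕ) (i : ℕ) (d : Data)
    (ks : List Str) : PMF Bool :=
  (A.guess.output (encOracleWith (keyedEnc E κ (readChallenge d.fst) ks) (readChallenge d.fst))
    (.cons (Data.unary κ) (.cons d.snd (viewWith (keyedEnc E κ (readChallenge d.fst) ks)
      (readChallenge d.fst) (hybridLog (readChallenge d.fst) i))))).map Data.toBool

/-- The answer of the adversary in the game with the hybrid log of index `i`. -/
noncomputable def hybridGame (E : DetEnc) (A : Adversary) (κ : ℕ) (i : ℕ) : PMF Bool :=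
  (A.choose.output noOracle (Data.unary κ)).bind fun d =>
    (iid (E.keyDist κ) (columns (readChallenge d.fst).schema).length).bind
      (hybridAnswer E A κ i d)

theorem length_toList_unary (κ : ℕ) : (Data.unary κ).toList.length = κ := by
  simp [Data.unary, Data.toList_ofList]

/-- Encrypting the class `j` by an oracle with key `k` amounts to replacing the key of this class by
`k`. -/
theorem hybridAnswer_set (E : DetEnc) (A : Adversary) (κ : ℕ) (i : ℕ) (d : Data)
    {ks : List Str} (hks : ks.length = (columns (readChallenge d.fst).schema).length) (j : ℕ)
    (k : Str) :
    (A.guess.output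
      (encOracleWith (Sample.cellEnc E (((Data.unary κ, d), ks), j) (E.enc κ k))
        (readChallenge d.fst))
      (Sample.guessInput (Sample.cellEnc E (((Data.unary κ, d), ks), j) (E.enc κ k))
        (((Data.unary κ, d), ks), j) i)).map Data.toBool =
      hybridAnswer E A κ i d (ks.set j k) := by
  have h : ∀ a ∈ columns (readChallenge d.fst).schema, ∀ v,
      Sample.cellEnc E (((Data.unary κ, d), ks), j) (E.enc κ k) a v =
        keyedEnc E κ (readChallenge d.fst) (ks.set j k) a v := by
    intro a ha v
    have hlt := classIdx_lt (δ := (readChallenge d.fst).eqs) ha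
    rw [← hks] at hlt
    unfold Sample.cellEnc keyedEnc Sample.challenge
    simp only [length_toList_unary, List.getD_eq_getElem?_getD, List.getElem?_set]
    by_cases hj : classIdx (readChallenge d.fst).schema (readChallenge d.fst).eqs a = j
    · simp [hj, hj ▸ hlt]
    · simp [hj, Ne.symm hj]
  have h1 := encOracleWith_congr (ch := readChallenge d.fst) fun a ha v _ _ => h a ha v
  have h2 := viewWith_congr (ch := readChallenge d.fst)
    (L := hybridLog (readChallenge d.fst) i) fun a ha v _ => h a ha v
  unfold hybridAnswer
  rw [← h1, ← h2]
  rfl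

/-- Given the encryption function with a random key, the distinguisher plays the hybrid game with a
random index: the key behind its oracle takes the part of one of the keys of the game. -/
theorem keyDist_bind_samples (E : DetEnc) (A : Adversary) (N : Polynomial ℕ) (κ b : ℕ) :
    ((E.keyDist κ).bind fun k => (samples E A N (Data.unary κ)).bind fun s =>
      (A.guess.output (encOracleWith (s.cellEnc E (E.enc κ k)) s.challenge)
        (s.guessInput (s.cellEnc E (E.enc κ k)) (s.2 + b))).map Data.toBool) =
      (dyadic (doublings (N.eval κ) (N.eval κ))).bind fun j => hybridGame E A κ (j + b) := by
  have h : ∀ k, ((samples E A N (Data.unary κ)).bind fun s =>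
      (A.guess.output (encOracleWith (s.cellEnc E (E.enc κ k)) s.challenge)
        (s.guessInput (s.cellEnc E (E.enc κ k)) (s.2 + b))).map Data.toBool) =
      (dyadic (doublings (N.eval κ) (N.eval κ))).bind fun j =>
        (A.choose.output noOracle (Data.unary κ)).bind fun d =>
          (iid (E.keyDist κ) (columns (readChallenge d.fst).schema).length).bind fun ks =>
            hybridAnswer E A κ (j + b) d (ks.set j k) := by
    intro k
    rw [PMF.bind_comm]
    simp only [samples, PMF.bind_bind, PMF.bind_map, length_toList_unary]
    refine bind_congr_of_mem_support fun d _ => ?_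
    rw [PMF.bind_comm]
    congr 1
    funext j
    refine bind_congr_of_mem_support fun ks hks => ?_
    exact hybridAnswer_set E A κ (j + b) d (length_of_mem_iid hks) j k
  simp only [h]
  rw [PMF.bind_comm]
  congr 1
  funext j
  rw [PMF.bind_comm]
  unfold hybridGame
  congr 1
  funext d
  exact iid_bind_set _ _ _ _

/-- The game is a choice between the first and the last hybrid. -/
theorem game_eq (E : DetEnc) {A : Adversary} (hA : A.IsAdmissible) (κ n : ℕ)
    (hn : ∀ d ∈ (A.choose.output noOracle (Data.unary κ)).support,
      (columns (readChallenge d.fst).schema).length ≤ n) :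
    game E A κ = (PMF.uniformOfFintype Bool).bind fun b =>
      (hybridGame E A κ (if b = true then n else 0)).map fun t => decide (t = b) := by
  unfold game hybridGame
  simp only [PMF.map_bind]
  rw [PMF.bind_comm]
  refine bind_congr_of_mem_support fun d hd => ?_
  have hv := hA κ d hd
  rw [PMF.bind_comm]
  congr 1
  funext b
  simp only [keyGenDET, PMF.bind_map]
  congr 1
  funext ks
  simp only [hybridAnswer, PMF.map_comp, Function.comp_apply]
  have hL : hybridLog (readChallenge d.fst) (if b = true then n else 0) =
      (readChallenge d.fst).log b := by
    cases b
    · exact hybridLog_zero hv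
    · exact hybridLog_of_le hv (hn d hd)
  rw [hL, encOracle_eq, view_eq]
  simp only [findIdx_sameClass]
  rfl

theorem winProb_eq (E : DetEnc) {A : Adversary} (hA : A.IsAdmissible) (κ n : ℕ)
    (hn : ∀ d ∈ (A.choose.output noOracle (Data.unary κ)).support,
      (columns (readChallenge d.fst).schema).length ≤ n) :
    winProb E A κ = 1 / 2 +
      ((hybridGame E A κ n true).toReal - (hybridGame E A κ 0 true).toReal) / 2 := by
  have h1 : (hybridGame E A κ n).map (fun t => decide (t = true)) = hybridGame E A κ n := by
    simp only [Bool.decide_eq_true]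
    exact PMF.map_id _
  have h2 : ((hybridGame E A κ 0).map fun t => decide (t = false)) true =
      hybridGame E A κ 0 false := by
    rw [PMF.map_apply, tsum_bool]
    simp
  have h3 : hybridGame E A κ 0 false + hybridGame E A κ 0 true = 1 := by
    rw [← (hybridGame E A κ 0).tsum_coe, tsum_bool]
  have h4 : (hybridGame E A κ 0 false).toReal + (hybridGame E A κ 0 true).toReal = 1 := by
    rw [← ENNReal.toReal_add (PMF.apply_ne_top _ _) (PMF.apply_ne_top _ _), h3]
    rfl
  rw [winProb, game_eq E hA κ n hn, PMF.bind_apply, tsum_bool]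
  simp only [PMF.uniformOfFintype_apply, Fintype.card_bool, Bool.false_eq_true, if_false, if_true,
    h1, h2]
  rw [ENNReal.toReal_add (ENNReal.mul_ne_top (by simp) (PMF.apply_ne_top _ _))
    (ENNReal.mul_ne_top (by simp) (PMF.apply_ne_top _ _)), ENNReal.toReal_mul, ENNReal.toReal_mul]
  simp only [Nat.cast_ofNat, ENNReal.toReal_inv, ENNReal.toReal_ofNat]
  linarith

/-! ### Negligible functions -/

theorem eval_le_mul_pow (T : Polynomial ℕ) {κ : ℕ} (hκ : 1 ≤ κ) :
    T.eval κ ≤ T.eval 1 * κ ^ T.natDegree := by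
  rw [Polynomial.eval_eq_sum_range, Polynomial.eval_eq_sum_range, Finset.sum_mul]
  refine Finset.sum_le_sum fun i hi => ?_
  rw [one_pow, mul_one]
  exact Nat.mul_le_mul_left _ (Nat.pow_le_pow_right hκ (by simpa [Nat.lt_succ_iff] using hi))

/-- A polynomial multiple of a sum of two negligible functions is negligible. -/
theorem Negligible.polynomial_mul_add {f g : ℕ → ℝ} (hf : Negligible f) (hg : Negligible g)
    (T : Polynomial ℕ) : Negligible fun κ => ((T.eval κ : ℕ) : ℝ) * (f κ + g κ) := by
  intro c
  obtain ⟨K, hK⟩ := hf (c + T.natDegree + 1)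
  obtain ⟨K', hK'⟩ := hg (c + T.natDegree + 1)
  refine ⟨max (max K K') (2 * T.eval 1 + 1), fun κ hκ => ?_⟩
  have h1 : K < κ := by omega
  have h2 : K' < κ := by omega
  have h3 : 2 * T.eval 1 < κ := by omega
  have h4 := hK κ h1
  have h5 := hK' κ h2
  have hκ0 : (0 : ℝ) < κ := by exact_mod_cast (by omega : 0 < κ)
  have h6 : ((T.eval κ : ℕ) : ℝ) ≤ T.eval 1 * (κ : ℝ) ^ T.natDegree := by
    exact_mod_cast eval_le_mul_pow T (by omega)
  have h7 : (2 * T.eval 1 : ℝ) < κ := by exact_mod_cast h3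
  have h8 : f κ + g κ ≤ 2 / (κ : ℝ) ^ (c + T.natDegree + 1) := by
    have : (2 : ℝ) / (κ : ℝ) ^ (c + T.natDegree + 1) = 1 / (κ : ℝ) ^ (c + T.natDegree + 1) +
      1 / (κ : ℝ) ^ (c + T.natDegree + 1) := by ring
    linarith
  calc ((T.eval κ : ℕ) : ℝ) * (f κ + g κ)
      ≤ ((T.eval κ : ℕ) : ℝ) * (2 / (κ : ℝ) ^ (c + T.natDegree + 1)) := by gcongr
    _ ≤ T.eval 1 * (κ : ℝ) ^ T.natDegree * (2 / (κ : ℝ) ^ (c + T.natDegree + 1)) := by gcongr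
    _ = (2 * T.eval 1) / κ * (1 / (κ : ℝ) ^ c) := by
      rw [pow_succ, pow_add]
      field_simp
    _ < 1 * (1 / (κ : ℝ) ^ c) := by
      gcongr
      rwa [div_lt_one hκ0]
    _ = 1 / (κ : ℝ) ^ c := one_mul _

/-! ### Acceptance probabilities of the distinguishers, and security -/

/-- The number of columns that the adversary chooses is bounded by a polynomial. -/
theorem exists_columns_le {A : Adversary} (hA : A.IsPPT) : ∃ N : Polynomial ℕ, ∀ κ,
    ∀ d ∈ (A.choose.output noOracle (Data.unary κ)).support,
      (columns (readChallenge d.fst).schema).length ≤ N.eval κ := by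
  have h : PolyRand fun (_ : Data → Data) (x : Data) => (A.choose.output noOracle x).map fun d =>
      columns (readChallenge d.fst).schema :=
    (PolyRand.of_polyTime hA.1).map (by fun_prop)
  obtain ⟨T, hT⟩ := h.size_le 1
  refine ⟨T.comp (2 * Polynomial.X + 1), fun κ d hd => (length_le_size _).trans ?_⟩
  have h2 := hT noOracle (2 * κ + 1) (Data.unary κ) (oracleBdd_noOracle _) (size_enc_nat κ).le
    (columns (readChallenge d.fst).schema)
    ((PMF.mem_support_map_iff _ _ _).mpr ⟨d, hd, rfl⟩)
  simpa using h2

theorem acceptProb_eq_tsum {E : DetEnc} {A : Adversary} {N : Polynomial ℕ} {b : ℕ} {B : Prog}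
    (hB : ∀ f x, B.output (strOracle f) x = (samples E A N x).bind fun s =>
      A.guess.output (encOracleWith (s.cellEnc E f) s.challenge)
        (s.guessInput (s.cellEnc E f) (s.2 + b))) (f : Str → Str) (x : Data) :
    B.acceptProb (strOracle f) x =
      ∑' s, samples E A N x s * s.accept E A f (s.2 + b) := by
  rw [Prog.acceptProb, hB, PMF.map_bind, PMF.bind_apply]
  rfl

theorem prfIdeal_eq_tsum {E : DetEnc} {A : Adversary} {N : Polynomial ℕ} {b : ℕ} {B : Prog}
    (hB : ∀ f x, B.output (strOracle f) x = (samples E A N x).bind fun s =>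
      A.guess.output (encOracleWith (s.cellEnc E f) s.challenge)
        (s.guessInput (s.cellEnc E f) (s.2 + b))) (κ : ℕ) :
    E.prfIdeal B κ = ∑' s, samples E A N (Data.unary κ) s *
      ∫⁻ ω, s.accept E A (randomFunction (E.outLen κ) ω) (s.2 + b) ∂fairBits := by
  simp only [DetEnc.prfIdeal, acceptProb_eq_tsum hB]
  rw [lintegral_tsum fun s => ((measurable_accept E A s _ _).const_mul _).aemeasurable]
  exact tsum_congr fun s => lintegral_const_mul _ (measurable_accept E A s _ _)

theorem challenge_valid_of_mem_samples {E : DetEnc} {A : Adversary} (hA : A.IsAdmissible)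
    {N : Polynomial ℕ} {κ : ℕ} {s : Sample} (hs : s ∈ (samples E A N (Data.unary κ)).support) :
    s.challenge.Valid := by
  simp only [samples, PMF.mem_support_bind_iff, PMF.mem_support_map_iff] at hs
  obtain ⟨d, hd, ks, -, j, -, rfl⟩ := hs
  exact hA κ d hd

/-- The real acceptance probability of the distinguisher is the average over `2 ^ m` hybrids. -/
theorem prfReal_eq {E : DetEnc} {A : Adversary} {N : Polynomial ℕ} {b : ℕ} {B : Prog}
    (hB : ∀ f x, B.output (strOracle f) x = (samples E A N x).bind fun s =>
      A.guess.output (encOracleWith (s.cellEnc E f) s.challenge)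
        (s.guessInput (s.cellEnc E f) (s.2 + b))) (κ : ℕ) :
    (2 : ℝ) ^ doublings (N.eval κ) (N.eval κ) * (E.prfReal B κ).toReal =
      ∑ j ∈ Finset.range (2 ^ doublings (N.eval κ) (N.eval κ)),
        (hybridGame E A κ (j + b) true).toReal := by
  have h := dyadic_bind_apply (doublings (N.eval κ) (N.eval κ))
    (fun j => hybridGame E A κ (j + b)) true
  rw [← keyDist_bind_samples] at h
  have h2 := congrArg ENNReal.toReal h
  rw [ENNReal.toReal_mul, ENNReal.toReal_pow, ENNReal.toReal_ofNat,
    ENNReal.toReal_sum fun j _ => PMF.apply_ne_top _ _] at h2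
  rw [← h2, DetEnc.prfReal]
  simp only [hB, PMF.map_bind]

theorem indCplaDetSecure_of_isPRF {E : DetEnc} (hE : E.IsPRF) : IndCplaDetSecure E := by
  intro A hA hA'
  obtain ⟨N, hN⟩ := exists_columns_le hA
  obtain ⟨B₀, hB₀, h₀⟩ := exists_distinguisher E hA N 0
  obtain ⟨B₁, hB₁, h₁⟩ := exists_distinguisher E hA N 1
  refine ⟨_, (hE B₁ hB₁).polynomial_mul_add (hE B₀ hB₀) (2 * N + 1), fun κ => ?_⟩
  have hideal : E.prfIdeal B₁ κ = E.prfIdeal B₀ κ := by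
    rw [prfIdeal_eq_tsum h₁, prfIdeal_eq_tsum h₀]
    refine tsum_congr fun s => ?_
    by_cases hs : samples E A N (Data.unary κ) s = 0
    · rw [hs, zero_mul, zero_mul]
    · rw [← lintegral_accept_succ E A s _
        (challenge_valid_of_mem_samples hA' ((PMF.mem_support_iff _ _).mpr hs))]
      rfl
  set m := doublings (N.eval κ) (N.eval κ)
  have htel : (2 : ℝ) ^ m * ((E.prfReal B₁ κ).toReal - (E.prfReal B₀ κ).toReal) =
      (hybridGame E A κ (2 ^ m) true).toReal - (hybridGame E A κ 0 true).toReal := by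
    rw [mul_sub, prfReal_eq h₁, prfReal_eq h₀, ← Finset.sum_sub_distrib]
    exact Finset.sum_range_sub (fun j => (hybridGame E A κ j true).toReal) (2 ^ m)
  rw [winProb_eq E hA' κ (2 ^ m) fun d hd => (hN κ d hd).trans (le_two_pow_doublings _), ← htel]
  have hpow : (2 : ℝ) ^ m ≤ (((2 * N + 1 : Polynomial ℕ).eval κ : ℕ) : ℝ) := by
    have h : 2 ^ m ≤ 2 * N.eval κ + 1 := two_pow_doublings_le (N.eval κ) (N.eval κ)
    have h' : (2 * N + 1 : Polynomial ℕ).eval κ = 2 * N.eval κ + 1 := by simp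
    rw [h']
    exact_mod_cast h
  have hadv : (E.prfReal B₁ κ).toReal - (E.prfReal B₀ κ).toReal ≤
      |(E.prfReal B₁ κ).toReal - (E.prfIdeal B₁ κ).toReal| +
        |(E.prfReal B₀ κ).toReal - (E.prfIdeal B₀ κ).toReal| := by
    rw [hideal]
    have h1 := le_abs_self ((E.prfReal B₁ κ).toReal - (E.prfIdeal B₀ κ).toReal)
    have h2 := neg_abs_le ((E.prfReal B₀ κ).toReal - (E.prfIdeal B₀ κ).toReal)
    linarith
  have hnonneg := (abs_nonneg ((E.prfReal B₁ κ).toReal - (E.prfIdeal B₁ κ).toReal)).trans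
    (le_add_of_nonneg_right (abs_nonneg ((E.prfReal B₀ κ).toReal - (E.prfIdeal B₀ κ).toReal)))
  have h3 := mul_le_mul_of_nonneg_left hadv (by positivity : (0 : ℝ) ≤ 2 ^ m)
  have h4 := mul_le_mul_of_nonneg_right hpow hnonneg
  have h5 : (0 : ℝ) ≤ 2 ^ m * (|(E.prfReal B₁ κ).toReal - (E.prfIdeal B₁ κ).toReal| +
        |(E.prfReal B₀ κ).toReal - (E.prfIdeal B₀ κ).toReal|) := by positivity
  linarith

end Eunomia

theorem theorem2 (E : Eunomia.DetEnc) (hE : E.IsPRF) : Eunomia.IndCplaDetSecure E :=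
  Eunomia.indCplaDetSecure_of_isPRF hE
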